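/- **Definitions.** A mixed Hodge structure (MHS) $H$ is a finitely generated abelian group $H_{\mathbb Z}$ with a finite increasing filtration $W$ of $H_{\mathbb Q}=H_{\mathbb Z}\otimes\mathbb Q$ and a finite decreasing filtration $F$ of $H_{\mathbb C}=H_{\mathbb Z}\otimes\mathbb C$ such that $F$ and $\overline F$ induce $k$-opposed filtrations on $\mathrm{Gr}^W_k H_{\mathbb C}$ for every $k$; it is torsion-free if $H_{\mathbb Z}$ is. $\mathrm{Ext}^1_{\sf MHS}(B,A)$ is the group, under Baer sum, of equivalence classes of extensions $0\to A\to H\to B\to 0$ of MHS. **Proposition.** Let $p\in\mathbb Z$, and let $A,B$ be torsion-free mixed Hodge structures with $B$ pure of weight $2p$ and $A$ of weights $\le 2p-1$ (that is, $W_{2p-1}A_{\mathbb Q}=A_{\mathbb Q}$). Put $B^{p,p}_{\mathbb Z}=\{b\in B_{\mathbb Z}: b\otimes 1\in F^pB_{\mathbb C}\cap\overline{F^pB_{\mathbb C}}\}$, regarded as a pure Hodge structure of type $(p,p)$ with inclusion $i:B^{p,p}_{\mathbb Z}\to B$, and $J^p(A)=A_{\mathbb C}/(F^pA_{\mathbb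 C}+A_{\mathbb Z})$. For an extension $0\to A\to H\to\mathbb Z(-p)\to 0$ choose lifts $h\in H_{\mathbb Z}$ and $f\in F^pH_{\mathbb C}$ of the generator $1$ of $\mathbb Z(-p)$, and let $c([H])\in J^p(A)$ be the class of $f-h\in A_{\mathbb C}$. Then: 1. $c:\mathrm{Ext}^1_{\sf MHS}(\mathbb Z(-p),A)\to J^p(A)$ is an isomorphism of groups. 2. For $C\in\{B,\,B^{p,p}_{\mathbb Z}\}$ and $\theta\in W_0\mathrm{Hom}(C,A)_{\mathbb C}$ (the $\mathbb C$-linear maps $C_{\mathbb C}\to A_{\mathbb C}$ respecting $W$) let $H_\theta$ be the extension with lattice $A_{\mathbb Z}\oplus C_{\mathbb Z}$, weight filtration $W_kA\oplus W_kC$ and Hodge filtration $F^k_\theta=\{(a+\theta(b),b): a\in F^kA_{\mathbb C},\ b\in F^kC_{\mathbb C}\}$. The groups $\mathrm{Ext}^1_{\sf MHS}(B,A)$, $\mathrm{Ext}^1_{\sf MHS}(B^{p,p}_{\mathbb Z},A)$ and $\mathrm{Hom}_{\mathbb Z}(B^{p,p}_{\mathbb Z},J^p(A))$ carry (unique) complex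 Lie group structures for which the maps $\theta\mapsto[H_\theta]$ from $W_0\mathrm{Hom}(B,A)_{\mathbb C}$ and $W_0\mathrm{Hom}(B^{p,p}_{\mathbb Z},A)_{\mathbb C}$, respectively the map $\mathrm{Hom}_{\mathbb Z}(B^{p,p}_{\mathbb Z},A_{\mathbb C})\to\mathrm{Hom}_{\mathbb Z}(B^{p,p}_{\mathbb Z},J^p(A))$ induced by $A_{\mathbb C}\to J^p(A)$, are surjective holomorphic submersions. 3. An element $b\in B^{p,p}_{\mathbb Z}$ defines morphisms $\mathbb Z(-p)\to B$ and $\mathbb Z(-p)\to B^{p,p}_{\mathbb Z}$, $1\mapsto b$, both denoted by $b$. The formulas $\gamma(x)(b)=c(b^*x)$ and $\bar\gamma(y)(b)=c(b^*y)$, where $b^*$ is pullback of extensions, together with pullback $i^*$ along $i$, define homomorphisms of complex Lie groups $$\gamma:\mathrm{Ext}^1_{\sf MHS}(B,A)\to\mathrm{Hom}_{\mathbb Z}(B^{p,p}_{\mathbb Z},J^p(A)),\quad \bar\gamma:\mathrm{Ext}^1_{\sf MHS}(B^{p,p}_{\mathbb Z},A)\to\mathrm{Hom}_{\mathbb Z}(B^{p,p}_{\mathbb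 Z},J^p(A)),$$ $$i^*:\mathrm{Ext}^1_{\sf MHS}(B,A)\to\mathrm{Ext}^1_{\sf MHS}(B^{p,p}_{\mathbb Z},A)$$ such that $\gamma=\bar\gamma\circ i^*$; moreover $\bar\gamma$ is an isomorphism of complex Lie groups and $i^*$ is surjective. -/

import Mathlib

open scoped TensorProduct ContDiff Manifold

universe u

namespace HodgeExt

section Filtrations

variable {V V' : Type*} [AddCommGroup V] [Module ℂ V] [AddCommGroup V'] [Module ℂ V']

/-- The filtration induced by a subspace `S` on the graded piece `W k / W (k - 1)`. -/
def grSub (W : ℤ → Submodule ℂ V) (k : ℤ) (S : Submodule ℂ V) :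
    Submodule ℂ (W k ⧸ (W (k - 1)).submoduleOf (W k)) :=
  (S.submoduleOf (W k)).map ((W (k - 1)).submoduleOf (W k)).mkQ

/-- Three finite opposed filtrations, unwound elementwise. -/
structure Opposed (W F G : ℤ → Submodule ℂ V) : Prop where
  W_mono : Monotone W
  F_anti : Antitone F
  G_anti : Antitone G
  W_bot : ∃ k, W k = ⊥
  W_top : ∃ k, W k = ⊤
  F_bot : ∃ k, F k = ⊥
  F_top : ∃ k, F k = ⊤
  G_bot : ∃ k, G k = ⊥
  G_top : ∃ k, G k = ⊤
  span : ∀ k p q, p + q = k + 1 → ∀ x ∈ W k, ∃ y z, y ∈ F p ∧ y ∈ W k ∧ z ∈ G q ∧ z ∈ W k ∧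
    x - y - z ∈ W (k - 1)
  disj : ∀ k p q, p + q = k + 1 → ∀ x y, x ∈ F p → x ∈ W k → y ∈ G q → y ∈ W k →
    x - y ∈ W (k - 1) → x ∈ W (k - 1)

theorem isCompl_grSub_iff {W : ℤ → Submodule ℂ V} {k : ℤ} (S T : Submodule ℂ V) :
    IsCompl (grSub W k S) (grSub W k T) ↔
      (∀ x ∈ W k, ∃ y z, y ∈ S ∧ y ∈ W k ∧ z ∈ T ∧ z ∈ W k ∧ x - y - z ∈ W (k - 1)) ∧
      (∀ x y, x ∈ S → x ∈ W k → y ∈ T → y ∈ W k → x - y ∈ W (k - 1) → x ∈ W (k - 1)) := by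
  constructor
  · intro h
    constructor
    · intro x hx
      have h1 : ((W (k - 1)).submoduleOf (W k)).mkQ ⟨x, hx⟩ ∈ grSub W k S ⊔ grSub W k T := by
        rw [h.sup_eq_top]; trivial
      obtain ⟨_, ⟨y, hy, rfl⟩, _, ⟨z, hz, rfl⟩, e⟩ := Submodule.mem_sup.1 h1
      refine ⟨y, z, hy, y.2, hz, z.2, ?_⟩
      rw [← map_add, eq_comm, ← sub_eq_zero, ← map_sub] at e
      have := (Submodule.Quotient.mk_eq_zero _).1 e
      have h2 : x - (y + z : V) ∈ W (k - 1) := this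
      rwa [← sub_sub] at h2
    · intro x y hx hxk hy hyk hxy
      have e : ((W (k - 1)).submoduleOf (W k)).mkQ ⟨x, hxk⟩ =
          ((W (k - 1)).submoduleOf (W k)).mkQ ⟨y, hyk⟩ := by
        rw [← sub_eq_zero, ← map_sub]
        exact (Submodule.Quotient.mk_eq_zero _).2 hxy
      have h1 : ((W (k - 1)).submoduleOf (W k)).mkQ ⟨x, hxk⟩ ∈ grSub W k S ⊓ grSub W k T :=
        ⟨⟨⟨x, hxk⟩, hx, rfl⟩, ⟨⟨y, hyk⟩, hy, e.symm⟩⟩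
      rw [h.inf_eq_bot] at h1
      have h2 := (Submodule.Quotient.mk_eq_zero _).1 ((Submodule.mem_bot ℂ).1 h1)
      exact h2
  · rintro ⟨h1, h2⟩
    constructor
    · rw [Submodule.disjoint_def]
      rintro _ ⟨x, hx, rfl⟩ ⟨y, hy, e⟩
      rw [eq_comm, ← sub_eq_zero, ← map_sub] at e
      have e' := (Submodule.Quotient.mk_eq_zero _).1 e
      have h3 := h2 x y hx x.2 hy y.2 e'
      exact (Submodule.Quotient.mk_eq_zero _).2 h3
    · rw [codisjoint_iff, eq_top_iff]
      intro x _
      obtain ⟨x, rfl⟩ := Submodule.mkQ_surjective _ x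
      obtain ⟨y, z, hy, hyk, hz, hzk, e⟩ := h1 x x.2
      refine Submodule.mem_sup.2 ⟨_, ⟨⟨y, hyk⟩, hy, rfl⟩, _, ⟨⟨z, hzk⟩, hz, rfl⟩, ?_⟩
      rw [← map_add, eq_comm, ← sub_eq_zero, ← map_sub]
      refine (Submodule.Quotient.mk_eq_zero _).2 ?_
      change (x - (y + z) : V) ∈ W (k - 1)
      rwa [← sub_sub]

/-- Tail of the correction term in the Deligne splitting. -/
def delTail (W G : ℤ → Submodule ℂ V) (q k : ℤ) (n : ℕ) : Submodule ℂ V :=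
  ⨆ j : ℕ, G (q - (n + j : ℕ)) ⊓ W (k - 1 - (n + j : ℕ))

/-- The Deligne splitting `I^{p,q}`, with `k = p + q`. -/
def delI (W F G : ℤ → Submodule ℂ V) (p q : ℤ) : Submodule ℂ V :=
  (F p ⊓ W (p + q)) ⊓ ((G q ⊓ W (p + q)) ⊔ delTail W G q (p + q) 0)

theorem delTail_eq (W G : ℤ → Submodule ℂ V) (q k : ℤ) (n : ℕ) :
    delTail W G q k n = (G (q - n) ⊓ W (k - 1 - n)) ⊔ delTail W G q k (n + 1) := by
  unfold delTail
  rw [← sup_iSup_nat_succ]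
  simp only [add_zero]
  congr 1
  refine iSup_congr fun j => ?_
  rw [show n + (j + 1) = n + 1 + j by ring]

theorem delTail_le {W G : ℤ → Submodule ℂ V} (hW : Monotone W) (q k : ℤ) (n : ℕ) :
    delTail W G q k n ≤ W (k - 1 - n) :=
  iSup_le fun j => inf_le_right.trans (hW (by push_cast; omega))

theorem delTail_anti (W G : ℤ → Submodule ℂ V) (q k : ℤ) (n : ℕ) :
    delTail W G q k n ≤ delTail W G q k 0 := by
  induction n with
  | zero => exact le_rfl
  | succ n ih => exact le_trans (by rw [delTail_eq W G q k n]; exact le_sup_right) ih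

variable {W F G : ℤ → Submodule ℂ V} {W' F' G' : ℤ → Submodule ℂ V'}

theorem Opposed.delI_inf (h : Opposed W F G) {p q : ℤ} {x : V} (hx : x ∈ delI W F G p q)
    (hx' : x ∈ W (p + q - 1)) : x = 0 := by
  obtain ⟨⟨hF, hWx⟩, hD⟩ := hx
  have key : ∀ n : ℕ, x ∈ W (p + q - 1 - n) ∧ x ∈ delTail W G q (p + q) n := by
    intro n
    induction n with
    | zero =>
      refine ⟨by simpa using hx', ?_⟩
      obtain ⟨b, ⟨hb, hb'⟩, d, hd, rfl⟩ := Submodule.mem_sup.1 hD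
      have hd1 := delTail_le h.W_mono _ _ _ hd
      simp only [Nat.cast_zero, sub_zero] at hd1
      refine add_mem ?_ hd
      rw [delTail_eq]
      refine Submodule.mem_sup_left ⟨by simpa using hb, ?_⟩
      simpa using (Submodule.add_mem_iff_left _ hd1).1 hx'
    | succ n ih =>
      obtain ⟨h1, h2⟩ := ih
      rw [delTail_eq] at h2
      obtain ⟨b, ⟨hb, hb'⟩, d, hd, e⟩ := Submodule.mem_sup.1 h2
      have hd1 := delTail_le h.W_mono _ _ _ hd
      have e1 : p + q - 1 - ((n + 1 : ℕ) : ℤ) = p + q - 1 - n - 1 := by push_cast; ring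
      have hxb : x - b = d := by rw [← e]; abel
      have hx2 : x ∈ W (p + q - 1 - n - 1) := by
        refine h.disj (p + q - 1 - n) p (q - n) (by ring) x b hF h1 hb hb' ?_
        rw [hxb, ← e1]; exact hd1
      refine ⟨by rwa [e1], ?_⟩
      rw [← e]
      refine add_mem ?_ hd
      rw [delTail_eq]
      refine Submodule.mem_sup_left ⟨h.G_anti (by push_cast; omega) hb, ?_⟩
      have : b = x - d := by rw [← e]; abel
      rw [this]
      exact sub_mem (by rwa [e1]) hd1
  obtain ⟨k, hk⟩ := h.W_bot
  have := (key (p + q - 1 - k).toNat).1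
  have h2 := h.W_mono (show p + q - 1 - ((p + q - 1 - k).toNat : ℤ) ≤ k by omega) this
  rwa [hk, Submodule.mem_bot] at h2

theorem Opposed.exists_delI (h : Opposed W F G) {p q : ℤ} {a b : V} (ha : a ∈ F p)
    (ha' : a ∈ W (p + q)) (hb : b ∈ G q) (hb' : b ∈ W (p + q)) (hab : a - b ∈ W (p + q - 1)) :
    ∃ i ∈ delI W F G p q, a - i ∈ W (p + q - 1) := by
  have key : ∀ n : ℕ, ∃ c d, c ∈ F p ∧ c ∈ W (p + q) ∧
      d ∈ (G q ⊓ W (p + q)) ⊔ delTail W G q (p + q) 0 ∧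
      c - d ∈ W (p + q - 1 - n) ∧ a - c ∈ W (p + q - 1) := by
    intro n
    induction n with
    | zero => exact ⟨a, b, ha, ha', Submodule.mem_sup_left ⟨hb, hb'⟩, by simpa using hab, by simp⟩
    | succ n ih =>
      obtain ⟨c, d, hc, hc', hd, hcd, hac⟩ := ih
      obtain ⟨y, z, hy, hy', hz, hz', e⟩ := h.span (p + q - 1 - n) p (q - n) (by ring) _ hcd
      refine ⟨c - y, d + z, sub_mem hc hy, sub_mem hc' (h.W_mono (by omega) hy'),
        add_mem hd (Submodule.mem_sup_right (delTail_anti _ _ _ _ n ?_)), ?_, ?_⟩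
      · rw [delTail_eq]; exact Submodule.mem_sup_left ⟨hz, hz'⟩
      · rw [show p + q - 1 - ((n + 1 : ℕ) : ℤ) = p + q - 1 - n - 1 by push_cast; ring,
          show c - y - (d + z) = c - d - y - z by abel]
        exact e
      · rw [show a - (c - y) = a - c + y by abel]
        exact add_mem hac (h.W_mono (by omega) hy')
  obtain ⟨k, hk⟩ := h.W_bot
  obtain ⟨c, d, hc, hc', hd, hcd, hac⟩ := key (p + q - 1 - k).toNat
  have h2 := h.W_mono (show p + q - 1 - ((p + q - 1 - k).toNat : ℤ) ≤ k by omega) hcd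
  rw [hk, Submodule.mem_bot, sub_eq_zero] at h2
  subst h2
  exact ⟨c, ⟨⟨hc, hc'⟩, hd⟩, hac⟩

/-- The subspace `F^r ∩ W_m + W_{m-1}`. -/
def fstep (W F : ℤ → Submodule ℂ V) (r m : ℤ) : Submodule ℂ V := (F r ⊓ W m) ⊔ W (m - 1)

theorem Opposed.peel (h : Opposed W F G) {r m : ℤ} {x : V} (hx : x ∈ fstep W F r m) :
    ∃ i ∈ delI W F G r (m - r), x - i ∈ fstep W F (r + 1) m := by
  obtain ⟨y, ⟨hy, hy'⟩, w, hw, rfl⟩ := Submodule.mem_sup.1 hx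
  obtain ⟨u, v, hu, hu', hv, hv', e⟩ := h.span m (r + 1) (m - r) (by ring) y hy'
  have em : r + (m - r) = m := by ring
  obtain ⟨i, hi, e'⟩ := h.exists_delI (p := r) (q := m - r) (a := y - u) (b := v)
    (sub_mem hy (h.F_anti (by omega) hu)) (by rw [em]; exact sub_mem hy' hu') hv
    (by rwa [em]) (by rwa [em])
  refine ⟨i, hi, ?_⟩
  rw [em] at e'
  rw [show y + w - i = u + (y - u - i + w) by abel]
  exact add_mem (Submodule.mem_sup_left ⟨hu, hu'⟩) (Submodule.mem_sup_right (add_mem e' hw))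

theorem Opposed.delI_fstep (h : Opposed W F G) {r m : ℤ} {x : V} (hx : x ∈ delI W F G r (m - r))
    (hx' : x ∈ fstep W F (r + 1) m) : x = 0 := by
  have em : r + (m - r) = m := by ring
  have hI := hx
  refine h.delI_inf hx ?_
  obtain ⟨⟨hF, hWx⟩, hD⟩ := hx
  rw [em] at hWx hD ⊢
  obtain ⟨u, ⟨hu, hu'⟩, w, hw, e⟩ := Submodule.mem_sup.1 hx'
  obtain ⟨b, ⟨hb, hb'⟩, d, hd, e'⟩ := Submodule.mem_sup.1 hD
  have hd1 := delTail_le h.W_mono _ _ _ hd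
  simp only [Nat.cast_zero, sub_zero] at hd1
  have := h.disj m (r + 1) (m - r) (by ring) u b hu hu' hb hb' (by
    rw [show u - b = d - w from by rw [sub_eq_sub_iff_add_eq_add, e, ← e', add_comm]]
    exact sub_mem hd1 hw)
  rw [← e]
  exact add_mem this hw

theorem delI_map (f : V →ₗ[ℂ] V') (hW : ∀ k, ∀ x ∈ W k, f x ∈ W' k)
    (hF : ∀ k, ∀ x ∈ F k, f x ∈ F' k) (hG : ∀ k, ∀ x ∈ G k, f x ∈ G' k) {p q : ℤ} {x : V}
    (hx : x ∈ delI W F G p q) : f x ∈ delI W' F' G' p q := by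
  obtain ⟨⟨h1, h2⟩, h3⟩ := hx
  refine ⟨⟨hF _ _ h1, hW _ _ h2⟩, ?_⟩
  have : (G q ⊓ W (p + q)) ⊔ delTail W G q (p + q) 0 ≤
      Submodule.comap f ((G' q ⊓ W' (p + q)) ⊔ delTail W' G' q (p + q) 0) := by
    refine sup_le (fun y hy => Submodule.mem_sup_left ⟨hG _ _ hy.1, hW _ _ hy.2⟩) ?_
    refine iSup_le fun j y hy => Submodule.mem_sup_right ?_
    exact Submodule.mem_iSup_of_mem (p := fun j : ℕ =>
      G' (q - (0 + j : ℕ)) ⊓ W' (p + q - 1 - (0 + j : ℕ))) j ⟨hG _ _ hy.1, hW _ _ hy.2⟩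
  exact this h3

/-- Induction along the Deligne splitting. -/
theorem Opposed.induction (h : Opposed W F G) {P : V → Prop} (h0 : P 0)
    (step : ∀ r m, ∀ i ∈ delI W F G r (m - r), ∀ y ∈ fstep W F (r + 1) m, P y → P (i + y))
    (x : V) : P x := by
  obtain ⟨k0, hk0⟩ := h.W_bot
  obtain ⟨k1, hk1⟩ := h.W_top
  obtain ⟨p0, hp0⟩ := h.F_top
  obtain ⟨p1, hp1⟩ := h.F_bot
  have key : ∀ n : ℕ, ∀ x ∈ W (k0 + n), P x := by
    intro n
    induction n with
    | zero => intro x hx; rw [Nat.cast_zero, add_zero, hk0, Submodule.mem_bot] at hx; rwa [hx]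
    | succ n ih =>
      have e : k0 + ((n + 1 : ℕ) : ℤ) - 1 = k0 + n := by push_cast; ring
      have key2 : ∀ j : ℕ, ∀ x ∈ fstep W F (p1 - j) (k0 + (n + 1 : ℕ)), P x := by
        intro j
        induction j with
        | zero =>
          intro x hx
          refine ih x ?_
          rw [fstep, Nat.cast_zero, sub_zero, hp1, bot_inf_eq, bot_sup_eq, e] at hx
          exact hx
        | succ j ihj =>
          intro x hx
          obtain ⟨i, hi, hi'⟩ := h.peel hx
          have e2 : p1 - ((j + 1 : ℕ) : ℤ) + 1 = p1 - j := by push_cast; ring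
          have := step _ _ i hi _ hi' (ihj _ (by rwa [e2] at hi'))
          rwa [add_sub_cancel] at this
      intro x hx
      refine key2 (p1 - p0).toNat x (Submodule.mem_sup_left ⟨?_, hx⟩)
      have := h.F_anti (show p1 - ((p1 - p0).toNat : ℤ) ≤ p0 by omega)
      rw [hp0] at this
      exact this trivial
  refine key (k1 - k0).toNat x ?_
  have := h.W_mono (show k1 ≤ k0 + ((k1 - k0).toNat : ℤ) by omega)
  rw [hk1] at this
  exact this trivial

theorem fstep_le (h : Opposed W F G) {r m : ℤ} : fstep W F r m ≤ W m :=
  sup_le inf_le_right (h.W_mono (by omega))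

/-- Morphisms of opposed filtrations are bistrict. -/
theorem Opposed.strict (h : Opposed W F G) (h' : Opposed W' F' G') (f : V →ₗ[ℂ] V')
    (hW : ∀ k, ∀ x ∈ W k, f x ∈ W' k)
    (hF : ∀ k, ∀ x ∈ F k, f x ∈ F' k) (hG : ∀ k, ∀ x ∈ G k, f x ∈ G' k) {p k : ℤ} (x : V)
    (hx : f x ∈ F' p) (hx' : f x ∈ W' k) : ∃ y ∈ F p, y ∈ W k ∧ f y = f x := by
  revert hx hx'
  refine h.induction (P := fun x => f x ∈ F' p → f x ∈ W' k → ∃ y ∈ F p, y ∈ W k ∧ f y = f x)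
    (fun _ _ => ⟨0, zero_mem _, zero_mem _, rfl⟩) ?_ x
  intro r m i hi y hy ih hx hx'
  have em : r + (m - r) = m := by ring
  by_cases hc : p ≤ r ∧ m ≤ k
  · have hiF : i ∈ F p := h.F_anti hc.1 hi.1.1
    have hiW : i ∈ W k := h.W_mono (by omega) hi.1.2
    obtain ⟨z, hz, hz', e⟩ := ih
      (by rw [map_add] at hx; exact (Submodule.add_mem_iff_right _ (hF _ _ hiF)).1 hx)
      (by rw [map_add] at hx'; exact (Submodule.add_mem_iff_right _ (hW _ _ hiW)).1 hx')
    exact ⟨i + z, add_mem hiF hz, add_mem hiW hz', by rw [map_add, map_add, e]⟩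
  · have hfy : f y ∈ fstep W' F' (r + 1) m := by
      obtain ⟨a, ha, b, hb, rfl⟩ := Submodule.mem_sup.1 hy
      rw [map_add]
      exact add_mem (Submodule.mem_sup_left ⟨hF _ _ ha.1, hW _ _ ha.2⟩)
        (Submodule.mem_sup_right (hW _ _ hb))
    have hfi := delI_map (W' := W') (F' := F') (G' := G') f hW hF hG hi
    have hfx : f (i + y) ∈ fstep W' F' (r + 1) m := by
      by_cases hm : m ≤ k
      · refine Submodule.mem_sup_left ⟨h'.F_anti (by omega) hx, ?_⟩
        rw [map_add]
        exact add_mem (h'.W_mono (by omega) hfi.1.2) (fstep_le h' hfy)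
      · exact Submodule.mem_sup_right (h'.W_mono (by omega) hx')
    have h0 : f i = 0 := h'.delI_fstep hfi (by
      have := sub_mem hfx hfy
      rwa [map_add, add_sub_cancel_right] at this)
    rw [map_add, h0, zero_add] at hx hx'
    rw [map_add, h0, zero_add]
    exact ih hx hx'

/-- The two filtrations on the cokernel of a morphism meet as expected. -/
theorem Opposed.coker_inf (h : Opposed W F G) (h' : Opposed W' F' G') (f : V →ₗ[ℂ] V')
    (hW : ∀ k, ∀ x ∈ W k, f x ∈ W' k)
    (hF : ∀ k, ∀ x ∈ F k, f x ∈ F' k) (hG : ∀ k, ∀ x ∈ G k, f x ∈ G' k) {p k : ℤ} (x : V)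
    (y w : V') (hy : y ∈ F' p) (hw : w ∈ W' k) (e : y - w = f x) :
    ∃ x', y - f x' ∈ F' p ∧ y - f x' ∈ W' k := by
  revert y w
  refine h.induction (P := fun x => ∀ y w : V', y ∈ F' p → w ∈ W' k → y - w = f x →
    ∃ x', y - f x' ∈ F' p ∧ y - f x' ∈ W' k) ?_ ?_ x
  · intro y w hy hw e
    rw [map_zero, sub_eq_zero] at e
    exact ⟨0, by simpa using hy, by simpa [e] using hw⟩
  · intro r m i hi z hz ih y w hy hw e
    have em : r + (m - r) = m := by ring
    have hfi := delI_map (W' := W') (F' := F') (G' := G') f hW hF hG hi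
    by_cases hm : m ≤ k
    · exact ih y (w + f i) hy (add_mem hw (h'.W_mono (by omega) hfi.1.2))
        (by rw [← sub_sub, e, map_add]; abel)
    by_cases hr : p ≤ r
    · obtain ⟨x', h1, h2⟩ := ih (y - f i) w (sub_mem hy (h'.F_anti hr hfi.1.1)) hw
        (by rw [sub_right_comm, e, map_add]; abel)
      exact ⟨i + x', by rwa [map_add, ← sub_sub], by rwa [map_add, ← sub_sub]⟩
    · have hfz : f z ∈ fstep W' F' (r + 1) m := by
        obtain ⟨a, ha, b, hb, rfl⟩ := Submodule.mem_sup.1 hz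
        rw [map_add]
        exact add_mem (Submodule.mem_sup_left ⟨hF _ _ ha.1, hW _ _ ha.2⟩)
          (Submodule.mem_sup_right (hW _ _ hb))
      have hw1 : w ∈ W' (m - 1) := h'.W_mono (by omega) hw
      have hy1 : y ∈ W' m := by
        rw [sub_eq_iff_eq_add.1 e, map_add]
        exact add_mem (add_mem (h'.W_mono (by omega) hfi.1.2) (fstep_le h' hfz))
          (h'.W_mono (by omega) hw1)
      have h0 : f i = 0 := h'.delI_fstep hfi (by
        have e2 : f i = y - w - f z := by rw [e, map_add]; abel
        rw [e2]
        exact sub_mem (sub_mem (Submodule.mem_sup_left ⟨h'.F_anti (by omega) hy, hy1⟩)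
          (Submodule.mem_sup_right hw1)) hfz)
      exact ih y w hy hw (by rw [e, map_add, h0, zero_add])

theorem Opposed.symm (h : Opposed W F G) : Opposed W G F where
  W_mono := h.W_mono
  F_anti := h.G_anti
  G_anti := h.F_anti
  W_bot := h.W_bot
  W_top := h.W_top
  F_bot := h.G_bot
  F_top := h.G_top
  G_bot := h.F_bot
  G_top := h.F_top
  span k p q hpq x hx := by
    obtain ⟨y, z, hy, hy', hz, hz', e⟩ := h.span k q p (by omega) x hx
    exact ⟨z, y, hz, hz', hy, hy', by rwa [sub_right_comm]⟩
  disj k p q hpq x y hx hx' hy hy' e := by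
    have e' : y - x ∈ W (k - 1) := by rw [← neg_sub x y]; exact neg_mem e
    have := h.disj k q p (by omega) y x hy hy' hx hx' e'
    rw [show x = y - (y - x) by abel]
    exact sub_mem this e'

theorem Opposed.ker {K : Type*} [AddCommGroup K] [Module ℂ K] (h : Opposed W F G)
    (h' : Opposed W' F' G') (f : V →ₗ[ℂ] V')
    (hW : ∀ k, ∀ x ∈ W k, f x ∈ W' k)
    (hF : ∀ k, ∀ x ∈ F k, f x ∈ F' k) (hG : ∀ k, ∀ x ∈ G k, f x ∈ G' k)
    (j : K →ₗ[ℂ] V) (hj : Function.Injective j) (hjf : Function.Exact j f) :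
    Opposed (fun k => (W k).comap j) (fun k => (F k).comap j) (fun k => (G k).comap j) where
  W_mono _ _ hk := Submodule.comap_mono (h.W_mono hk)
  F_anti _ _ hk := Submodule.comap_mono (h.F_anti hk)
  G_anti _ _ hk := Submodule.comap_mono (h.G_anti hk)
  W_bot := by
    obtain ⟨k, hk⟩ := h.W_bot
    exact ⟨k, by rw [hk]; exact LinearMap.ker_eq_bot.2 hj⟩
  W_top := by obtain ⟨k, hk⟩ := h.W_top; exact ⟨k, by rw [hk]; rfl⟩
  F_bot := by
    obtain ⟨k, hk⟩ := h.F_bot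
    exact ⟨k, by rw [hk]; exact LinearMap.ker_eq_bot.2 hj⟩
  F_top := by obtain ⟨k, hk⟩ := h.F_top; exact ⟨k, by rw [hk]; rfl⟩
  G_bot := by
    obtain ⟨k, hk⟩ := h.G_bot
    exact ⟨k, by rw [hk]; exact LinearMap.ker_eq_bot.2 hj⟩
  G_top := by obtain ⟨k, hk⟩ := h.G_top; exact ⟨k, by rw [hk]; rfl⟩
  span k p q hpq x hx := by
    obtain ⟨y, z, hy, hy', hz, hz', e⟩ := h.span k p q hpq (j x) hx
    have e0 : f (j x) = 0 := (hjf (j x)).2 ⟨x, rfl⟩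
    have e1 : f y - (- f z) ∈ W' (k - 1) := by
      have e2 := neg_mem (hW _ _ e)
      rw [map_sub, map_sub, e0] at e2
      convert e2 using 1
      abel
    have h1 := h'.disj k p q hpq _ _ (hF _ _ hy) (hW _ _ hy') (neg_mem (hG _ _ hz))
      (neg_mem (hW _ _ hz')) e1
    have h2 : f z ∈ W' (k - 1) := by
      rw [sub_neg_eq_add] at e1
      exact (Submodule.add_mem_iff_right _ h1).1 e1
    obtain ⟨y', hyF, hyW, ey⟩ := h.strict h' f hW hF hG y (hF _ _ hy) h1
    obtain ⟨z', hzG, hzW, ez⟩ := h.symm.strict h'.symm f hW hG hF z (hG _ _ hz) h2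
    obtain ⟨u, hu⟩ := (hjf (y - y')).1 (by rw [map_sub, ey, sub_self])
    obtain ⟨v, hv⟩ := (hjf (z - z')).1 (by rw [map_sub, ez, sub_self])
    refine ⟨u, v, ?_, ?_, ?_, ?_, ?_⟩
    · rw [Submodule.mem_comap, hu]; exact sub_mem hy hyF
    · rw [Submodule.mem_comap, hu]; exact sub_mem hy' (h.W_mono (by omega) hyW)
    · rw [Submodule.mem_comap, hv]; exact sub_mem hz hzG
    · rw [Submodule.mem_comap, hv]; exact sub_mem hz' (h.W_mono (by omega) hzW)
    · rw [Submodule.mem_comap, map_sub, map_sub, hu, hv,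
        show j x - (y - y') - (z - z') = j x - y - z + y' + z' by abel]
      exact add_mem (add_mem e hyW) hzW
  disj k p q hpq x y hx hx' hy hy' e :=
    h.disj k p q hpq (j x) (j y) hx hx' hy hy' (by rw [← map_sub]; exact e)

theorem Opposed.coker {C : Type*} [AddCommGroup C] [Module ℂ C] (h : Opposed W F G)
    (h' : Opposed W' F' G') (f : V →ₗ[ℂ] V')
    (hW : ∀ k, ∀ x ∈ W k, f x ∈ W' k)
    (hF : ∀ k, ∀ x ∈ F k, f x ∈ F' k) (hG : ∀ k, ∀ x ∈ G k, f x ∈ G' k)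
    (c : V' →ₗ[ℂ] C) (hc : Function.Surjective c) (hfc : Function.Exact f c) :
    Opposed (fun k => (W' k).map c) (fun k => (F' k).map c) (fun k => (G' k).map c) where
  W_mono _ _ hk := Submodule.map_mono (h'.W_mono hk)
  F_anti _ _ hk := Submodule.map_mono (h'.F_anti hk)
  G_anti _ _ hk := Submodule.map_mono (h'.G_anti hk)
  W_bot := by obtain ⟨k, hk⟩ := h'.W_bot; exact ⟨k, by rw [hk, Submodule.map_bot]⟩
  W_top := by
    obtain ⟨k, hk⟩ := h'.W_top
    exact ⟨k, by rw [hk, Submodule.map_top, LinearMap.range_eq_top.2 hc]⟩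
  F_bot := by obtain ⟨k, hk⟩ := h'.F_bot; exact ⟨k, by rw [hk, Submodule.map_bot]⟩
  F_top := by
    obtain ⟨k, hk⟩ := h'.F_top
    exact ⟨k, by rw [hk, Submodule.map_top, LinearMap.range_eq_top.2 hc]⟩
  G_bot := by obtain ⟨k, hk⟩ := h'.G_bot; exact ⟨k, by rw [hk, Submodule.map_bot]⟩
  G_top := by
    obtain ⟨k, hk⟩ := h'.G_top
    exact ⟨k, by rw [hk, Submodule.map_top, LinearMap.range_eq_top.2 hc]⟩
  span k p q hpq x hx := by
    obtain ⟨x, hx, rfl⟩ := hx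
    obtain ⟨y, z, hy, hy', hz, hz', e⟩ := h'.span k p q hpq x hx
    exact ⟨c y, c z, ⟨y, hy, rfl⟩, ⟨y, hy', rfl⟩, ⟨z, hz, rfl⟩, ⟨z, hz', rfl⟩,
      ⟨_, e, by rw [map_sub, map_sub]⟩⟩
  disj k p q hpq x y hx hx' hy hy' e := by
    obtain ⟨a, ha, rfl⟩ := hx
    obtain ⟨a', ha', ea⟩ := hx'
    obtain ⟨b, hb, rfl⟩ := hy
    obtain ⟨b', hb', eb⟩ := hy'
    obtain ⟨w, hw, ew⟩ := e
    obtain ⟨u, hu⟩ := (hfc (a - a')).1 (by rw [map_sub, ea, sub_self])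
    obtain ⟨v, hv⟩ := (hfc (b - b')).1 (by rw [map_sub, eb, sub_self])
    obtain ⟨u', hu1, hu2⟩ := h.coker_inf h' f hW hF hG u a a' ha ha' hu.symm
    obtain ⟨v', hv1, hv2⟩ := h.symm.coker_inf h'.symm f hW hG hF v b b' hb hb' hv.symm
    have hcf : ∀ t, c (f t) = 0 := fun t => (hfc (f t)).2 ⟨t, rfl⟩
    obtain ⟨t, ht⟩ := (hfc ((a - f u') - (b - f v') - w)).1 (by
      rw [map_sub, map_sub, map_sub, map_sub, hcf, hcf, ew]; abel)
    have htW : f t ∈ W' k := by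
      rw [ht]; exact sub_mem (sub_mem hu2 hv2) (h'.W_mono (by omega) hw)
    obtain ⟨p0, hp0⟩ := h'.F_top
    obtain ⟨t', -, htW', et⟩ := h.strict h' f hW hF hG (p := p0) t (by rw [hp0]; trivial) htW
    obtain ⟨r, s, hr, hr', hs, hs', er⟩ := h.span k p q hpq t' htW'
    have key := h'.disj k p q hpq (a - f u' - f r) (b - f v' + f s)
      (sub_mem hu1 (hF _ _ hr)) (sub_mem hu2 (hW _ _ hr')) (add_mem hv1 (hG _ _ hs))
      (add_mem hv2 (hW _ _ hs')) (by
        have e1 := add_mem (hW _ _ er) hw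
        rw [map_sub, map_sub, et, ht] at e1
        convert e1 using 1
        abel)
    exact ⟨_, key, by rw [map_sub, map_sub, hcf, hcf, sub_zero, sub_zero]⟩

theorem Opposed.twist {U : Type*} [AddCommGroup U] [Module ℂ U] (h : Opposed W F G)
    (h' : Opposed W' F' G') (a : U →ₗ[ℂ] V) (b : U →ₗ[ℂ] V')
    (mk : ∀ x y, ∃ u, a u = x ∧ b u = y) (hu : ∀ u, a u = 0 → b u = 0 → u = 0)
    (θ η : V' →ₗ[ℂ] V) (hθ : ∀ k, ∀ x ∈ W' k, θ x ∈ W k) (hη : ∀ k, ∀ x ∈ W' k, η x ∈ W k) :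
    Opposed (fun k => (W k).comap a ⊓ (W' k).comap b)
      (fun k => (F k).comap (a - θ ∘ₗ b) ⊓ (F' k).comap b)
      (fun k => (G k).comap (a - η ∘ₗ b) ⊓ (G' k).comap b) where
  W_mono _ _ hk := inf_le_inf (Submodule.comap_mono (h.W_mono hk))
    (Submodule.comap_mono (h'.W_mono hk))
  F_anti _ _ hk := inf_le_inf (Submodule.comap_mono (h.F_anti hk))
    (Submodule.comap_mono (h'.F_anti hk))
  G_anti _ _ hk := inf_le_inf (Submodule.comap_mono (h.G_anti hk))
    (Submodule.comap_mono (h'.G_anti hk))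
  W_bot := by
    obtain ⟨k, hk⟩ := h.W_bot
    obtain ⟨k', hk'⟩ := h'.W_bot
    refine ⟨min k k', eq_bot_iff.2 fun u hu' => hu u ?_ ?_⟩
    · have := h.W_mono (min_le_left k k') hu'.1; rwa [hk] at this
    · have := h'.W_mono (min_le_right k k') hu'.2; rwa [hk'] at this
  W_top := by
    obtain ⟨k, hk⟩ := h.W_top
    obtain ⟨k', hk'⟩ := h'.W_top
    refine ⟨max k k', eq_top_iff.2 fun u _ => ⟨h.W_mono (le_max_left k k') ?_,
      h'.W_mono (le_max_right k k') ?_⟩⟩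
    · rw [hk]; trivial
    · rw [hk']; trivial
  F_bot := by
    obtain ⟨k, hk⟩ := h.F_bot
    obtain ⟨k', hk'⟩ := h'.F_bot
    refine ⟨max k k', eq_bot_iff.2 fun u hu' => ?_⟩
    have h1 := h'.F_anti (le_max_right k k') hu'.2
    have h2 := h.F_anti (le_max_left k k') hu'.1
    rw [hk', Submodule.mem_bot] at h1
    rw [hk, Submodule.mem_bot, LinearMap.sub_apply, LinearMap.comp_apply, h1, map_zero,
      sub_zero] at h2
    exact hu u h2 h1
  F_top := by
    obtain ⟨k, hk⟩ := h.F_top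
    obtain ⟨k', hk'⟩ := h'.F_top
    refine ⟨min k k', eq_top_iff.2 fun u _ => ⟨h.F_anti (min_le_left k k') ?_,
      h'.F_anti (min_le_right k k') ?_⟩⟩
    · rw [hk]; trivial
    · rw [hk']; trivial
  G_bot := by
    obtain ⟨k, hk⟩ := h.G_bot
    obtain ⟨k', hk'⟩ := h'.G_bot
    refine ⟨max k k', eq_bot_iff.2 fun u hu' => ?_⟩
    have h1 := h'.G_anti (le_max_right k k') hu'.2
    have h2 := h.G_anti (le_max_left k k') hu'.1
    rw [hk', Submodule.mem_bot] at h1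
    rw [hk, Submodule.mem_bot, LinearMap.sub_apply, LinearMap.comp_apply, h1, map_zero,
      sub_zero] at h2
    exact hu u h2 h1
  G_top := by
    obtain ⟨k, hk⟩ := h.G_top
    obtain ⟨k', hk'⟩ := h'.G_top
    refine ⟨min k k', eq_top_iff.2 fun u _ => ⟨h.G_anti (min_le_left k k') ?_,
      h'.G_anti (min_le_right k k') ?_⟩⟩
    · rw [hk]; trivial
    · rw [hk']; trivial
  span k p q hpq x hx := by
    obtain ⟨y, z, hy, hy', hz, hz', e⟩ := h'.span k p q hpq (b x) hx.2
    obtain ⟨r, s, hr, hr', hs, hs', e'⟩ := h.span k p q hpq (a x - θ y - η z)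
      (sub_mem (sub_mem hx.1 (hθ _ _ hy')) (hη _ _ hz'))
    obtain ⟨u, hua, hub⟩ := mk (r + θ y) y
    obtain ⟨v, hva, hvb⟩ := mk (s + η z) z
    refine ⟨u, v, ⟨?_, ?_⟩, ⟨?_, ?_⟩, ⟨?_, ?_⟩, ⟨?_, ?_⟩, ⟨?_, ?_⟩⟩
    · simpa [hua, hub] using hr
    · simpa [hub] using hy
    · simpa [hua] using add_mem hr' (hθ _ _ hy')
    · simpa [hub] using hy'
    · simpa [hva, hvb] using hs
    · simpa [hvb] using hz
    · simpa [hva] using add_mem hs' (hη _ _ hz')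
    · simpa [hvb] using hz'
    · rw [SetLike.mem_coe, Submodule.mem_comap, map_sub, map_sub, hua, hva]
      convert e' using 1
      abel
    · simpa [hub, hvb] using e
  disj k p q hpq x y hx hx' hy hy' e := by
    have e1 : a x - a y ∈ W (k - 1) := by simpa using e.1
    have e2 : b x - b y ∈ W' (k - 1) := by simpa using e.2
    have h1 := h'.disj k p q hpq _ _ hx.2 hx'.2 hy.2 hy'.2 e2
    have h2 : b y ∈ W' (k - 1) := by
      rw [show b y = b x - (b x - b y) by abel]; exact sub_mem h1 e2
    have hx1 : a x - θ (b x) ∈ F p := hx.1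
    have hy1 : a y - η (b y) ∈ G q := hy.1
    have h3 := h.disj k p q hpq _ _ hx1 (sub_mem hx'.1 (hθ _ _ hx'.2)) hy1
      (sub_mem hy'.1 (hη _ _ hy'.2)) (by
        rw [show a x - θ (b x) - (a y - η (b y)) = a x - a y - θ (b x) + η (b y) by abel]
        exact add_mem (sub_mem e1 (hθ _ _ h1)) (hη _ _ h2))
    refine ⟨?_, h1⟩
    have := add_mem h3 (hθ _ _ h1)
    rwa [sub_add_cancel] at this

end Filtrations

section Scalars

variable (L : Type*) [AddCommGroup L] {L' : Type*} [AddCommGroup L']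

/-- The canonical map `ℚ ⊗ L → ℂ ⊗ L`. -/
noncomputable def toCx : (ℚ ⊗[ℤ] L) →ₗ[ℤ] (ℂ ⊗[ℤ] L) :=
  LinearMap.rTensor L (algebraMap ℚ ℂ).toAddMonoidHom.toIntLinearMap

/-- Complex conjugation on `ℂ ⊗ L`, that is, `z ⊗ l ↦ conj z ⊗ l`. -/
noncomputable def conjC : (ℂ ⊗[ℤ] L) →ₛₗ[starRingEnd ℂ] (ℂ ⊗[ℤ] L) where
  toFun := LinearMap.rTensor L (starRingEnd ℂ).toAddMonoidHom.toIntLinearMap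
  map_add' := map_add _
  map_smul' z x := by
    induction x with
    | zero => simp
    | tmul w l => simp [TensorProduct.smul_tmul']
    | add x y hx hy => rw [smul_add, map_add, hx, hy, map_add, smul_add]

/-- The map `ℂ ⊗ L → ℚ ⊗ L` induced by a `ℚ`-linear functional on `ℂ`. -/
noncomputable def retr (r : ℂ →ₗ[ℚ] ℚ) : (ℂ ⊗[ℤ] L) →ₗ[ℤ] (ℚ ⊗[ℤ] L) :=
  LinearMap.rTensor L r.toAddMonoidHom.toIntLinearMap

variable {L}

@[simp] theorem toCx_tmul (q : ℚ) (l : L) : toCx L (q ⊗ₜ l) = (q : ℂ) ⊗ₜ l := by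
  change (algebraMap ℚ ℂ q) ⊗ₜ[ℤ] l = _
  rw [eq_ratCast]

@[simp] theorem conjC_tmul (z : ℂ) (l : L) :
    conjC L (z ⊗ₜ l) = (starRingEnd ℂ z) ⊗ₜ l := rfl

@[simp] theorem retr_tmul (r : ℂ →ₗ[ℚ] ℚ) (z : ℂ) (l : L) :
    retr L r (z ⊗ₜ l) = r z ⊗ₜ l := rfl

/-- The complexification `S ⊗_ℚ ℂ ⊆ ℂ ⊗ L` of a rational subspace `S ⊆ ℚ ⊗ L`. -/
noncomputable def cx (S : Submodule ℚ (ℚ ⊗[ℤ] L)) : Submodule ℂ (ℂ ⊗[ℤ] L) :=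
  Submodule.span ℂ (toCx L '' S)

theorem retr_smul_toCx (r : ℂ →ₗ[ℚ] ℚ) (z : ℂ) (y : ℚ ⊗[ℤ] L) :
    retr L r (z • toCx L y) = r z • y := by
  induction y with
  | zero => simp
  | tmul q l =>
    rw [toCx_tmul, TensorProduct.smul_tmul', retr_tmul, TensorProduct.smul_tmul', smul_eq_mul,
      smul_eq_mul, mul_comm, ← Rat.smul_def, map_smul, smul_eq_mul, mul_comm]
  | add x y hx hy => simp only [map_add, smul_add, hx, hy]

theorem exists_retr_sum (x : ℂ ⊗[ℤ] L) :
    ∃ I : Finset (Module.Basis.ofVectorSpaceIndex ℚ ℂ), ∀ J, I ⊆ J →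
      x = ∑ i ∈ J, (Module.Basis.ofVectorSpace ℚ ℂ i) •
        toCx L (retr L ((Module.Basis.ofVectorSpace ℚ ℂ).coord i) x) := by
  classical
  induction x with
  | zero => exact ⟨∅, fun J _ => by simp⟩
  | tmul z l =>
    refine ⟨((Module.Basis.ofVectorSpace ℚ ℂ).repr z).support, fun J hJ => ?_⟩
    have h1 := (Module.Basis.ofVectorSpace ℚ ℂ).linearCombination_repr z
    rw [Finsupp.linearCombination_apply, Finsupp.sum_of_support_subset _ hJ _ (by simp)] at h1
    conv_lhs => rw [← h1]
    rw [TensorProduct.sum_tmul]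
    refine Finset.sum_congr rfl fun i _ => ?_
    rw [retr_tmul, toCx_tmul, TensorProduct.smul_tmul', Module.Basis.coord_apply, Rat.smul_def,
      smul_eq_mul, mul_comm]
  | add x y hx hy =>
    obtain ⟨I, hI⟩ := hx
    obtain ⟨I', hI'⟩ := hy
    refine ⟨I ∪ I', fun J hJ => ?_⟩
    simp only [map_add, smul_add, Finset.sum_add_distrib]
    rw [← hI J (Finset.union_subset_left hJ), ← hI' J (Finset.union_subset_right hJ)]

theorem mem_cx_iff {S : Submodule ℚ (ℚ ⊗[ℤ] L)} {x : ℂ ⊗[ℤ] L} :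
    x ∈ cx S ↔ ∀ r : ℂ →ₗ[ℚ] ℚ, retr L r x ∈ S := by
  constructor
  · intro h r
    have h' : ∀ z : ℂ, retr L r (z • x) ∈ S := by
      refine Submodule.span_induction (p := fun x _ => ∀ z : ℂ, retr L r (z • x) ∈ S)
        ?_ ?_ ?_ ?_ h
      · rintro _ ⟨y, hy, rfl⟩ z
        rw [retr_smul_toCx]
        exact S.smul_mem _ hy
      · intro z; simp
      · intro x y _ _ hx hy z
        rw [smul_add, map_add]
        exact add_mem (hx z) (hy z)
      · intro a x _ hx z
        rw [smul_smul]
        exact hx _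
    simpa using h' 1
  · intro h
    obtain ⟨I, hI⟩ := exists_retr_sum x
    rw [hI I le_rfl]
    exact sum_mem fun i _ => Submodule.smul_mem _ _ (Submodule.subset_span ⟨_, h _, rfl⟩)

theorem retr_baseChange (r : ℂ →ₗ[ℚ] ℚ) (f : L →ₗ[ℤ] L') (x : ℂ ⊗[ℤ] L) :
    retr L' r (f.baseChange ℂ x) = f.baseChange ℚ (retr L r x) := by
  induction x with
  | zero => simp
  | tmul z l => simp
  | add x y hx hy => simp only [map_add, hx, hy]

theorem toCx_baseChange (f : L →ₗ[ℤ] L') (x : ℚ ⊗[ℤ] L) :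
    toCx L' (f.baseChange ℚ x) = f.baseChange ℂ (toCx L x) := by
  induction x with
  | zero => simp
  | tmul z l => simp
  | add x y hx hy => simp only [map_add, hx, hy]

theorem conjC_baseChange (f : L →ₗ[ℤ] L') (x : ℂ ⊗[ℤ] L) :
    conjC L' (f.baseChange ℂ x) = f.baseChange ℂ (conjC L x) := by
  induction x with
  | zero => simp
  | tmul z l => simp
  | add x y hx hy => simp only [map_add, hx, hy]

@[simp] theorem conjC_conjC (x : ℂ ⊗[ℤ] L) : conjC L (conjC L x) = x := by
  induction x with
  | zero => simp
  | tmul z l => simp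
  | add x y hx hy => simp only [map_add, hx, hy]

theorem retr_conjC (r : ℂ →ₗ[ℚ] ℚ) (x : ℂ ⊗[ℤ] L) :
    retr L r (conjC L x) =
      retr L (r ∘ₗ (Complex.conjAe.toLinearMap.restrictScalars ℚ)) x := by
  induction x with
  | zero => simp
  | tmul z l => simp
  | add x y hx hy => simp only [map_add, hx, hy]

theorem cx_mono {S T : Submodule ℚ (ℚ ⊗[ℤ] L)} (h : S ≤ T) : cx S ≤ cx T :=
  Submodule.span_mono (Set.image_mono h)

theorem cx_comap (f : L →ₗ[ℤ] L') (S : Submodule ℚ (ℚ ⊗[ℤ] L')) :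
    cx (S.comap (f.baseChange ℚ)) = (cx S).comap (f.baseChange ℂ) := by
  ext x
  simp only [mem_cx_iff, Submodule.mem_comap, retr_baseChange]

theorem cx_inf (S T : Submodule ℚ (ℚ ⊗[ℤ] L)) : cx (S ⊓ T) = cx S ⊓ cx T := by
  ext x
  simp only [mem_cx_iff, Submodule.mem_inf, forall_and]

theorem cx_map (f : L →ₗ[ℤ] L') (S : Submodule ℚ (ℚ ⊗[ℤ] L)) :
    cx (S.map (f.baseChange ℚ)) = (cx S).map (f.baseChange ℂ) := by
  rw [cx, cx, Submodule.map_span]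
  congr 1
  ext x
  simp only [Set.mem_image, SetLike.mem_coe, Submodule.mem_map]
  constructor
  · rintro ⟨_, ⟨y, hy, rfl⟩, rfl⟩
    exact ⟨_, ⟨y, hy, rfl⟩, (toCx_baseChange f y).symm⟩
  · rintro ⟨_, ⟨y, hy, rfl⟩, rfl⟩
    exact ⟨_, ⟨y, hy, rfl⟩, toCx_baseChange f y⟩

@[simp] theorem cx_bot : cx (⊥ : Submodule ℚ (ℚ ⊗[ℤ] L)) = ⊥ := by
  rw [cx, Submodule.span_eq_bot]
  rintro _ ⟨y, hy, rfl⟩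
  rw [SetLike.mem_coe, Submodule.mem_bot] at hy
  rw [hy, map_zero]

@[simp] theorem cx_top : cx (⊤ : Submodule ℚ (ℚ ⊗[ℤ] L)) = ⊤ := by
  rw [eq_top_iff]
  intro x _
  rw [mem_cx_iff]
  intro r
  trivial

theorem conjC_mem_cx {S : Submodule ℚ (ℚ ⊗[ℤ] L)} {x : ℂ ⊗[ℤ] L} (h : x ∈ cx S) :
    conjC L x ∈ cx S := by
  rw [mem_cx_iff] at h ⊢
  intro r
  rw [retr_conjC]
  exact h _

theorem baseChange_injective (K : Type) [Field K] [CharZero K] (f : L →ₗ[ℤ] L')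
    (hf : Function.Injective f) : Function.Injective (f.baseChange K) :=
  Module.Flat.lTensor_preserves_injective_linearMap (M := K) f hf

theorem baseChange_exact (K : Type) [Field K] [CharZero K] {L'' : Type*} [AddCommGroup L'']
    (f : L →ₗ[ℤ] L') (g : L' →ₗ[ℤ] L'') (h : Function.Exact f g) :
    Function.Exact (f.baseChange K) (g.baseChange K) :=
  Module.Flat.lTensor_exact (M := K) h

theorem baseChange_surjective (K : Type) [Field K] [CharZero K] (f : L →ₗ[ℤ] L')
    (hf : Function.Surjective f) : Function.Surjective (f.baseChange K) :=
  LinearMap.lTensor_surjective K hf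

theorem baseChange_fst_prod (K : Type) [Field K] {L₁ L₂ : Type*} [AddCommGroup L₁]
    [AddCommGroup L₂] (f : L →ₗ[ℤ] L₁) (g : L →ₗ[ℤ] L₂) (x : K ⊗[ℤ] L) :
    (LinearMap.fst ℤ L₁ L₂).baseChange K ((f.prod g).baseChange K x) = f.baseChange K x := by
  rw [← LinearMap.comp_apply, ← LinearMap.baseChange_comp, LinearMap.fst_prod]

theorem baseChange_snd_prod (K : Type) [Field K] {L₁ L₂ : Type*} [AddCommGroup L₁]
    [AddCommGroup L₂] (f : L →ₗ[ℤ] L₁) (g : L →ₗ[ℤ] L₂) (x : K ⊗[ℤ] L) :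
    (LinearMap.snd ℤ L₁ L₂).baseChange K ((f.prod g).baseChange K x) = g.baseChange K x := by
  rw [← LinearMap.comp_apply, ← LinearMap.baseChange_comp, LinearMap.snd_prod]

theorem baseChange_fst_inl (K : Type) [Field K] {L₁ L₂ : Type*} [AddCommGroup L₁]
    [AddCommGroup L₂] (x : K ⊗[ℤ] L₁) :
    (LinearMap.fst ℤ L₁ L₂).baseChange K ((LinearMap.inl ℤ L₁ L₂).baseChange K x) = x := by
  rw [← LinearMap.comp_apply, ← LinearMap.baseChange_comp, LinearMap.fst_comp_inl,
    LinearMap.baseChange_id, LinearMap.id_apply]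

theorem baseChange_snd_inl (K : Type) [Field K] {L₁ L₂ : Type*} [AddCommGroup L₁]
    [AddCommGroup L₂] (x : K ⊗[ℤ] L₁) :
    (LinearMap.snd ℤ L₁ L₂).baseChange K ((LinearMap.inl ℤ L₁ L₂).baseChange K x) = 0 := by
  rw [← LinearMap.comp_apply, ← LinearMap.baseChange_comp, LinearMap.snd_comp_inl,
    LinearMap.baseChange_zero, LinearMap.zero_apply]

end Scalars

/-- A mixed Hodge structure: a finitely generated abelian group `L`, a finite increasing weight
filtration `W` on `ℚ ⊗ L` and a finite decreasing Hodge filtration `F` on `ℂ ⊗ L` such that for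
every `k` the filtrations induced by `F` and by its complex conjugate on
`Gr_k^W = W_k / W_{k-1}` (complexified) are `k`-opposed:
`Gr_k^W = F^p Gr_k^W ⊕ conj (F^q Gr_k^W)` whenever `p + q = k + 1`. -/
structure MHS where
  L : Type u
  [grp : AddCommGroup L]
  [fin : Module.Finite ℤ L]
  W : ℤ → Submodule ℚ (ℚ ⊗[ℤ] L)
  F : ℤ → Submodule ℂ (ℂ ⊗[ℤ] L)
  W_mono : Monotone W
  F_anti : Antitone F
  W_bot : ∃ k, W k = ⊥
  W_top : ∃ k, W k = ⊤
  F_bot : ∃ k, F k = ⊥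
  F_top : ∃ k, F k = ⊤
  opposed : ∀ k p q : ℤ, p + q = k + 1 →
    IsCompl (grSub (fun j => cx (W j)) k (F p))
      (grSub (fun j => cx (W j)) k ((F q).comap (conjC L)))

attribute [instance] MHS.grp MHS.fin

namespace MHS

/-- The complexified weight filtration. -/
noncomputable def WC (X : MHS.{u}) (k : ℤ) : Submodule ℂ (ℂ ⊗[ℤ] X.L) := cx (X.W k)

/-- The complex conjugate of the Hodge filtration. -/
noncomputable def Fbar (X : MHS.{u}) (k : ℤ) : Submodule ℂ (ℂ ⊗[ℤ] X.L) :=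
  (X.F k).comap (conjC X.L)

theorem comap_conj_bot (L : Type*) [AddCommGroup L] :
    (⊥ : Submodule ℂ (ℂ ⊗[ℤ] L)).comap (conjC L) = ⊥ := by
  rw [eq_bot_iff]
  intro x hx
  rw [Submodule.mem_comap, Submodule.mem_bot] at hx
  rw [Submodule.mem_bot, ← conjC_conjC x, hx, map_zero]

theorem opp (X : MHS.{u}) : Opposed X.WC X.F X.Fbar where
  W_mono _ _ h := cx_mono (X.W_mono h)
  F_anti := X.F_anti
  G_anti _ _ h := Submodule.comap_mono (X.F_anti h)
  W_bot := by obtain ⟨k, hk⟩ := X.W_bot; exact ⟨k, by rw [WC, hk, cx_bot]⟩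
  W_top := by obtain ⟨k, hk⟩ := X.W_top; exact ⟨k, by rw [WC, hk, cx_top]⟩
  F_bot := X.F_bot
  F_top := X.F_top
  G_bot := by obtain ⟨k, hk⟩ := X.F_bot; exact ⟨k, by rw [Fbar, hk, comap_conj_bot]⟩
  G_top := by obtain ⟨k, hk⟩ := X.F_top; exact ⟨k, by rw [Fbar, hk, Submodule.comap_top]⟩
  span k p q h := ((isCompl_grSub_iff _ _).1 (X.opposed k p q h)).1
  disj k p q h := ((isCompl_grSub_iff _ _).1 (X.opposed k p q h)).2

/-- Constructor from the elementwise form of the axioms. -/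
def ofOpposed (L : Type u) [AddCommGroup L] [Module.Finite ℤ L]
    (W : ℤ → Submodule ℚ (ℚ ⊗[ℤ] L)) (F : ℤ → Submodule ℂ (ℂ ⊗[ℤ] L))
    (W_mono : Monotone W) (W_bot : ∃ k, W k = ⊥) (W_top : ∃ k, W k = ⊤)
    (h : Opposed (fun k => cx (W k)) F (fun k => (F k).comap (conjC L))) : MHS.{u} where
  L := L
  W := W
  F := F
  W_mono := W_mono
  F_anti := h.F_anti
  W_bot := W_bot
  W_top := W_top
  F_bot := h.F_bot
  F_top := h.F_top
  opposed k p q hpq := (isCompl_grSub_iff _ _).2 ⟨h.span k p q hpq, h.disj k p q hpq⟩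

/-- A morphism of mixed Hodge structures: a homomorphism of the underlying groups which is
compatible with both filtrations. -/
@[ext]
structure Hom (X Y : MHS.{u}) where
  toLin : X.L →ₗ[ℤ] Y.L
  map_W : ∀ k, X.W k ≤ (Y.W k).comap (toLin.baseChange ℚ)
  map_F : ∀ k, X.F k ≤ (Y.F k).comap (toLin.baseChange ℂ)

namespace Hom

variable {X Y Z T : MHS.{u}}

/-- The identity morphism. -/
def id (X : MHS.{u}) : Hom X X where
  toLin := LinearMap.id
  map_W k x hx := by simpa using hx
  map_F k x hx := by simpa using hx

/-- Composition of morphisms, `g ∘ f`. -/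
def comp (g : Hom Y Z) (f : Hom X Y) : Hom X Z where
  toLin := g.toLin ∘ₗ f.toLin
  map_W k x hx := by
    rw [LinearMap.baseChange_comp]
    exact g.map_W k (f.map_W k hx)
  map_F k x hx := by
    rw [LinearMap.baseChange_comp]
    exact g.map_F k (f.map_F k hx)

/-- The sum of two morphisms. -/
def add (f g : Hom X Y) : Hom X Y where
  toLin := f.toLin + g.toLin
  map_W k x hx := by
    rw [LinearMap.baseChange_add, Submodule.mem_comap, LinearMap.add_apply]
    exact (Y.W k).add_mem (f.map_W k hx) (g.map_W k hx)
  map_F k x hx := by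
    rw [LinearMap.baseChange_add, Submodule.mem_comap, LinearMap.add_apply]
    exact (Y.F k).add_mem (f.map_F k hx) (g.map_F k hx)

/-- The negative of a morphism. -/
def neg (f : Hom X Y) : Hom X Y where
  toLin := -f.toLin
  map_W k x hx := by
    rw [LinearMap.baseChange_neg, Submodule.mem_comap, LinearMap.neg_apply]
    exact (Y.W k).neg_mem (f.map_W k hx)
  map_F k x hx := by
    rw [LinearMap.baseChange_neg, Submodule.mem_comap, LinearMap.neg_apply]
    exact (Y.F k).neg_mem (f.map_F k hx)

/-- The zero morphism. -/
def zero (X Y : MHS.{u}) : Hom X Y where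
  toLin := 0
  map_W k x _ := by
    rw [LinearMap.baseChange_zero, Submodule.mem_comap, LinearMap.zero_apply]
    exact (Y.W k).zero_mem
  map_F k x _ := by
    rw [LinearMap.baseChange_zero, Submodule.mem_comap, LinearMap.zero_apply]
    exact (Y.F k).zero_mem

@[simp] theorem zero_apply (x : X.L) : (Hom.zero X Y).toLin x = 0 := rfl
@[simp] theorem id_apply (x : X.L) : (Hom.id X).toLin x = x := rfl
@[simp] theorem comp_apply (g : Hom Y Z) (f : Hom X Y) (x : X.L) :
    (g.comp f).toLin x = g.toLin (f.toLin x) := rfl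
@[simp] theorem add_apply (f g : Hom X Y) (x : X.L) :
    (f.add g).toLin x = f.toLin x + g.toLin x := rfl
@[simp] theorem neg_apply (f : Hom X Y) (x : X.L) : f.neg.toLin x = -f.toLin x := rfl

theorem map_WC (f : Hom X Y) (k : ℤ) (x : ℂ ⊗[ℤ] X.L) (hx : x ∈ X.WC k) :
    f.toLin.baseChange ℂ x ∈ Y.WC k := by
  have := cx_mono (f.map_W k) hx
  rwa [cx_comap] at this

theorem map_Fbar (f : Hom X Y) (k : ℤ) (x : ℂ ⊗[ℤ] X.L) (hx : x ∈ X.Fbar k) :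
    f.toLin.baseChange ℂ x ∈ Y.Fbar k := by
  rw [Fbar, Submodule.mem_comap, conjC_baseChange]
  exact f.map_F k hx

theorem strict (f : Hom X Y) {p k : ℤ} (x : ℂ ⊗[ℤ] X.L)
    (hx : f.toLin.baseChange ℂ x ∈ Y.F p) (hx' : f.toLin.baseChange ℂ x ∈ Y.WC k) :
    ∃ y ∈ X.F p, y ∈ X.WC k ∧ f.toLin.baseChange ℂ y = f.toLin.baseChange ℂ x :=
  X.opp.strict Y.opp _ f.map_WC (fun k _ hx => f.map_F k hx) f.map_Fbar x hx hx'

theorem strict_F (f : Hom X Y) {p : ℤ} (x : ℂ ⊗[ℤ] X.L)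
    (hx : f.toLin.baseChange ℂ x ∈ Y.F p) :
    ∃ y ∈ X.F p, f.toLin.baseChange ℂ y = f.toLin.baseChange ℂ x := by
  obtain ⟨k, hk⟩ := Y.opp.W_top
  obtain ⟨y, hy, -, e⟩ := f.strict (k := k) x hx (by rw [hk]; trivial)
  exact ⟨y, hy, e⟩

theorem strict_W (f : Hom X Y) {k : ℤ} (x : ℚ ⊗[ℤ] X.L)
    (hx : f.toLin.baseChange ℚ x ∈ Y.W k) :
    ∃ y ∈ X.W k, f.toLin.baseChange ℚ y = f.toLin.baseChange ℚ x := by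
  obtain ⟨p, hp⟩ := Y.F_top
  have h1 : f.toLin.baseChange ℂ (toCx X.L x) ∈ Y.WC k := by
    rw [← toCx_baseChange]
    exact Submodule.subset_span ⟨_, hx, rfl⟩
  obtain ⟨y, -, hy, e⟩ := f.strict (p := p) _ (by rw [hp]; trivial) h1
  obtain ⟨r, hr⟩ : ∃ r : ℂ →ₗ[ℚ] ℚ, r 1 = 1 := Module.Projective.exists_dual_eq_one ℚ one_ne_zero
  refine ⟨retr X.L r y, mem_cx_iff.1 hy r, ?_⟩
  have h2 := retr_smul_toCx r 1 (f.toLin.baseChange ℚ x)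
  rw [one_smul, hr, one_smul] at h2
  rw [← retr_baseChange, e, ← toCx_baseChange, h2]

/-- A morphism that vanishes on the kernel of a surjective one factors through it. -/
noncomputable def descend (t : Hom T X) (ht : Function.Surjective t.toLin) (s : Hom T Y)
    (h : ∀ x, t.toLin x = 0 → s.toLin x = 0) : Hom X Y :=
  let φ : X.L →ₗ[ℤ] Y.L := (LinearMap.ker t.toLin).liftQ s.toLin (fun x hx => h x hx) ∘ₗ
    (t.toLin.quotKerEquivOfSurjective ht).symm.toLinearMap
  have hφ : φ ∘ₗ t.toLin = s.toLin := by
    ext x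
    have : (t.toLin.quotKerEquivOfSurjective ht).symm (t.toLin x) = Submodule.Quotient.mk x := by
      rw [LinearEquiv.symm_apply_eq]; rfl
    simp only [φ, LinearMap.comp_apply, LinearEquiv.coe_coe, this]
    rfl
  { toLin := φ
    map_W := fun k x hx => by
      obtain ⟨y, rfl⟩ := baseChange_surjective ℚ _ ht x
      obtain ⟨y', hy', e⟩ := t.strict_W y hx
      rw [← e, Submodule.mem_comap, ← LinearMap.comp_apply, ← LinearMap.baseChange_comp, hφ]
      exact s.map_W k hy'
    map_F := fun k x hx => by
      obtain ⟨y, rfl⟩ := baseChange_surjective ℂ _ ht x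
      obtain ⟨y', hy', e⟩ := t.strict_F y hx
      rw [← e, Submodule.mem_comap, ← LinearMap.comp_apply, ← LinearMap.baseChange_comp, hφ]
      exact s.map_F k hy' }

@[simp] theorem descend_apply (t : Hom T X) (ht : Function.Surjective t.toLin) (s : Hom T Y)
    (h : ∀ x, t.toLin x = 0 → s.toLin x = 0) (x : T.L) :
    (descend t ht s h).toLin (t.toLin x) = s.toLin x := by
  have : (t.toLin.quotKerEquivOfSurjective ht).symm (t.toLin x) = Submodule.Quotient.mk x := by
    rw [LinearEquiv.symm_apply_eq]; rfl
  simp only [descend, LinearMap.comp_apply, LinearEquiv.coe_coe, this]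
  rfl

/-- A morphism with values in the image of an injective one factors through it. -/
noncomputable def lift (j : Hom X T) (hj : Function.Injective j.toLin) (s : Hom Y T)
    (h : ∀ y, ∃ x, j.toLin x = s.toLin y) : Hom Y X :=
  let φ : Y.L →ₗ[ℤ] X.L := (LinearEquiv.ofInjective j.toLin hj).symm.toLinearMap ∘ₗ
    s.toLin.codRestrict (LinearMap.range j.toLin) h
  have hφ : j.toLin ∘ₗ φ = s.toLin := by
    ext y
    have := (LinearEquiv.ofInjective j.toLin hj).apply_symm_apply
      (s.toLin.codRestrict (LinearMap.range j.toLin) h y)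
    exact congrArg Subtype.val this
  { toLin := φ
    map_W := fun k x hx => by
      have h1 : j.toLin.baseChange ℚ (φ.baseChange ℚ x) = s.toLin.baseChange ℚ x := by
        rw [← LinearMap.comp_apply, ← LinearMap.baseChange_comp, hφ]
      obtain ⟨y, hy, e⟩ := j.strict_W (φ.baseChange ℚ x) (by rw [h1]; exact s.map_W k hx)
      have := baseChange_injective ℚ _ hj e
      rwa [this] at hy
    map_F := fun k x hx => by
      have h1 : j.toLin.baseChange ℂ (φ.baseChange ℂ x) = s.toLin.baseChange ℂ x := by
        rw [← LinearMap.comp_apply, ← LinearMap.baseChange_comp, hφ]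
      obtain ⟨y, hy, e⟩ := j.strict_F (φ.baseChange ℂ x) (by rw [h1]; exact s.map_F k hx)
      have := baseChange_injective ℂ _ hj e
      rwa [this] at hy }

@[simp] theorem apply_lift (j : Hom X T) (hj : Function.Injective j.toLin) (s : Hom Y T)
    (h : ∀ y, ∃ x, j.toLin x = s.toLin y) (y : Y.L) :
    j.toLin ((lift j hj s h).toLin y) = s.toLin y := by
  have := (LinearEquiv.ofInjective j.toLin hj).apply_symm_apply
    (s.toLin.codRestrict (LinearMap.range j.toLin) h y)
  exact congrArg Subtype.val this

end Hom

/-- The kernel of a morphism, with the induced filtrations. -/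
noncomputable def ker {X Y : MHS.{u}} (f : Hom X Y) : MHS.{u} :=
  have h : Opposed _ _ _ := X.opp.ker Y.opp _ f.map_WC (fun k _ hx => f.map_F k hx) f.map_Fbar
    ((LinearMap.ker f.toLin).subtype.baseChange ℂ)
    (baseChange_injective ℂ _ (Submodule.injective_subtype _))
    (baseChange_exact ℂ _ _ (LinearMap.exact_subtype_ker_map f.toLin))
  ofOpposed (LinearMap.ker f.toLin)
    (fun k => (X.W k).comap ((LinearMap.ker f.toLin).subtype.baseChange ℚ))
    (fun k => (X.F k).comap ((LinearMap.ker f.toLin).subtype.baseChange ℂ))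
    (fun _ _ hk => Submodule.comap_mono (X.W_mono hk))
    (by
      obtain ⟨k, hk⟩ := X.W_bot
      exact ⟨k, by
        rw [hk]
        exact LinearMap.ker_eq_bot.2 (baseChange_injective ℚ _ (Submodule.injective_subtype _))⟩)
    (by obtain ⟨k, hk⟩ := X.W_top; exact ⟨k, by rw [hk]; rfl⟩)
    (by
      convert h using 1
      · ext k x
        rw [cx_comap]; rfl
      · ext k x
        simp only [Submodule.mem_comap, Fbar, conjC_baseChange])

/-- The cokernel of a morphism, with the quotient filtrations. -/
noncomputable def coker {X Y : MHS.{u}} (f : Hom X Y) : MHS.{u} :=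
  have hs := (LinearMap.range f.toLin).mkQ_surjective
  have h : Opposed _ _ _ := X.opp.coker Y.opp _ f.map_WC (fun k _ hx => f.map_F k hx) f.map_Fbar
    ((LinearMap.range f.toLin).mkQ.baseChange ℂ) (baseChange_surjective ℂ _ hs)
    (baseChange_exact ℂ _ _ (LinearMap.exact_map_mkQ_range f.toLin))
  ofOpposed (Y.L ⧸ LinearMap.range f.toLin)
    (fun k => (Y.W k).map ((LinearMap.range f.toLin).mkQ.baseChange ℚ))
    (fun k => (Y.F k).map ((LinearMap.range f.toLin).mkQ.baseChange ℂ))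
    (fun _ _ hk => Submodule.map_mono (Y.W_mono hk))
    (by obtain ⟨k, hk⟩ := Y.W_bot; exact ⟨k, by rw [hk, Submodule.map_bot]⟩)
    (by
      obtain ⟨k, hk⟩ := Y.W_top
      exact ⟨k, by
        rw [hk, Submodule.map_top, LinearMap.range_eq_top.2 (baseChange_surjective ℚ _ hs)]⟩)
    (by
      convert h using 1
      · ext k x
        rw [cx_map]; rfl
      · ext k x
        simp only [Submodule.mem_comap, Submodule.mem_map, Fbar]
        constructor
        · rintro ⟨y, hy, e⟩
          exact ⟨conjC _ y, by rwa [conjC_conjC], by rw [← conjC_baseChange, e, conjC_conjC]⟩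
        · rintro ⟨y, hy, e⟩
          exact ⟨conjC _ y, hy, by rw [← conjC_baseChange, e]⟩)

/-- `W_0 Hom(B, A)_ℂ`: the `ℂ`-linear maps `B_ℂ → A_ℂ` that respect the weight filtrations. -/
def W0Hom (B A : MHS.{u}) : Submodule ℂ ((ℂ ⊗[ℤ] B.L) →ₗ[ℂ] (ℂ ⊗[ℤ] A.L)) where
  carrier := {θ | ∀ k, ∀ x ∈ B.WC k, θ x ∈ A.WC k}
  add_mem' hθ hη k x hx := add_mem (hθ k x hx) (hη k x hx)
  zero_mem' _ _ _ := zero_mem _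
  smul_mem' c _ hθ k x hx := Submodule.smul_mem _ c (hθ k x hx)

section Twist

variable {A B : MHS.{u}}

/-- The complex conjugate of a linear map. -/
noncomputable def conjMap (θ : (ℂ ⊗[ℤ] B.L) →ₗ[ℂ] (ℂ ⊗[ℤ] A.L)) :
    (ℂ ⊗[ℤ] B.L) →ₗ[ℂ] (ℂ ⊗[ℤ] A.L) where
  toFun x := conjC _ (θ (conjC _ x))
  map_add' x y := by simp only [map_add]
  map_smul' c x := by simp

variable (A B) in
/-- The first projection `ℂ ⊗ (A ⊕ B) → ℂ ⊗ A`. -/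
noncomputable abbrev fstC : (ℂ ⊗[ℤ] (A.L × B.L)) →ₗ[ℂ] (ℂ ⊗[ℤ] A.L) :=
  (LinearMap.fst ℤ A.L B.L).baseChange ℂ

variable (A B) in
/-- The second projection `ℂ ⊗ (A ⊕ B) → ℂ ⊗ B`. -/
noncomputable abbrev sndC : (ℂ ⊗[ℤ] (A.L × B.L)) →ₗ[ℂ] (ℂ ⊗[ℤ] B.L) :=
  (LinearMap.snd ℤ A.L B.L).baseChange ℂ

theorem baseChange_prod_mk (K : Type) [Field K] (x : K ⊗[ℤ] A.L) (y : K ⊗[ℤ] B.L) :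
    ∃ u : K ⊗[ℤ] (A.L × B.L), (LinearMap.fst ℤ A.L B.L).baseChange K u = x ∧
      (LinearMap.snd ℤ A.L B.L).baseChange K u = y := by
  refine ⟨(LinearMap.inl ℤ A.L B.L).baseChange K x + (LinearMap.inr ℤ A.L B.L).baseChange K y,
    ?_, ?_⟩
  · rw [map_add, ← LinearMap.comp_apply, ← LinearMap.baseChange_comp, ← LinearMap.comp_apply,
      ← LinearMap.baseChange_comp, LinearMap.fst_comp_inl, LinearMap.fst_comp_inr,
      LinearMap.baseChange_zero, LinearMap.baseChange_id, LinearMap.zero_apply, add_zero,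
      LinearMap.id_apply]
  · rw [map_add, ← LinearMap.comp_apply, ← LinearMap.baseChange_comp, ← LinearMap.comp_apply,
      ← LinearMap.baseChange_comp, LinearMap.snd_comp_inl, LinearMap.snd_comp_inr,
      LinearMap.baseChange_zero, LinearMap.baseChange_id, LinearMap.zero_apply, zero_add,
      LinearMap.id_apply]

theorem baseChange_prod_ext (K : Type) [Field K] (u : K ⊗[ℤ] (A.L × B.L))
    (h1 : (LinearMap.fst ℤ A.L B.L).baseChange K u = 0)
    (h2 : (LinearMap.snd ℤ A.L B.L).baseChange K u = 0) : u = 0 := by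
  have e : LinearMap.inl ℤ A.L B.L ∘ₗ LinearMap.fst ℤ A.L B.L +
      LinearMap.inr ℤ A.L B.L ∘ₗ LinearMap.snd ℤ A.L B.L = LinearMap.id := by
    ext x <;> simp
  have e2 := congrArg (fun f => f.baseChange K u) e
  simp only [LinearMap.baseChange_add, LinearMap.baseChange_comp, LinearMap.add_apply,
    LinearMap.comp_apply, h1, h2, map_zero, add_zero, LinearMap.baseChange_id,
    LinearMap.id_apply] at e2
  exact e2.symm

variable (A B) in
/-- The mixed Hodge structure on `A ⊕ B` whose weight filtration is the direct sum and whose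
Hodge filtration is `F_θ^k = {(a + θ b, b) | a ∈ F^k A, b ∈ F^k B}`. -/
noncomputable def twist (θ : W0Hom B A) : MHS.{u} :=
  have hη : ∀ k, ∀ x ∈ B.WC k, conjMap θ.1 x ∈ A.WC k := fun k x hx =>
    conjC_mem_cx (θ.2 k _ (conjC_mem_cx hx))
  have h : Opposed _ _ _ := A.opp.twist B.opp (fstC A B) (sndC A B) (baseChange_prod_mk ℂ)
    (baseChange_prod_ext ℂ) θ.1 (conjMap θ.1) θ.2 hη
  ofOpposed (A.L × B.L)
    (fun k => (A.W k).comap ((LinearMap.fst ℤ A.L B.L).baseChange ℚ) ⊓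
      (B.W k).comap ((LinearMap.snd ℤ A.L B.L).baseChange ℚ))
    (fun k => (A.F k).comap (fstC A B - θ.1 ∘ₗ sndC A B) ⊓ (B.F k).comap (sndC A B))
    (fun _ _ hk => inf_le_inf (Submodule.comap_mono (A.W_mono hk))
      (Submodule.comap_mono (B.W_mono hk)))
    (by
      obtain ⟨k, hk⟩ := A.W_bot
      obtain ⟨k', hk'⟩ := B.W_bot
      refine ⟨min k k', eq_bot_iff.2 fun u hu' => baseChange_prod_ext ℚ u ?_ ?_⟩
      · have := A.W_mono (min_le_left k k') hu'.1; rwa [hk] at this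
      · have := B.W_mono (min_le_right k k') hu'.2; rwa [hk'] at this)
    (by
      obtain ⟨k, hk⟩ := A.W_top
      obtain ⟨k', hk'⟩ := B.W_top
      refine ⟨max k k', eq_top_iff.2 fun u _ => ⟨A.W_mono (le_max_left k k') ?_,
        B.W_mono (le_max_right k k') ?_⟩⟩
      · rw [hk]; trivial
      · rw [hk']; trivial)
    (by
      convert h using 1
      · ext k x
        rw [cx_inf, cx_comap, cx_comap]; rfl
      · ext k x
        simp only [Submodule.mem_comap, Submodule.mem_inf, Fbar, conjC_baseChange,
          LinearMap.sub_apply, LinearMap.comp_apply, map_sub, conjMap, LinearMap.coe_mk,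
          AddHom.coe_mk, conjC_conjC])

variable (A B) in
/-- The direct sum of two mixed Hodge structures. -/
noncomputable def prod : MHS.{u} := twist A B 0

theorem mem_prod_W {k : ℤ} {x : ℚ ⊗[ℤ] (A.L × B.L)} : x ∈ (prod A B).W k ↔
    (LinearMap.fst ℤ A.L B.L).baseChange ℚ x ∈ A.W k ∧
      (LinearMap.snd ℤ A.L B.L).baseChange ℚ x ∈ B.W k := Iff.rfl

theorem mem_prod_F {k : ℤ} {x : ℂ ⊗[ℤ] (A.L × B.L)} : x ∈ (prod A B).F k ↔
    (LinearMap.fst ℤ A.L B.L).baseChange ℂ x ∈ A.F k ∧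
      (LinearMap.snd ℤ A.L B.L).baseChange ℂ x ∈ B.F k := by
  change (fstC A B x - (0 : _ →ₗ[ℂ] _) (sndC A B x) ∈ A.F k ∧ _) ↔ _
  rw [LinearMap.zero_apply, sub_zero]
  rfl

/-- The first projection of a direct sum. -/
noncomputable def Hom.fst : Hom (prod A B) A where
  toLin := LinearMap.fst ℤ A.L B.L
  map_W _ _ hx := (mem_prod_W.1 hx).1
  map_F _ _ hx := (mem_prod_F.1 hx).1

/-- The second projection of a direct sum. -/
noncomputable def Hom.snd : Hom (prod A B) B where
  toLin := LinearMap.snd ℤ A.L B.L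
  map_W _ _ hx := (mem_prod_W.1 hx).2
  map_F _ _ hx := (mem_prod_F.1 hx).2

/-- The morphism to a direct sum with given components. -/
noncomputable def Hom.pair {T : MHS.{u}} (f : Hom T A) (g : Hom T B) : Hom T (prod A B) where
  toLin := LinearMap.prod f.toLin g.toLin
  map_W k x hx := by
    have h1 := baseChange_fst_prod ℚ f.toLin g.toLin x
    have h2 := baseChange_snd_prod ℚ f.toLin g.toLin x
    exact mem_prod_W.2 ⟨(congrArg (· ∈ A.W k) h1).mpr (f.map_W k hx),
      (congrArg (· ∈ B.W k) h2).mpr (g.map_W k hx)⟩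
  map_F k x hx := by
    have h1 := baseChange_fst_prod ℂ f.toLin g.toLin x
    have h2 := baseChange_snd_prod ℂ f.toLin g.toLin x
    exact mem_prod_F.2 ⟨(congrArg (· ∈ A.F k) h1).mpr (f.map_F k hx),
      (congrArg (· ∈ B.F k) h2).mpr (g.map_F k hx)⟩

end Twist

section Fibre

variable {X Y Z T : MHS.{u}}

/-- The inclusion of a kernel. -/
noncomputable def kerIncl (f : Hom X Y) : Hom (ker f) X where
  toLin := (LinearMap.ker f.toLin).subtype
  map_W _ _ hx := hx
  map_F _ _ hx := hx

/-- The projection to a cokernel. -/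
noncomputable def cokerProj (f : Hom X Y) : Hom Y (coker f) where
  toLin := (LinearMap.range f.toLin).mkQ
  map_W _ _ hx := ⟨_, hx, rfl⟩
  map_F _ _ hx := ⟨_, hx, rfl⟩

theorem kerIncl_injective (f : Hom X Y) : Function.Injective (kerIncl f).toLin :=
  Submodule.injective_subtype _

theorem cokerProj_surjective (f : Hom X Y) : Function.Surjective (cokerProj f).toLin :=
  Submodule.mkQ_surjective _

theorem cokerProj_eq_zero_iff (f : Hom X Y) (y : Y.L) :
    (cokerProj f).toLin y = 0 ↔ ∃ x, f.toLin x = y :=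
  Submodule.Quotient.mk_eq_zero _

/-- The fibre product `{(x, y) | f x = g y}`, as the kernel of `f - g : X ⊕ Y → Z`. -/
noncomputable def fib (f : Hom X Z) (g : Hom Y Z) : MHS.{u} :=
  ker ((f.comp Hom.fst).add (g.comp Hom.snd).neg)

/-- The first projection of a fibre product. -/
noncomputable def fibFst (f : Hom X Z) (g : Hom Y Z) : Hom (fib f g) X :=
  Hom.fst.comp (kerIncl _)

/-- The second projection of a fibre product. -/
noncomputable def fibSnd (f : Hom X Z) (g : Hom Y Z) : Hom (fib f g) Y :=
  Hom.snd.comp (kerIncl _)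

theorem fib_comm (f : Hom X Z) (g : Hom Y Z) (e : (fib f g).L) :
    f.toLin ((fibFst f g).toLin e) = g.toLin ((fibSnd f g).toLin e) := by
  have := e.2
  rw [← sub_eq_zero, sub_eq_add_neg]
  exact this

theorem fib_ext {f : Hom X Z} {g : Hom Y Z} {e e' : (fib f g).L}
    (h1 : (fibFst f g).toLin e = (fibFst f g).toLin e')
    (h2 : (fibSnd f g).toLin e = (fibSnd f g).toLin e') : e = e' :=
  Subtype.ext (Prod.ext h1 h2)

/-- The morphism to a fibre product with given components. -/
noncomputable def fibLift (f : Hom X Z) (g : Hom Y Z) (s : Hom T X) (t : Hom T Y)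
    (h : ∀ x, f.toLin (s.toLin x) = g.toLin (t.toLin x)) : Hom T (fib f g) :=
  Hom.lift (kerIncl _) (kerIncl_injective _) (Hom.pair s t) (fun x =>
    ⟨⟨(s.toLin x, t.toLin x), by
      change f.toLin (s.toLin x) + -g.toLin (t.toLin x) = 0
      rw [h, add_neg_cancel]⟩, rfl⟩)

@[simp] theorem fibFst_lift (f : Hom X Z) (g : Hom Y Z) (s : Hom T X) (t : Hom T Y)
    (h : ∀ x, f.toLin (s.toLin x) = g.toLin (t.toLin x)) (x : T.L) :
    (fibFst f g).toLin ((fibLift f g s t h).toLin x) = s.toLin x := by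
  have := Hom.apply_lift (kerIncl ((f.comp Hom.fst).add (g.comp Hom.snd).neg))
    (kerIncl_injective _) (Hom.pair s t) (fun x =>
    ⟨⟨(s.toLin x, t.toLin x), by
      change f.toLin (s.toLin x) + -g.toLin (t.toLin x) = 0
      rw [h, add_neg_cancel]⟩, rfl⟩) x
  exact congrArg Prod.fst this

@[simp] theorem fibSnd_lift (f : Hom X Z) (g : Hom Y Z) (s : Hom T X) (t : Hom T Y)
    (h : ∀ x, f.toLin (s.toLin x) = g.toLin (t.toLin x)) (x : T.L) :
    (fibSnd f g).toLin ((fibLift f g s t h).toLin x) = t.toLin x := by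
  have := Hom.apply_lift (kerIncl ((f.comp Hom.fst).add (g.comp Hom.snd).neg))
    (kerIncl_injective _) (Hom.pair s t) (fun x =>
    ⟨⟨(s.toLin x, t.toLin x), by
      change f.toLin (s.toLin x) + -g.toLin (t.toLin x) = 0
      rw [h, add_neg_cancel]⟩, rfl⟩) x
  exact congrArg Prod.snd this

theorem fib_exists (f : Hom X Z) (g : Hom Y Z) (x : X.L) (y : Y.L) (h : f.toLin x = g.toLin y) :
    ∃ e, (fibFst f g).toLin e = x ∧ (fibSnd f g).toLin e = y :=
  ⟨⟨(x, y), by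
    change f.toLin x + -g.toLin y = 0
    rw [h, add_neg_cancel]⟩, rfl, rfl⟩

end Fibre

end MHS

/-- An extension `0 → A → H → B → 0` of mixed Hodge structures. -/
structure Extension (B A : MHS.{u}) where
  H : MHS.{u}
  ι : MHS.Hom A H
  π : MHS.Hom H B
  inj : Function.Injective ι.toLin
  exact : Function.Exact ι.toLin π.toLin
  surj : Function.Surjective π.toLin

namespace Extension

open MHS

variable {A B B' : MHS.{u}}

/-- Equivalence of extensions: a morphism inducing the identity on `A` and on `B`. -/
def Equiv (E E' : Extension B A) : Prop :=
  ∃ φ : Hom E.H E'.H, (∀ a, φ.toLin (E.ι.toLin a) = E'.ι.toLin a) ∧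
    ∀ h, E'.π.toLin (φ.toLin h) = E.π.toLin h

theorem π_ι (E : Extension B A) (a : A.L) : E.π.toLin (E.ι.toLin a) = 0 :=
  (E.exact _).2 ⟨a, rfl⟩

theorem Equiv.refl (E : Extension B A) : E.Equiv E := ⟨Hom.id _, fun _ => rfl, fun _ => rfl⟩

theorem Equiv.trans {E E' E'' : Extension B A} (h : E.Equiv E') (h' : E'.Equiv E'') :
    E.Equiv E'' := by
  obtain ⟨φ, h1, h2⟩ := h
  obtain ⟨ψ, h3, h4⟩ := h'
  exact ⟨ψ.comp φ, fun a => by rw [Hom.comp_apply, h1, h3],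
    fun x => by rw [Hom.comp_apply, h4, h2]⟩

theorem Equiv.symm {E E' : Extension B A} (h : E.Equiv E') : E'.Equiv E := by
  obtain ⟨φ, h1, h2⟩ := h
  have inj : ∀ x, φ.toLin x = 0 → x = 0 := by
    intro x hx
    obtain ⟨a, rfl⟩ := (E.exact x).1 (by rw [← h2, hx, map_zero])
    rw [h1, ← map_zero E'.ι.toLin] at hx
    rw [E'.inj hx, map_zero]
  have surj : Function.Surjective φ.toLin := by
    intro y
    obtain ⟨x, hx⟩ := E.surj (E'.π.toLin y)
    obtain ⟨a, ha⟩ := (E'.exact (y - φ.toLin x)).1 (by rw [map_sub, h2, hx, sub_self])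
    exact ⟨x + E.ι.toLin a, by rw [map_add, h1, ha, add_sub_cancel]⟩
  have inj' : ∀ x, φ.toLin x = 0 → (Hom.id E.H).toLin x = 0 := inj
  have hd := Hom.descend_apply φ surj (Hom.id _) inj'
  refine ⟨Hom.descend φ surj (Hom.id _) inj', fun a => ?_, fun y => ?_⟩
  · rw [← h1, hd, Hom.id_apply]
  · obtain ⟨x, rfl⟩ := surj y
    rw [hd, Hom.id_apply, h2]

instance setoid (B A : MHS.{u}) : Setoid (Extension B A) where
  r := Equiv
  iseqv := ⟨Equiv.refl, Equiv.symm, Equiv.trans⟩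

/-- The pullback of an extension of `B` by `A` along a morphism `f : B' → B`; its middle term is
the fibre product `H ×_B B'`. -/
noncomputable def pullback (f : Hom B' B) (E : Extension B A) : Extension B' A where
  H := fib E.π f
  ι := fibLift E.π f E.ι (Hom.zero A B') (fun a => by rw [E.π_ι, Hom.zero_apply, map_zero])
  π := fibSnd E.π f
  inj a a' h := E.inj (by
    have := congrArg (fibFst E.π f).toLin h
    rwa [fibFst_lift, fibFst_lift] at this)
  exact e := by
    constructor
    · intro h
      obtain ⟨a, ha⟩ := (E.exact ((fibFst E.π f).toLin e)).1 (by rw [fib_comm, h, map_zero])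
      exact ⟨a, fib_ext (by rw [fibFst_lift, ha]) (by rw [fibSnd_lift, h, Hom.zero_apply])⟩
    · rintro ⟨a, rfl⟩
      rw [fibSnd_lift, Hom.zero_apply]
  surj b := by
    obtain ⟨x, hx⟩ := E.surj (f.toLin b)
    obtain ⟨e, -, he⟩ := fib_exists E.π f x b hx
    exact ⟨e, he⟩

theorem pullback_congr (f : Hom B' B) {E E' : Extension B A} (h : E.Equiv E') :
    (E.pullback f).Equiv (E'.pullback f) := by
  obtain ⟨φ, h1, h2⟩ := h
  let s : Hom (fib E.π f) (fib E'.π f) := fibLift E'.π f (φ.comp (fibFst E.π f)) (fibSnd E.π f)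
    (fun e => by rw [Hom.comp_apply, h2, fib_comm])
  have hs1 : ∀ e, (fibFst E'.π f).toLin (s.toLin e) = φ.toLin ((fibFst E.π f).toLin e) :=
    fun e => fibFst_lift _ _ _ _ _ _
  have hs2 : ∀ e, (fibSnd E'.π f).toLin (s.toLin e) = (fibSnd E.π f).toLin e :=
    fun e => fibSnd_lift _ _ _ _ _ _
  let i (D : Extension B A) : Hom A (fib D.π f) := fibLift D.π f D.ι (Hom.zero A B')
    (fun a => by rw [D.π_ι, Hom.zero_apply, map_zero])
  have hi1 : ∀ D a, (fibFst D.π f).toLin ((i D).toLin a) = D.ι.toLin a :=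
    fun D a => fibFst_lift _ _ _ _ _ _
  have hi2 : ∀ D a, (fibSnd D.π f).toLin ((i D).toLin a) = 0 :=
    fun D a => fibSnd_lift _ _ _ _ _ _
  have key : ∀ a, s.toLin ((i E).toLin a) = (i E').toLin a := fun a =>
    fib_ext (by rw [hs1, hi1, hi1, h1]) (by rw [hs2, hi2, hi2])
  exact ⟨s, key, hs2⟩

section Baer

variable (E₁ E₂ E₃ : Extension B A)

/-- The antidiagonal embedding `a ↦ (ι₁ a, - ι₂ a)` of `A` into `H₁ ×_B H₂`. -/
noncomputable def anti : Hom A (fib E₁.π E₂.π) :=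
  fibLift E₁.π E₂.π E₁.ι E₂.ι.neg (fun a => by
    rw [E₁.π_ι, Hom.neg_apply, map_neg, E₂.π_ι, neg_zero])

/-- The projection from `H₁ ×_B H₂` to its quotient by the antidiagonal. -/
noncomputable def baerMk : Hom (fib E₁.π E₂.π) (coker (anti E₁ E₂)) := cokerProj _

theorem baerMk_surjective : Function.Surjective (baerMk E₁ E₂).toLin := cokerProj_surjective _

theorem baerMk_eq_zero_iff (e : (fib E₁.π E₂.π).L) : (baerMk E₁ E₂).toLin e = 0 ↔
    ∃ a, (fibFst E₁.π E₂.π).toLin e = E₁.ι.toLin a ∧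
      (fibSnd E₁.π E₂.π).toLin e = -E₂.ι.toLin a := by
  refine (cokerProj_eq_zero_iff _ _).trans ⟨?_, ?_⟩
  · rintro ⟨a, rfl⟩
    exact ⟨a, by rw [anti, fibFst_lift], by rw [anti, fibSnd_lift, Hom.neg_apply]⟩
  · rintro ⟨a, h1, h2⟩
    exact ⟨a, fib_ext (by rw [anti, fibFst_lift, h1]) (by rw [anti, fibSnd_lift, h2,
      Hom.neg_apply])⟩

/-- The embedding `a ↦ (ι₁ a, 0)` of `A` into `H₁ ×_B H₂`. -/
noncomputable def baerIn : Hom A (fib E₁.π E₂.π) :=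
  fibLift E₁.π E₂.π E₁.ι (Hom.zero A E₂.H) (fun a => by rw [E₁.π_ι, Hom.zero_apply, map_zero])

/-- The Baer sum of two extensions: the quotient of `H₁ ×_B H₂` by the antidiagonal copy
`{(ι₁ a, - ι₂ a)}` of `A`. -/
noncomputable def baer : Extension B A where
  H := coker (anti E₁ E₂)
  ι := (baerMk E₁ E₂).comp (baerIn E₁ E₂)
  π := Hom.descend (baerMk E₁ E₂) (baerMk_surjective E₁ E₂) (E₁.π.comp (fibFst E₁.π E₂.π))
    (fun e he => by
      obtain ⟨a, h1, -⟩ := (baerMk_eq_zero_iff _ _ _).1 he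
      rw [Hom.comp_apply, h1, E₁.π_ι])
  inj := by
    rw [injective_iff_map_eq_zero]
    intro a ha
    obtain ⟨a', h1, h2⟩ := (baerMk_eq_zero_iff _ _ _).1 ha
    rw [baerIn, fibFst_lift] at h1
    rw [baerIn, fibSnd_lift, Hom.zero_apply, eq_comm, neg_eq_zero, ← map_zero E₂.ι.toLin] at h2
    rw [E₁.inj h1, E₂.inj h2]
  exact := by
    intro x
    obtain ⟨e, rfl⟩ := baerMk_surjective E₁ E₂ x
    rw [Hom.descend_apply, Hom.comp_apply]
    constructor
    · intro h
      obtain ⟨a, ha⟩ := (E₁.exact _).1 h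
      rw [fib_comm] at h
      obtain ⟨a', ha'⟩ := (E₂.exact _).1 h
      refine ⟨a + a', ?_⟩
      rw [← sub_eq_zero, Hom.comp_apply, ← map_sub]
      refine (baerMk_eq_zero_iff _ _ _).2 ⟨a', ?_, ?_⟩
      · rw [map_sub, baerIn, fibFst_lift, ← ha, map_add, add_sub_cancel_left]
      · rw [map_sub, baerIn, fibSnd_lift, ← ha', Hom.zero_apply, zero_sub]
    · rintro ⟨a, ha⟩
      rw [← sub_eq_zero, Hom.comp_apply, ← map_sub] at ha
      obtain ⟨a', h1, -⟩ := (baerMk_eq_zero_iff _ _ _).1 ha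
      rw [map_sub, baerIn, fibFst_lift, sub_eq_iff_eq_add, eq_comm, ← eq_sub_iff_add_eq'] at h1
      rw [h1, ← map_sub, E₁.π_ι]
  surj b := by
    obtain ⟨x, hx⟩ := E₁.surj b
    obtain ⟨y, hy⟩ := E₂.surj b
    obtain ⟨e, h1, -⟩ := fib_exists E₁.π E₂.π x y (by rw [hx, hy])
    exact ⟨(baerMk E₁ E₂).toLin e, by rw [Hom.descend_apply, Hom.comp_apply, h1, hx]⟩

/-- The sum map `H₁ ×_B H₂ → H` to the middle term of the Baer sum. -/
noncomputable def baerSum : Hom (fib E₁.π E₂.π) (baer E₁ E₂).H := baerMk E₁ E₂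

theorem baerSum_surjective : Function.Surjective (baerSum E₁ E₂).toLin := baerMk_surjective _ _

theorem baer_π (e : (fib E₁.π E₂.π).L) :
    (baer E₁ E₂).π.toLin ((baerSum E₁ E₂).toLin e) = E₁.π.toLin ((fibFst E₁.π E₂.π).toLin e) :=
  Hom.descend_apply _ _ _ _ _

theorem baer_ι (e : (fib E₁.π E₂.π).L) (a₁ a₂ : A.L)
    (h1 : (fibFst E₁.π E₂.π).toLin e = E₁.ι.toLin a₁)
    (h2 : (fibSnd E₁.π E₂.π).toLin e = E₂.ι.toLin a₂) :
    (baerSum E₁ E₂).toLin e = (baer E₁ E₂).ι.toLin (a₁ + a₂) := by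
  change (baerMk E₁ E₂).toLin e = (baerMk E₁ E₂).toLin ((baerIn E₁ E₂).toLin (a₁ + a₂))
  rw [← sub_eq_zero, ← map_sub]
  refine (baerMk_eq_zero_iff _ _ _).2 ⟨-a₂, ?_, ?_⟩
  · rw [map_sub, baerIn, fibFst_lift, h1, map_add, map_neg]; abel
  · rw [map_sub, baerIn, fibSnd_lift, h2, Hom.zero_apply, map_neg]; abel

variable {E₁ E₂ E₃}

/-- A morphism `H₁ ×_B H₂ → H₃` which is the sum on `A × A` and lies over `B` identifies the Baer
sum. -/
theorem baer_equiv (s : Hom (fib E₁.π E₂.π) E₃.H)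
    (hs : ∀ e a₁ a₂, (fibFst E₁.π E₂.π).toLin e = E₁.ι.toLin a₁ →
      (fibSnd E₁.π E₂.π).toLin e = E₂.ι.toLin a₂ → s.toLin e = E₃.ι.toLin (a₁ + a₂))
    (hs' : ∀ e, E₃.π.toLin (s.toLin e) = E₁.π.toLin ((fibFst E₁.π E₂.π).toLin e)) :
    (baer E₁ E₂).Equiv E₃ := by
  refine ⟨Hom.descend (baerSum E₁ E₂) (baerSum_surjective E₁ E₂) s (fun e he => ?_),
    fun a => ?_, fun x => ?_⟩
  · obtain ⟨a, h1, h2⟩ := (baerMk_eq_zero_iff _ _ _).1 he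
    rw [hs e a (-a) h1 (by rw [h2, map_neg]), add_neg_cancel, map_zero]
  · have h1 : (fibFst E₁.π E₂.π).toLin ((baerIn E₁ E₂).toLin a) = E₁.ι.toLin a := by
      rw [baerIn, fibFst_lift]
    have h2 : (fibSnd E₁.π E₂.π).toLin ((baerIn E₁ E₂).toLin a) = E₂.ι.toLin 0 := by
      rw [baerIn, fibSnd_lift, Hom.zero_apply, map_zero]
    have h3 := baer_ι E₁ E₂ _ a 0 h1 h2
    rw [add_zero] at h3
    rw [← h3, Hom.descend_apply, hs _ a 0 h1 h2, add_zero]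
  · obtain ⟨e, rfl⟩ := baerSum_surjective E₁ E₂ x
    rw [Hom.descend_apply, hs', baer_π]

theorem baer_congr {E₁' E₂' : Extension B A} (h : E₁.Equiv E₁') (h' : E₂.Equiv E₂') :
    (baer E₁ E₂).Equiv (baer E₁' E₂') := by
  obtain ⟨φ, h1, h2⟩ := h
  obtain ⟨ψ, h3, h4⟩ := h'
  refine baer_equiv ((baerSum E₁' E₂').comp (fibLift E₁'.π E₂'.π (φ.comp (fibFst _ _))
    (ψ.comp (fibSnd _ _)) (fun e => ?_))) (fun e a₁ a₂ e1 e2 => ?_) (fun e => ?_)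
  · rw [Hom.comp_apply, Hom.comp_apply, h2, h4, fib_comm]
  · rw [Hom.comp_apply]
    refine baer_ι _ _ _ _ _ ?_ ?_
    · rw [fibFst_lift, Hom.comp_apply, e1, h1]
    · rw [fibSnd_lift, Hom.comp_apply, e2, h3]
  · rw [Hom.comp_apply, baer_π, fibFst_lift, Hom.comp_apply, h2]

theorem baer_comm : (baer E₁ E₂).Equiv (baer E₂ E₁) := by
  refine baer_equiv ((baerSum E₂ E₁).comp (fibLift E₂.π E₁.π (fibSnd _ _) (fibFst _ _)
    (fun e => (fib_comm _ _ e).symm))) (fun e a₁ a₂ e1 e2 => ?_) (fun e => ?_)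
  · rw [Hom.comp_apply, add_comm]
    refine baer_ι _ _ _ _ _ ?_ ?_
    · rw [fibFst_lift, e2]
    · rw [fibSnd_lift, e1]
  · rw [Hom.comp_apply, baer_π, fibFst_lift, fib_comm]

theorem baer_assoc : (baer (baer E₁ E₂) E₃).Equiv (baer E₁ (baer E₂ E₃)) := by
  let p₁ := E₁.π.comp (fibFst E₁.π E₂.π)
  let t : Hom (fib p₁ E₃.π) (fib (baer E₁ E₂).π E₃.π) :=
    fibLift _ _ ((baerSum E₁ E₂).comp (fibFst _ _)) (fibSnd _ _) (fun e => by
      rw [Hom.comp_apply, baer_π, ← fib_comm]; rfl)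
  have ht1 : ∀ e, (fibFst (baer E₁ E₂).π E₃.π).toLin (t.toLin e) =
      (baerSum E₁ E₂).toLin ((fibFst p₁ E₃.π).toLin e) := fun e => fibFst_lift _ _ _ _ _ _
  have ht2 : ∀ e, (fibSnd (baer E₁ E₂).π E₃.π).toLin (t.toLin e) =
      (fibSnd p₁ E₃.π).toLin e := fun e => fibSnd_lift _ _ _ _ _ _
  have htS : Function.Surjective t.toLin := by
    intro y
    obtain ⟨x, hx⟩ := baerSum_surjective E₁ E₂ ((fibFst _ _).toLin y)
    obtain ⟨e, h1, h2⟩ := fib_exists p₁ E₃.π x ((fibSnd _ _).toLin y) (by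
      rw [← fib_comm, ← hx, baer_π]; rfl)
    exact ⟨e, fib_ext (by rw [ht1, h1, hx]) (by rw [ht2, h2])⟩
  let r : Hom (fib p₁ E₃.π) (fib E₂.π E₃.π) :=
    fibLift _ _ ((fibSnd _ _).comp (fibFst _ _)) (fibSnd _ _) (fun e => by
      rw [Hom.comp_apply, ← fib_comm, ← fib_comm]; rfl)
  have hr1 : ∀ e, (fibFst E₂.π E₃.π).toLin (r.toLin e) =
      (fibSnd E₁.π E₂.π).toLin ((fibFst p₁ E₃.π).toLin e) := fun e => fibFst_lift _ _ _ _ _ _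
  have hr2 : ∀ e, (fibSnd E₂.π E₃.π).toLin (r.toLin e) =
      (fibSnd p₁ E₃.π).toLin e := fun e => fibSnd_lift _ _ _ _ _ _
  let s₀ : Hom (fib p₁ E₃.π) (fib E₁.π (baer E₂ E₃).π) :=
    fibLift _ _ ((fibFst _ _).comp (fibFst _ _)) ((baerSum E₂ E₃).comp r) (fun e => by
      rw [Hom.comp_apply, Hom.comp_apply, baer_π, hr1, fib_comm])
  have hs1 : ∀ e, (fibFst E₁.π (baer E₂ E₃).π).toLin (s₀.toLin e) =
      (fibFst E₁.π E₂.π).toLin ((fibFst p₁ E₃.π).toLin e) := fun e => fibFst_lift _ _ _ _ _ _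
  have hs2 : ∀ e, (fibSnd E₁.π (baer E₂ E₃).π).toLin (s₀.toLin e) =
      (baerSum E₂ E₃).toLin (r.toLin e) := fun e => fibSnd_lift _ _ _ _ _ _
  let s := (baerSum E₁ (baer E₂ E₃)).comp s₀
  have key : ∀ e a a₃, (baerSum E₁ E₂).toLin ((fibFst p₁ E₃.π).toLin e) =
      (baer E₁ E₂).ι.toLin a → (fibSnd p₁ E₃.π).toLin e = E₃.ι.toLin a₃ →
      s.toLin e = (baer E₁ (baer E₂ E₃)).ι.toLin (a + a₃) := by
    intro e a a₃ h1 h2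
    have h3 : E₁.π.toLin ((fibFst E₁.π E₂.π).toLin ((fibFst p₁ E₃.π).toLin e)) = 0 := by
      rw [← baer_π, h1, π_ι]
    obtain ⟨a₁, ha₁⟩ := (E₁.exact _).1 h3
    rw [fib_comm] at h3
    obtain ⟨a₂, ha₂⟩ := (E₂.exact _).1 h3
    have h4 := baer_ι E₁ E₂ _ a₁ a₂ ha₁.symm ha₂.symm
    rw [h1] at h4
    rw [(baer E₁ E₂).inj h4, add_assoc, Hom.comp_apply]
    refine baer_ι _ _ _ _ _ ?_ ?_
    · rw [hs1, ha₁]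
    · rw [hs2]
      exact baer_ι _ _ _ _ _ (by rw [hr1, ha₂]) (by rw [hr2, h2])
  refine baer_equiv (Hom.descend t htS s (fun e he => ?_)) (fun y a a₃ h1 h2 => ?_) (fun y => ?_)
  · have h1 := ht1 e
    have h2 := ht2 e
    rw [he, map_zero] at h1 h2
    rw [key e 0 0 (by rw [← h1, map_zero]) (by rw [← h2, map_zero]), add_zero, map_zero]
  · obtain ⟨e, rfl⟩ := htS y
    rw [Hom.descend_apply]
    exact key e a a₃ (by rw [← ht1, h1]) (by rw [← ht2, h2])
  · obtain ⟨e, rfl⟩ := htS y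
    rw [Hom.descend_apply, Hom.comp_apply, baer_π, hs1, ht1, baer_π]

/-- The extension with middle term `(A ⊕ B, W ⊕ W, F_θ)`. -/
noncomputable def ofTwist (θ : W0Hom B A) : Extension B A where
  H := twist A B θ
  ι :=
    { toLin := LinearMap.inl ℤ A.L B.L
      map_W := fun k x hx => by
        refine ⟨?_, ?_⟩
        · have h := baseChange_fst_inl (L₂ := B.L) ℚ x
          exact (congrArg (· ∈ A.W k) h).mpr hx
        · have h := baseChange_snd_inl (L₂ := B.L) ℚ x
          exact (congrArg (· ∈ B.W k) h).mpr (zero_mem _)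
      map_F := fun k x hx => by
        have h := baseChange_fst_inl (L₂ := B.L) ℂ x
        have h' := baseChange_snd_inl (L₂ := B.L) ℂ x
        refine ⟨?_, ?_⟩
        · change fstC A B _ - θ.1 (sndC A B _) ∈ A.F k
          have e : fstC A B ((LinearMap.inl ℤ A.L B.L).baseChange ℂ x) -
              θ.1 (sndC A B ((LinearMap.inl ℤ A.L B.L).baseChange ℂ x)) = x := by
            rw [h, h', map_zero, sub_zero]
          exact (congrArg (· ∈ A.F k) e).mpr hx
        · exact (congrArg (· ∈ B.F k) h').mpr (zero_mem _) }
  π :=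
    { toLin := LinearMap.snd ℤ A.L B.L
      map_W := fun _ _ hx => hx.2
      map_F := fun _ _ hx => hx.2 }
  inj := LinearMap.inl_injective
  exact := Function.Exact.inl_snd
  surj := LinearMap.snd_surjective

/-- The split extension, with middle term `A ⊕ B`. -/
noncomputable def split (B A : MHS.{u}) : Extension B A := ofTwist 0

/-- The morphism to the middle term of the split extension with given components. -/
noncomputable def toSplit {T : MHS.{u}} (f : Hom T A) (g : Hom T B) : Hom T (split B A).H :=
  Hom.pair f g

theorem baer_split : (baer E₁ (split B A)).Equiv E₁ := by
  let q : Hom (split B A).H A := Hom.fst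
  refine baer_equiv ((fibFst E₁.π (split B A).π).add (E₁.ι.comp (q.comp
    (fibSnd E₁.π (split B A).π)))) (fun e a₁ a₂ e1 e2 => ?_) (fun e => ?_)
  · rw [Hom.add_apply, Hom.comp_apply, Hom.comp_apply, e1, e2, map_add]
    rfl
  · rw [Hom.add_apply, map_add, Hom.comp_apply, π_ι, add_zero]

/-- The opposite extension, with the sign of `ι` changed. -/
def opposite (E : Extension B A) : Extension B A where
  H := E.H
  ι := E.ι.neg
  π := E.π
  inj a a' h := E.inj (neg_injective h)
  exact x := by
    rw [E.exact x]
    constructor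
    · rintro ⟨a, rfl⟩; exact ⟨-a, by simp⟩
    · rintro ⟨a, rfl⟩; exact ⟨-a, by simp⟩
  surj := E.surj

theorem opposite_congr (h : E₁.Equiv E₂) : E₁.opposite.Equiv E₂.opposite := by
  obtain ⟨φ, h1, h2⟩ := h
  refine ⟨φ, fun a => ?_, h2⟩
  change φ.toLin (E₁.ι.neg.toLin a) = E₂.ι.neg.toLin a
  rw [Hom.neg_apply, Hom.neg_apply, map_neg, h1]

theorem baer_opposite : (baer E₁.opposite E₁).Equiv (split B A) := by
  let d : Hom (fib E₁.opposite.π E₁.π) E₁.H :=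
    (fibSnd E₁.opposite.π E₁.π).add (fibFst E₁.opposite.π E₁.π).neg
  let d₁ : Hom (fib E₁.opposite.π E₁.π) E₁.H := fibFst E₁.opposite.π E₁.π
  have hdd : ∀ e, d.toLin e = (fibSnd E₁.opposite.π E₁.π).toLin e + -d₁.toLin e := fun _ => rfl
  have e1' : ∀ e a, (fibFst E₁.opposite.π E₁.π).toLin e = E₁.opposite.ι.toLin a →
    d₁.toLin e = E₁.ι.neg.toLin a := fun _ _ h => h
  have hd : ∀ e, ∃ a, E₁.ι.toLin a = d.toLin e := fun e => (E₁.exact _).1 (by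
    rw [hdd, map_add, map_neg, ← fib_comm]
    exact add_neg_cancel _)
  refine baer_equiv (toSplit (Hom.lift E₁.ι E₁.inj d hd) (E₁.π.comp (fibSnd _ _)))
    (fun e a₁ a₂ e1 e2 => ?_) (fun e => ?_)
  · refine Prod.ext ?_ ?_
    · refine E₁.inj ((Hom.apply_lift E₁.ι E₁.inj d hd e).trans ?_)
      rw [hdd, e1' e a₁ e1, e2]
      change E₁.ι.toLin a₂ + -(E₁.ι.neg.toLin a₁) = E₁.ι.toLin (a₁ + a₂)
      rw [Hom.neg_apply, neg_neg, map_add, add_comm]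
    · change E₁.π.toLin ((fibSnd _ _).toLin e) = 0
      rw [e2, π_ι]
  · change E₁.π.toLin ((fibSnd _ _).toLin e) = E₁.opposite.π.toLin ((fibFst _ _).toLin e)
    rw [fib_comm]

end Baer

end Extension

/-- `Ext¹(B, A)` in the category of mixed Hodge structures: equivalence classes of extensions of
`B` by `A`. -/
def Ext (B A : MHS.{u}) : Type (u + 1) := Quotient (Extension.setoid B A)

namespace Ext

variable {A B B' : MHS.{u}}

/-- The class of an extension. -/
def mk (E : Extension B A) : Ext B A := Quotient.mk _ E

theorem sound {E E' : Extension B A} (h : E.Equiv E') : mk E = mk E' := Quotient.sound h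

/-- The sum of extension classes is given by the Baer sum. -/
noncomputable instance : Add (Ext B A) :=
  ⟨Quotient.map₂ Extension.baer (fun _ _ h _ _ h' => Extension.baer_congr h h')⟩

/-- The zero class is the class of the split extension. -/
noncomputable instance : Zero (Ext B A) := ⟨mk (Extension.split B A)⟩

/-- The opposite of an extension class. -/
noncomputable instance : Neg (Ext B A) :=
  ⟨Quotient.map Extension.opposite (fun _ _ h => Extension.opposite_congr h)⟩

/-- `Ext¹(B, A)` is an abelian group under the Baer sum. -/
noncomputable instance : AddCommGroup (Ext B A) where
  add_assoc := by rintro ⟨x⟩ ⟨y⟩ ⟨z⟩; exact sound Extension.baer_assoc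
  add_comm := by rintro ⟨x⟩ ⟨y⟩; exact sound Extension.baer_comm
  add_zero := by rintro ⟨x⟩; exact sound Extension.baer_split
  zero_add := by
    rintro ⟨x⟩; exact sound (Extension.baer_comm.trans Extension.baer_split)
  neg_add_cancel := by rintro ⟨x⟩; exact sound Extension.baer_opposite
  nsmul := nsmulRec
  zsmul := zsmulRec

/-- Pullback of extension classes along `f : B' → B`. -/
noncomputable def pullback (f : MHS.Hom B' B) : Ext B A → Ext B' A :=
  Quotient.map (Extension.pullback f) (fun _ _ h => Extension.pullback_congr f h)

end Ext

namespace MHS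

/-- The pure mixed Hodge structure of type `(p, p)` on a finitely generated abelian group `M`,
that is, `M ⊗ ℤ(-p)`. -/
noncomputable def tate (p : ℤ) (M : Type u) [AddCommGroup M] [Module.Finite ℤ M] : MHS.{u} :=
  ofOpposed M (fun k => if 2 * p ≤ k then ⊤ else ⊥) (fun q => if q ≤ p then ⊤ else ⊥)
    (by
      intro k l h
      dsimp only
      split_ifs with h1 h2
      · exact le_rfl
      · omega
      · exact bot_le
      · exact le_rfl)
    ⟨2 * p - 1, if_neg (by omega)⟩ ⟨2 * p, if_pos le_rfl⟩
    { W_mono := by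
        intro k l h
        dsimp only
        split_ifs with h1 h2
        · exact le_rfl
        · omega
        · exact cx_mono bot_le
        · exact le_rfl
      F_anti := by
        intro k l h
        dsimp only
        split_ifs with h1 h2
        · exact le_rfl
        · omega
        · exact bot_le
        · exact le_rfl
      G_anti := by
        intro k l h
        dsimp only
        split_ifs with h1 h2
        · exact le_rfl
        · omega
        · exact Submodule.comap_mono bot_le
        · exact le_rfl
      W_bot := ⟨2 * p - 1, by rw [if_neg (by omega), cx_bot]⟩
      W_top := ⟨2 * p, by rw [if_pos le_rfl, cx_top]⟩
      F_bot := ⟨p + 1, if_neg (by omega)⟩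
      F_top := ⟨p, if_pos le_rfl⟩
      G_bot := ⟨p + 1, by rw [if_neg (by omega), comap_conj_bot]⟩
      G_top := ⟨p, by rw [if_pos le_rfl, Submodule.comap_top]⟩
      span := by
        intro k a b hab x hx
        by_cases h1 : 2 * p ≤ k - 1
        · exact ⟨0, 0, zero_mem _, zero_mem _, zero_mem _, zero_mem _, by
            rw [if_pos h1, cx_top]; trivial⟩
        by_cases h2 : 2 * p ≤ k
        · by_cases ha : a ≤ p
          · exact ⟨x, 0, by rw [if_pos ha]; trivial, hx, zero_mem _, zero_mem _, by simp⟩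
          · exact ⟨0, x, zero_mem _, zero_mem _, by
              rw [if_pos (by omega)]; trivial, hx, by simp⟩
        · rw [if_neg h2, cx_bot, Submodule.mem_bot] at hx
          subst hx
          exact ⟨0, 0, zero_mem _, zero_mem _, zero_mem _, zero_mem _, by simp⟩
      disj := by
        intro k a b hab x y hx hx' hy hy' e
        by_cases h1 : 2 * p ≤ k - 1
        · rw [if_pos h1, cx_top]; trivial
        by_cases h2 : 2 * p ≤ k
        · by_cases ha : a ≤ p
          · rw [if_neg (by omega), comap_conj_bot, Submodule.mem_bot] at hy
            rwa [hy, sub_zero] at e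
          · rw [if_neg ha, Submodule.mem_bot] at hx
            rw [hx]; exact zero_mem _
        · rw [if_neg h2, cx_bot, Submodule.mem_bot] at hx'
          rw [hx']; exact zero_mem _ }

/-- The Tate structure `ℤ(-p)`, pure of type `(p, p)`. -/
noncomputable def tateZ (p : ℤ) : MHS.{u} := tate p (ULift.{u} ℤ)

/-- The generator `1` of `ℤ(-p)`. -/
def tateGen (p : ℤ) : (tateZ.{u} p).L := (ULift.up 1 : ULift.{u} ℤ)

/-- The group of integral classes of type `(p, p)`: the elements `b` of the lattice whose image
in `B_ℂ` lies in `F^p ∩ conj F^p`, and whose image in `B_ℚ` lies in `W_{2p}` (which is no condition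
if `B` is pure of weight `2p`; then this is `B_ℤ^{p,p}`). -/
noncomputable def hodge (p : ℤ) (B : MHS.{u}) : Submodule ℤ B.L :=
  ((B.F p ⊓ B.Fbar p).restrictScalars ℤ).comap (TensorProduct.mk ℤ ℂ B.L 1) ⊓
    ((B.W (2 * p)).restrictScalars ℤ).comap (TensorProduct.mk ℤ ℚ B.L 1)

theorem mem_hodge {p : ℤ} {B : MHS.{u}} {b : B.L} : b ∈ hodge p B ↔
    ((1 : ℂ) ⊗ₜ[ℤ] b ∈ B.F p ∧ (1 : ℂ) ⊗ₜ[ℤ] b ∈ B.Fbar p) ∧ (1 : ℚ) ⊗ₜ[ℤ] b ∈ B.W (2 * p) :=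
  Iff.rfl

theorem mem_hodge_tate (p : ℤ) (M : Type u) [AddCommGroup M] [Module.Finite ℤ M] (m : M) :
    m ∈ hodge p (tate p M) := by
  refine mem_hodge.2 ⟨⟨?_, ?_⟩, ?_⟩
  · change _ ∈ (if p ≤ p then (⊤ : Submodule ℂ (ℂ ⊗[ℤ] M)) else ⊥)
    rw [if_pos le_rfl]; trivial
  · change _ ∈ Submodule.comap _ (if p ≤ p then (⊤ : Submodule ℂ (ℂ ⊗[ℤ] M)) else ⊥)
    rw [if_pos le_rfl]; trivial
  · change _ ∈ (if 2 * p ≤ 2 * p then (⊤ : Submodule ℚ (ℚ ⊗[ℤ] M)) else ⊥)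
    rw [if_pos le_rfl]; trivial

/-- A homomorphism `M → B_ℤ` with values in the integral classes of type `(p, p)` is a morphism of
mixed Hodge structures `M ⊗ ℤ(-p) → B`. -/
noncomputable def ofHodge {p : ℤ} {B : MHS.{u}} {M : Type u} [AddCommGroup M] [Module.Finite ℤ M]
    (f : M →ₗ[ℤ] B.L) (hf : ∀ m, f m ∈ hodge p B) : Hom (tate p M) B where
  toLin := f
  map_W k := by
    change (if 2 * p ≤ k then (⊤ : Submodule ℚ (ℚ ⊗[ℤ] M)) else ⊥) ≤
      (B.W k).comap (f.baseChange ℚ)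
    split_ifs with h
    · intro x _
      rw [Submodule.mem_comap]
      refine B.W_mono h ?_
      induction x with
      | zero => rw [map_zero]; exact zero_mem _
      | tmul q m =>
        rw [LinearMap.baseChange_tmul, show q ⊗ₜ[ℤ] f m = q • ((1 : ℚ) ⊗ₜ[ℤ] f m) by
          rw [TensorProduct.smul_tmul', smul_eq_mul, mul_one]]
        exact Submodule.smul_mem _ _ (mem_hodge.1 (hf m)).2
      | add x y hx hy => rw [map_add]; exact add_mem (hx trivial) (hy trivial)
    · exact bot_le
  map_F k := by
    change (if k ≤ p then (⊤ : Submodule ℂ (ℂ ⊗[ℤ] M)) else ⊥) ≤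
      (B.F k).comap (f.baseChange ℂ)
    split_ifs with h
    · intro x _
      rw [Submodule.mem_comap]
      refine B.F_anti h ?_
      induction x with
      | zero => rw [map_zero]; exact zero_mem _
      | tmul q m =>
        rw [LinearMap.baseChange_tmul, show q ⊗ₜ[ℤ] f m = q • ((1 : ℂ) ⊗ₜ[ℤ] f m) by
          rw [TensorProduct.smul_tmul', smul_eq_mul, mul_one]]
        exact Submodule.smul_mem _ _ (mem_hodge.1 (hf m)).1.1
      | add x y hx hy => rw [map_add]; exact add_mem (hx trivial) (hy trivial)
    · exact bot_le

/-- `B_ℤ^{p,p}` as a mixed Hodge structure, pure of type `(p, p)`. -/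
noncomputable def hodgePart (p : ℤ) (B : MHS.{u}) : MHS.{u} := tate p (hodge p B)

/-- The inclusion `i : B_ℤ^{p,p} → B`. -/
noncomputable def hodgeIncl (p : ℤ) (B : MHS.{u}) : Hom (hodgePart p B) B :=
  ofHodge (hodge p B).subtype (fun m => m.2)

/-- The morphism `ℤ(-p) → B`, `1 ↦ b`, given by an integral class `b` of type `(p, p)`. -/
noncomputable def classHom {p : ℤ} {B : MHS.{u}} (b : hodge p B) : Hom (tateZ p) B :=
  ofHodge (LinearMap.toSpanSingleton ℤ B.L b.1 ∘ₗ ULift.moduleEquiv.toLinearMap)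
    (fun m => (hodge p B).smul_mem m.down b.2)

/-- The morphism `ℤ(-p) → B_ℤ^{p,p}`, `1 ↦ b`. -/
noncomputable def classHomPart {p : ℤ} {B : MHS.{u}} (b : hodge p B) :
    Hom (tateZ p) (hodgePart p B) :=
  classHom (B := hodgePart p B) ⟨b, mem_hodge_tate p _ b⟩

/-- The `p`-th Jacobian `J^p(A) = A_ℂ / (F^p A_ℂ + A_ℤ)`. -/
abbrev J (p : ℤ) (A : MHS.{u}) : Type u :=
  (ℂ ⊗[ℤ] A.L) ⧸ ((A.F p).restrictScalars ℤ ⊔ LinearMap.range (TensorProduct.mk ℤ ℂ A.L 1))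

/-- The quotient map `A_ℂ → J^p(A)`. -/
noncomputable def toJ (p : ℤ) (A : MHS.{u}) : (ℂ ⊗[ℤ] A.L) →ₗ[ℤ] J p A := Submodule.mkQ _

end MHS

namespace Extension

open MHS

variable {A : MHS.{u}} {p : ℤ}

/-- `a ∈ A_ℂ` is the difference `f - h` of a lift `f ∈ F^p H_ℂ` and a lift `h ∈ H_ℤ` of the
generator `1` of `ℤ(-p)`. -/
def IsDiff (E : Extension (tateZ p) A) (a : ℂ ⊗[ℤ] A.L) : Prop :=
  ∃ (h : E.H.L) (f : ℂ ⊗[ℤ] E.H.L), E.π.toLin h = tateGen p ∧ f ∈ E.H.F p ∧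
    E.π.toLin.baseChange ℂ f = (1 : ℂ) ⊗ₜ[ℤ] tateGen p ∧
    E.ι.toLin.baseChange ℂ a = f - (1 : ℂ) ⊗ₜ[ℤ] h

theorem exists_isDiff (E : Extension (tateZ p) A) : ∃ a, E.IsDiff a := by
  obtain ⟨h, hh⟩ := E.surj (tateGen p)
  have e : E.π.toLin.baseChange ℂ ((1 : ℂ) ⊗ₜ[ℤ] h) =
      (1 : ℂ) ⊗ₜ[ℤ] tateGen p := by
    rw [LinearMap.baseChange_tmul, hh]
  obtain ⟨f, hf, hf'⟩ := E.π.strict_F (p := p) ((1 : ℂ) ⊗ₜ[ℤ] h) (by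
    have ht : (tateZ.{u} p).F p = ⊤ := if_pos le_rfl
    rw [ht]; trivial)
  obtain ⟨a, ha⟩ := (baseChange_exact ℂ _ _ E.exact (f - (1 : ℂ) ⊗ₜ[ℤ] h)).1 (by
    rw [map_sub, hf', sub_self])
  exact ⟨a, h, f, hh, hf, hf'.trans e, ha⟩

theorem IsDiff.toJ_eq {E : Extension (tateZ p) A} {a a' : ℂ ⊗[ℤ] A.L} (h : E.IsDiff a)
    (h' : E.IsDiff a') : toJ p A a = toJ p A a' := by
  obtain ⟨h, f, h1, h2, h3, h4⟩ := h
  obtain ⟨h', f', h1', h2', h3', h4'⟩ := h'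
  obtain ⟨n, hn⟩ := (E.exact (h - h')).1 (by rw [map_sub, h1, h1', sub_self])
  rw [← sub_eq_zero, ← map_sub]
  refine (Submodule.Quotient.mk_eq_zero _).2 ?_
  have e : E.ι.toLin.baseChange ℂ (a - a' + (1 : ℂ) ⊗ₜ[ℤ] n) = f - f' := by
    rw [map_add, map_sub, h4, h4', LinearMap.baseChange_tmul, hn, TensorProduct.tmul_sub]
    abel
  obtain ⟨y, hy, e'⟩ := E.ι.strict_F (p := p) (a - a' + (1 : ℂ) ⊗ₜ[ℤ] n) (by
    rw [e]; exact sub_mem h2 h2')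
  rw [baseChange_injective ℂ _ E.inj e'] at hy
  refine Submodule.mem_sup.2 ⟨_, hy, -((1 : ℂ) ⊗ₜ[ℤ] n), neg_mem ⟨n, rfl⟩, by abel⟩

theorem IsDiff.of_equiv {E E' : Extension (tateZ p) A} (h : E.Equiv E') {a : ℂ ⊗[ℤ] A.L}
    (ha : E.IsDiff a) : E'.IsDiff a := by
  obtain ⟨φ, k1, k2⟩ := h
  obtain ⟨h, f, h1, h2, h3, h4⟩ := ha
  have e1 : φ.toLin ∘ₗ E.ι.toLin = E'.ι.toLin := LinearMap.ext k1
  have e2 : E'.π.toLin ∘ₗ φ.toLin = E.π.toLin := LinearMap.ext k2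
  refine ⟨φ.toLin h, φ.toLin.baseChange ℂ f, by rw [k2, h1], φ.map_F p h2, ?_, ?_⟩
  · rw [← LinearMap.comp_apply, ← LinearMap.baseChange_comp, e2, h3]
  · rw [← e1, LinearMap.baseChange_comp, LinearMap.comp_apply, h4, map_sub,
      LinearMap.baseChange_tmul]

end Extension

/-- Carlson's map `Ext¹(ℤ(-p), A) → J^p(A)`: the class of `0 → A → H → ℤ(-p) → 0` is sent to the
class of `f - h ∈ A_ℂ`, where `f ∈ F^p H_ℂ` and `h ∈ H_ℤ` are lifts of `1`. -/
noncomputable def Ext.carlson {A : MHS.{u}} {p : ℤ} : Ext (MHS.tateZ p) A → MHS.J p A :=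
  Quotient.lift (fun E => MHS.toJ p A (Classical.choose E.exists_isDiff)) (fun E E' h =>
    ((Classical.choose_spec E.exists_isDiff).of_equiv h).toJ_eq
      (Classical.choose_spec E'.exists_isDiff))

theorem Ext.carlson_mk {A : MHS.{u}} {p : ℤ} {E : Extension (MHS.tateZ p) A} {a : ℂ ⊗[ℤ] A.L}
    (h : E.IsDiff a) : Ext.carlson (Ext.mk E) = MHS.toJ p A a :=
  (Classical.choose_spec E.exists_isDiff).toJ_eq h

/-- A complex Lie group structure on an abelian group. -/
structure ComplexLie (G : Type*) [AddCommGroup G] where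
  dim : ℕ
  top : TopologicalSpace G
  t2 : T2Space G
  sc : SecondCountableTopology G
  charts : ChartedSpace (Fin dim → ℂ) G
  lie : LieAddGroup 𝓘(ℂ, Fin dim → ℂ) ω G

namespace ComplexLie

variable {G G' : Type*} [AddCommGroup G] [AddCommGroup G']

/-- Holomorphic maps between complex Lie groups. -/
def Holomorphic (S : ComplexLie G) (S' : ComplexLie G') (f : G → G') : Prop :=
  letI := S.top
  letI := S.charts
  letI := S'.top
  letI := S'.charts
  ContMDiff 𝓘(ℂ, Fin S.dim → ℂ) 𝓘(ℂ, Fin S'.dim → ℂ) ω f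

/-- `G` carries the quotient structure along `u : V → G`, where `V` is a finite-dimensional complex
vector space: in linear coordinates on `V`, `u` is a surjective holomorphic submersion. There is at
most one complex structure on `G` with this property. -/
def IsQuotient (S : ComplexLie G) {V : Type*} [AddCommGroup V] [Module ℂ V] (u : V → G) : Prop :=
  letI := S.top
  letI := S.charts
  Function.Surjective u ∧ ∃ (n : ℕ) (e : (Fin n → ℂ) ≃ₗ[ℂ] V),
    ContMDiff 𝓘(ℂ, Fin n → ℂ) 𝓘(ℂ, Fin S.dim → ℂ) ω (fun v => u (e v)) ∧
    ∀ v, Function.Surjective (mfderiv 𝓘(ℂ, Fin n → ℂ) 𝓘(ℂ, Fin S.dim → ℂ) (fun v => u (e v)) v)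

end ComplexLie

end HodgeExt

open HodgeExt HodgeExt.MHS

/-! Let `C` be pure of weight `2p` with free lattice and let `A` have weights at most `2p - 1`. Then
every complex linear map `C_ℂ → A_ℂ` respects `W`. An extension of `C` by `A` splits over the
lattices, and by strictness its complexification splits compatibly with `F`. The difference of the
two splittings is a map `θ : C_ℂ → A_ℂ`, and the extension is equivalent to `H_θ`
(`exists_ofTwist`). Since `H_θ + H_η ∼ H_{θ+η}` (`baer_ofTwist`) and `H_θ` splits exactly when `θ +
ψ` preserves `F` for some integral `ψ` (`equiv_split_iff`), `Ext¹(C, A)` is the quotient of `W_0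
Hom(C, A)_ℂ` by `F^0 + Hom(C_ℤ, A_ℤ)`.

If `C` is of type `(p, p)` with lattice `M`, then `θ` amounts to a homomorphism `M → A_ℂ`, and it
lies in `F^0` exactly when its values on `M` lie in `F^p A_ℂ`. So `[H_θ] = 0` exactly when `θ`
induces the zero map `M → J^p(A)`, and `Ext¹(C, A)` and `Hom(M, J^p(A))` are quotients of one vector
space by one subgroup. Carlson's map is the case `M = ℤ`; `γ̄` is the case `M = B_ℤ^{p,p}`, because
the Carlson class of `b^*[H_θ]` is the class of `θ(b ⊗ 1)`.

For the Lie group structures, the image of the lattice `Hom(C_ℤ, A_ℤ)` in `W_0 Hom / F^0 ≅ ℂ^d` has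
to be discrete. A real element of `F^0` also preserves the conjugate of `F`, so it respects Deligne
splittings and vanishes because its target has smaller weights (`eq_zero_of_conjMap_eq`). Therefore
an integral basis stays linearly independent over `ℝ` modulo `F^0`, and the group is `ℂ^d` modulo a
discrete subgroup. The maps `γ`, `γ̄`, its inverse and `i^*` are covered by linear maps, so they are
holomorphic. Finally `i^*` is covered by restriction along the injection `(B_ℤ^{p,p})_ℂ → B_ℂ`,
which is surjective on linear maps. -/

namespace HodgeExt

/-! ### Complex Lie groups as quotients of `ℂ^d` by discrete subgroups. -/

/-- An open quotient homomorphism `ℂ^d → G` with discrete kernel: no nonzero element of the kernel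
has norm less than `2 ε`. -/
structure Uniformization (d : ℕ) (G : Type*) [AddCommGroup G] [TopologicalSpace G] where
  π : (Fin d → ℂ) →+ G
  quot : IsOpenQuotientMap π
  ε : ℝ
  pos : 0 < ε
  disc : ∀ x, π x = 0 → ‖x‖ < 2 * ε → x = 0

namespace Uniformization

variable {d : ℕ} {G : Type*} [AddCommGroup G] [TopologicalSpace G] (U : Uniformization d G)

/-- Two points of a ball of radius `ε` are at distance less than `2 ε`; this is the reason for the
factor 2 in `disc`. -/
theorem injOn_ball (x : Fin d → ℂ) : Set.InjOn U.π (Metric.ball x U.ε) := by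
  intro y hy z hz h
  rw [Metric.mem_ball] at hy hz
  rw [← sub_eq_zero]
  refine U.disc _ (by rw [map_sub, h, sub_self]) ?_
  rw [← dist_eq_norm]
  linarith [dist_triangle_right y z x]

/-- The chart of `G` inverse to the restriction of `π` to a small ball around `x`. -/
noncomputable def chart (x : Fin d → ℂ) : OpenPartialHomeomorph G (Fin d → ℂ) :=
  (OpenPartialHomeomorph.ofContinuousOpen
    ((U.injOn_ball x).toPartialEquiv U.π (Metric.ball x U.ε))
    U.quot.continuous.continuousOn U.quot.isOpenMap Metric.isOpen_ball).symm

theorem mem_chart_target (x : Fin d → ℂ) : x ∈ (U.chart x).target :=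
  Metric.mem_ball_self U.pos

theorem mem_chart_source (x : Fin d → ℂ) : U.π x ∈ (U.chart x).source :=
  (U.chart x).map_target (U.mem_chart_target x)

theorem π_chart {x : Fin d → ℂ} {g : G} (hg : g ∈ (U.chart x).source) :
    U.π (U.chart x g) = g :=
  (U.chart x).left_inv hg

theorem chart_π {x y : Fin d → ℂ} (hy : y ∈ (U.chart x).target) : U.chart x (U.π y) = y :=
  (U.chart x).right_inv hy

/-- The charts given by the local inverses of `π`. -/
noncomputable abbrev chartedSpace : ChartedSpace (Fin d → ℂ) G where
  atlas := Set.range U.chart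
  chartAt g := U.chart (Classical.choose (U.quot.surjective g))
  mem_chart_source g := by
    have h := U.mem_chart_source (Classical.choose (U.quot.surjective g))
    rwa [Classical.choose_spec (U.quot.surjective g)] at h
  chart_mem_atlas g := ⟨_, rfl⟩

/-- In the charts, `π` is locally a translation. -/
theorem chart_π_eventuallyEq {x z : Fin d → ℂ} (hz : U.π z ∈ (U.chart x).source) :
    (fun w => U.chart x (U.π w)) =ᶠ[nhds z] fun w => w + (U.chart x (U.π z) - z) := by
  have h1 : Filter.Tendsto (fun w : Fin d → ℂ => w + (U.chart x (U.π z) - z)) (nhds z)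
      (nhds (U.chart x (U.π z))) := by
    have h : Continuous fun w : Fin d → ℂ => w + (U.chart x (U.π z) - z) := by fun_prop
    have := h.tendsto z
    rwa [add_sub_cancel] at this
  filter_upwards [h1.eventually
    ((U.chart x).open_target.mem_nhds ((U.chart x).map_source hz))] with w hw
  -- The shift `U.chart x (U.π z) - z` lies in the kernel of `π`, and for `w` near `z` the shifted
  -- point lies in the ball on which `U.chart x` inverts `π`.
  have h2 : U.π w = U.π (w + (U.chart x (U.π z) - z)) := by
    rw [map_add, map_sub, U.π_chart hz, sub_self, add_zero]
  rw [h2, U.chart_π hw]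

/-- A change of charts is `π` followed by a chart, hence locally a translation. -/
theorem isManifold :
    letI := U.chartedSpace
    IsManifold 𝓘(ℂ, Fin d → ℂ) ω G := by
  let _ := U.chartedSpace
  refine isManifold_of_contDiffOn _ _ _ ?_
  rintro _ _ ⟨x, rfl⟩ ⟨y, rfl⟩ z hz
  refine ContDiffAt.contDiffWithinAt ?_
  have hz' : U.π z ∈ (U.chart y).source := by
    have := hz.1
    simp only [modelWithCornersSelf_coe_symm, Set.preimage_id_eq, id,
      OpenPartialHomeomorph.trans_source, OpenPartialHomeomorph.symm_source] at this
    exact this.2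
  refine ContDiffAt.congr_of_eventuallyEq ?_ (U.chart_π_eventuallyEq hz')
  fun_prop

/-- Near `x`, the map `π` is the inverse of the chart `U.chart x`. -/
theorem contMDiff_π :
    letI := U.chartedSpace
    ContMDiff 𝓘(ℂ, Fin d → ℂ) 𝓘(ℂ, Fin d → ℂ) ω U.π := by
  let _ := U.chartedSpace
  have := U.isManifold
  intro x
  have h := contMDiffOn_symm_of_mem_maximalAtlas (I := 𝓘(ℂ, Fin d → ℂ)) (n := ω)
    (e := U.chart x) (IsManifold.subset_maximalAtlas ⟨x, rfl⟩)
  exact h.contMDiffAt ((U.chart x).open_target.mem_nhds (U.mem_chart_target x))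

theorem contMDiffAt_chart (x : Fin d → ℂ) :
    letI := U.chartedSpace
    ContMDiffAt 𝓘(ℂ, Fin d → ℂ) 𝓘(ℂ, Fin d → ℂ) ω (U.chart x) (U.π x) := by
  let _ := U.chartedSpace
  have := U.isManifold
  exact contMDiffAt_of_mem_maximalAtlas (IsManifold.subset_maximalAtlas ⟨x, rfl⟩)
    (U.mem_chart_source x)

theorem eventually_π_chart (x : Fin d → ℂ) : ∀ᶠ g in nhds (U.π x), U.π (U.chart x g) = g := by
  filter_upwards [(U.chart x).open_source.mem_nhds (U.mem_chart_source x)] with g hg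
  exact U.π_chart hg

/-- The chart is a holomorphic local section of `π`, so the chain rule gives the differential of `π`
a right inverse. -/
theorem surjective_mfderiv_π (x : Fin d → ℂ) :
    letI := U.chartedSpace
    Function.Surjective (mfderiv 𝓘(ℂ, Fin d → ℂ) 𝓘(ℂ, Fin d → ℂ) U.π x) := by
  let _ := U.chartedSpace
  have hx : U.chart x (U.π x) = x := U.chart_π (U.mem_chart_target x)
  have h1 := (U.contMDiffAt_chart x).mdifferentiableAt (by simp)
  have h2 := (U.contMDiff_π (U.chart x (U.π x))).mdifferentiableAt (n := ω) (by simp)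
  have h3 := mfderiv_comp (U.π x) h2 h1
  have h4 : (U.π ∘ U.chart x) =ᶠ[nhds (U.π x)] id := U.eventually_π_chart x
  rw [h4.mfderiv_eq, mfderiv_id] at h3
  rw [hx] at h3
  intro v
  exact ⟨_, (DFunLike.congr_fun h3 v).symm⟩

/-- A map from `G` is holomorphic if its composition with `π` is. -/
theorem contMDiff_of_comp {E' : Type*} [NormedAddCommGroup E'] [NormedSpace ℂ E'] {M : Type*}
    [TopologicalSpace M] [ChartedSpace E' M] {f : G → M}
    (hf : ContMDiff 𝓘(ℂ, Fin d → ℂ) 𝓘(ℂ, E') ω fun x => f (U.π x)) :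
    letI := U.chartedSpace
    ContMDiff 𝓘(ℂ, Fin d → ℂ) 𝓘(ℂ, E') ω f := by
  let _ := U.chartedSpace
  intro g
  obtain ⟨x, rfl⟩ := U.quot.surjective g
  -- Near `π x` the map `f` is the composition of `U.chart x` with `f ∘ π`.
  have h := ContMDiffAt.comp (U.π x) (hf (U.chart x (U.π x))) (U.contMDiffAt_chart x)
  refine h.congr_of_eventuallyEq ?_
  filter_upwards [U.eventually_π_chart x] with g hg
  simp only [Function.comp_apply, hg]

/-- Near `(π x, π y)` addition is `(g, h) ↦ π (U.chart x g + U.chart y h)`, because `π` is a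
homomorphism; negation is covered by negation on `ℂ^d`. -/
theorem lieAddGroup :
    letI := U.chartedSpace
    LieAddGroup 𝓘(ℂ, Fin d → ℂ) ω G := by
  let _ := U.chartedSpace
  have := U.isManifold
  have hadd : ContMDiff (𝓘(ℂ, Fin d → ℂ).prod 𝓘(ℂ, Fin d → ℂ)) 𝓘(ℂ, Fin d → ℂ) ω
      fun p : G × G => p.1 + p.2 := by
    rintro ⟨g, h⟩
    obtain ⟨x, rfl⟩ := U.quot.surjective g
    obtain ⟨y, rfl⟩ := U.quot.surjective h
    have h1 : ContMDiffAt (𝓘(ℂ, Fin d → ℂ).prod 𝓘(ℂ, Fin d → ℂ)) 𝓘(ℂ, Fin d → ℂ) ω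
        (fun p : G × G => U.chart x p.1) (U.π x, U.π y) :=
      ContMDiffAt.comp (U.π x, U.π y) (U.contMDiffAt_chart x) contMDiffAt_fst
    have h2 : ContMDiffAt (𝓘(ℂ, Fin d → ℂ).prod 𝓘(ℂ, Fin d → ℂ)) 𝓘(ℂ, Fin d → ℂ) ω
        (fun p : G × G => U.chart y p.2) (U.π x, U.π y) :=
      ContMDiffAt.comp (U.π x, U.π y) (U.contMDiffAt_chart y) contMDiffAt_snd
    refine ((U.contMDiff_π _).comp _ (h1.add h2)).congr_of_eventuallyEq ?_
    rw [nhds_prod_eq]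
    filter_upwards [(U.eventually_π_chart x).prod_mk (U.eventually_π_chart y)] with p hp
    simp only [Function.comp_apply, Pi.add_apply, map_add, hp.1, hp.2]
  have hneg : ContMDiff 𝓘(ℂ, Fin d → ℂ) 𝓘(ℂ, Fin d → ℂ) ω fun g : G => -g := by
    refine U.contMDiff_of_comp ?_
    have h : ContMDiff 𝓘(ℂ, Fin d → ℂ) 𝓘(ℂ, Fin d → ℂ) ω fun x : Fin d → ℂ => -x :=
      contMDiff_id.neg
    refine (U.contMDiff_π.comp h).congr fun x => ?_
    simp only [Function.comp_apply, map_neg]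
  exact { contMDiff_add := hadd, contMDiff_neg := hneg }

/-- By `disc` zero is isolated in the kernel, and a discrete subgroup of a Hausdorff group is
closed. -/
theorem isClosed_ker : IsClosed (U.π.ker : Set (Fin d → ℂ)) := by
  have : DiscreteTopology U.π.ker := by
    refine discreteTopology_of_isOpen_singleton_zero ?_
    rw [Metric.isOpen_singleton_iff]
    refine ⟨2 * U.ε, by linarith [U.pos], fun y hy => Subtype.ext (U.disc y y.2 ?_)⟩
    rwa [dist_zero_right] at hy
  exact AddSubgroup.isClosed_of_discrete

/-- For an open quotient map, the target is Hausdorff as soon as the relation `π x = π y` is closed;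
here it is the preimage of the closed kernel under subtraction. -/
theorem t2Space (U : Uniformization d G) : T2Space G := by
  rw [t2Space_iff_of_isOpenQuotientMap U.quot]
  have : {q : (Fin d → ℂ) × (Fin d → ℂ) | U.π q.1 = U.π q.2} =
      (fun q => q.1 - q.2) ⁻¹' (U.π.ker : Set (Fin d → ℂ)) := by
    ext q
    change U.π q.1 = U.π q.2 ↔ U.π (q.1 - q.2) = 0
    rw [map_sub, sub_eq_zero]
  rw [this]
  exact U.isClosed_ker.preimage (by fun_prop)

theorem secondCountableTopology (U : Uniformization d G) : SecondCountableTopology G :=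
  U.quot.isQuotientMap.secondCountableTopology U.quot.isOpenMap

/-- The complex Lie group structure transported from `ℂ^d`. -/
noncomputable def complexLie : ComplexLie G where
  dim := d
  top := inferInstance
  t2 := U.t2Space
  sc := U.secondCountableTopology
  charts := U.chartedSpace
  lie := U.lieAddGroup

/-- The composition of `π` with a surjective linear map exhibits `G` as a quotient. -/
theorem isQuotient {V : Type*} [AddCommGroup V] [Module ℂ V] [Module.Finite ℂ V]
    (q : V →ₗ[ℂ] (Fin d → ℂ)) (hq : Function.Surjective q) :
    U.complexLie.IsQuotient fun v => U.π (q v) := by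
  let _ := U.chartedSpace
  refine ⟨U.quot.surjective.comp hq, Module.finrank ℂ V,
    (Module.finBasis ℂ V).equivFun.symm, ?_⟩
  set l : (Fin (Module.finrank ℂ V) → ℂ) →L[ℂ] (Fin d → ℂ) :=
    LinearMap.toContinuousLinearMap (q ∘ₗ (Module.finBasis ℂ V).equivFun.symm.toLinearMap) with hl
  have hls : Function.Surjective l := hq.comp (Module.finBasis ℂ V).equivFun.symm.surjective
  have hlc : ContMDiff 𝓘(ℂ, Fin (Module.finrank ℂ V) → ℂ) 𝓘(ℂ, Fin d → ℂ) ω l := l.contMDiff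
  refine ⟨U.contMDiff_π.comp hlc, fun v => ?_⟩
  -- The differential is that of `π` composed with `l`, and both are surjective.
  have h := mfderiv_comp v ((U.contMDiff_π (l v)).mdifferentiableAt (n := ω) (by simp))
    ((hlc v).mdifferentiableAt (by simp))
  have h2 : mfderiv 𝓘(ℂ, Fin (Module.finrank ℂ V) → ℂ) 𝓘(ℂ, Fin d → ℂ) l v = l := by
    rw [mfderiv_eq_fderiv]; exact l.fderiv
  rw [h2] at h
  intro w
  obtain ⟨w₁, rfl⟩ := U.surjective_mfderiv_π (l v) w
  obtain ⟨w₂, rfl⟩ := hls w₁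
  exact ⟨w₂, DFunLike.congr_fun h w₂⟩

/-- Maps covered by linear maps are holomorphic. -/
theorem holomorphic {d' : ℕ} {G' : Type*} [AddCommGroup G'] [TopologicalSpace G']
    (U' : Uniformization d' G') {f : G → G'} (l : (Fin d → ℂ) →ₗ[ℂ] (Fin d' → ℂ))
    (h : ∀ x, f (U.π x) = U'.π (l x)) : U.complexLie.Holomorphic U'.complexLie f := by
  let _ := U.chartedSpace
  let _ := U'.chartedSpace
  change ContMDiff 𝓘(ℂ, Fin d → ℂ) 𝓘(ℂ, Fin d' → ℂ) ω f
  refine U.contMDiff_of_comp ?_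
  have hl : ContMDiff 𝓘(ℂ, Fin d → ℂ) 𝓘(ℂ, Fin d' → ℂ) ω l :=
    (LinearMap.toContinuousLinearMap l).contMDiff
  exact (U'.contMDiff_π.comp hl).congr h

end Uniformization

/-! ### Filtered sections of strict surjections. -/

/-- A surjection which is strict for finite decreasing filtrations has a filtered section. -/
theorem exists_filtered_section {V V' : Type*} [AddCommGroup V] [Module ℂ V] [AddCommGroup V']
    [Module ℂ V'] {F : ℤ → Submodule ℂ V} {F' : ℤ → Submodule ℂ V'} (hF : Antitone F)
    (hF' : Antitone F') (hb : ∃ k, F' k = ⊥) (ht : ∃ k, F k = ⊤) (ht' : ∃ k, F' k = ⊤)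
    (f : V →ₗ[ℂ] V') (hf : ∀ k, ∀ y ∈ F' k, ∃ x ∈ F k, f x = y) :
    ∃ s : V' →ₗ[ℂ] V, (∀ y, f (s y) = y) ∧ ∀ k, ∀ y ∈ F' k, s y ∈ F k := by
  obtain ⟨b, hb⟩ := hb
  obtain ⟨t, ht⟩ := ht
  obtain ⟨t', ht'⟩ := ht'
  -- Descending induction on the filtration, starting at `F' b = 0`: after `n` steps `s` is a
  -- filtered section on `F' (b - n)`, with no control over smaller indices.
  have key : ∀ n : ℕ, ∃ s : V' →ₗ[ℂ] V, (∀ y ∈ F' (b - n), f (s y) = y) ∧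
      ∀ k, b - n ≤ k → ∀ y ∈ F' k, s y ∈ F k := by
    intro n
    induction n with
    | zero =>
      have h0 : ∀ k, b ≤ k → ∀ y ∈ F' k, y = 0 := fun k hk y hy => by
        have := hF' hk hy
        rwa [hb, Submodule.mem_bot] at this
      refine ⟨0, fun y hy => ?_, fun k _ y _ => zero_mem _⟩
      rw [h0 _ (by simp) y hy, map_zero, map_zero]
    | succ n ih =>
      obtain ⟨s, hs, hs'⟩ := ih
      have hle : b - ((n + 1 : ℕ) : ℤ) ≤ b - n := by push_cast; omega
      obtain ⟨P₀, hP₀⟩ := LinearMap.exists_leftInverse_of_injective (F' (b - n)).subtype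
        (Submodule.ker_subtype _)
      have hP : ∀ y ∈ F' (b - n), (P₀ y : V') = y := fun y hy =>
        congrArg Subtype.val (LinearMap.congr_fun hP₀ ⟨y, hy⟩)
      have hg : ∀ x : (F (b - (n + 1 : ℕ)) ⊓ (F' (b - (n + 1 : ℕ))).comap f : Submodule ℂ V),
          f.domRestrict _ x ∈ F' (b - (n + 1 : ℕ)) := fun x => x.2.2
      -- By `hf`, `f` maps the part of `F (b - (n + 1))` lying over `F' (b - (n + 1))` onto the
      -- latter. A linear section `r` of this map, extended arbitrarily to `V'`, is `τ`.
      obtain ⟨r, hr⟩ := LinearMap.exists_rightInverse_of_surjective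
        ((f.domRestrict _).codRestrict _ hg) (LinearMap.range_eq_top.2 fun y => by
          obtain ⟨x, hx, e⟩ := hf _ y y.2
          exact ⟨⟨x, hx, (congrArg (· ∈ F' (b - (n + 1 : ℕ))) e).mpr y.2⟩, Subtype.ext e⟩)
      obtain ⟨τ, hτ⟩ := LinearMap.exists_extend (Submodule.subtype _ ∘ₗ r)
      have hτ1 : ∀ y ∈ F' (b - (n + 1 : ℕ)), f (τ y) = y := fun y hy => by
        have h1 := LinearMap.congr_fun hτ ⟨y, hy⟩
        have h2 := congrArg Subtype.val (LinearMap.congr_fun hr ⟨y, hy⟩)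
        exact (congrArg f h1).trans h2
      have hτ2 : ∀ y ∈ F' (b - (n + 1 : ℕ)), τ y ∈ F (b - (n + 1 : ℕ)) := fun y hy => by
        have h1 := LinearMap.congr_fun hτ ⟨y, hy⟩
        exact (congrArg (· ∈ F (b - (n + 1 : ℕ))) h1).mpr (r ⟨y, hy⟩).2.1
      -- The retraction `P₀` onto `F' (b - n)` splits a vector into two parts: the old section is
      -- kept on the first, and `τ` is applied to the remainder.
      refine ⟨s ∘ₗ (F' (b - n)).subtype ∘ₗ P₀ +
        τ ∘ₗ (LinearMap.id - (F' (b - n)).subtype ∘ₗ P₀), fun y hy => ?_, fun k hk y hy => ?_⟩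
      · have h1 := hs _ (P₀ y).2
        have h2 := hτ1 (y - P₀ y) (sub_mem hy (hF' hle (P₀ y).2))
        simp only [LinearMap.add_apply, LinearMap.comp_apply, LinearMap.sub_apply,
          LinearMap.id_apply, Submodule.subtype_apply, map_add f, h1, h2]
        abel
      · simp only [LinearMap.add_apply, LinearMap.comp_apply, LinearMap.sub_apply,
          LinearMap.id_apply, Submodule.subtype_apply]
        by_cases hk' : b - n ≤ k
        · rw [hP y (hF' hk' hy), sub_self, map_zero, add_zero]
          exact hs' k hk' y hy
        · obtain rfl : k = b - (n + 1 : ℕ) := by push_cast at hk ⊢; omega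
          exact add_mem (hF hle (hs' _ le_rfl _ (P₀ y).2))
            (hτ2 _ (sub_mem hy (hF' hle (P₀ y).2)))
  -- At the index reached, which is at most `min t t'`, `F'` is everything, so `s` is a section. For
  -- smaller indices `F` is everything as well, so nothing is left to check.
  obtain ⟨s, hs, hs'⟩ := key (b - min t t').toNat
  have hT' : F' (b - (b - min t t').toNat) = ⊤ :=
    eq_top_iff.2 (ht' ▸ hF' (by have := min_le_right t t'; have := min_le_left t t'; omega))
  have hT : ∀ k, k < b - (b - min t t').toNat → F k = ⊤ := fun k hk =>
    eq_top_iff.2 (ht ▸ hF (by have := min_le_left t t'; omega))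
  refine ⟨s, fun y => hs y (by rw [hT']; trivial), fun k y hy => ?_⟩
  by_cases hk : b - (b - min t t').toNat ≤ k
  · exact hs' k hk y hy
  · rw [hT k (by omega)]; trivial

/-! ### Weight separation and the vanishing of real elements of `F^0`. -/

namespace MHS

variable {A B C : MHS.{u}} {p : ℤ}

/-- `C` is pure of weight `2 p` and `A` has weights `≤ 2 p - 1`. -/
structure Separated (p : ℤ) (C A : MHS.{u}) : Prop where
  top : C.W (2 * p) = ⊤
  bot : C.W (2 * p - 1) = ⊥
  weights : A.W (2 * p - 1) = ⊤

namespace Separated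

variable (h : Separated p C A)
include h

theorem W_eq_bot {k : ℤ} (hk : k < 2 * p) : C.W k = ⊥ :=
  eq_bot_iff.2 (h.bot ▸ C.W_mono (by omega))

theorem W_eq_top {k : ℤ} (hk : 2 * p ≤ k) : A.W k = ⊤ :=
  eq_top_iff.2 (h.weights ▸ A.W_mono (by omega))

/-- For `k < 2 p` the source `W_k` is zero and for `k ≥ 2 p` the target `W_k` is everything, so the
weights impose no condition. -/
theorem mem_W0Hom (θ : (ℂ ⊗[ℤ] C.L) →ₗ[ℂ] (ℂ ⊗[ℤ] A.L)) : θ ∈ W0Hom C A := by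
  intro k x hx
  by_cases hk : k < 2 * p
  · rw [WC, h.W_eq_bot hk, cx_bot, Submodule.mem_bot] at hx
    rw [hx, map_zero]
    exact zero_mem _
  · rw [WC, h.W_eq_top (not_lt.1 hk), cx_top]
    trivial

theorem map_W (ψ : C.L →ₗ[ℤ] A.L) {k : ℤ} {x : ℚ ⊗[ℤ] C.L} (hx : x ∈ C.W k) :
    ψ.baseChange ℚ x ∈ A.W k := by
  by_cases hk : k < 2 * p
  · rw [h.W_eq_bot hk, Submodule.mem_bot] at hx
    rw [hx, map_zero]
    exact zero_mem _
  · rw [h.W_eq_top (not_lt.1 hk)]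
    trivial

end Separated

/-- `F^0 W_0 Hom(C, A)_ℂ`. -/
noncomputable def F0Hom (C A : MHS.{u}) : Submodule ℂ (W0Hom C A) where
  carrier := {θ | ∀ k, ∀ x ∈ C.F k, θ.1 x ∈ A.F k}
  add_mem' hθ hη k x hx := add_mem (hθ k x hx) (hη k x hx)
  zero_mem' _ _ _ := zero_mem _
  smul_mem' c _ hθ k x hx := Submodule.smul_mem _ c (hθ k x hx)

/-- A real element of `F^0 Hom(C, A)` vanishes for weight reasons. -/
theorem Separated.eq_zero_of_conjMap_eq (h : Separated p C A) {θ : W0Hom C A}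
    (hθ : θ ∈ F0Hom C A) (hc : conjMap θ.1 = θ.1) : θ = 0 := by
  -- Commuting with conjugation, `θ` preserves the conjugate filtration too, so `delI_map` applies
  -- to it although it need not be rational.
  have hbar : ∀ k, ∀ x ∈ C.Fbar k, θ.1 x ∈ A.Fbar k := by
    intro k x hx
    rw [← hc, Fbar, Submodule.mem_comap]
    change conjC _ (conjC _ (θ.1 (conjC _ x))) ∈ _
    rw [conjC_conjC]
    exact hθ k _ hx
  refine Subtype.ext (LinearMap.ext fun x => ?_)
  change θ.1 x = 0
  refine C.opp.induction (P := fun x => θ.1 x = 0) (map_zero _) (fun r m i hi y _ hy => ?_) x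
  rw [map_add, hy, add_zero]
  have em : r + (m - r) = m := by ring
  by_cases hm : m < 2 * p
  · have := hi.1.2
    rw [em, WC, h.W_eq_bot hm, cx_bot] at this
    rw [(Submodule.mem_bot ℂ).1 this, map_zero]
  · refine A.opp.delI_inf (delI_map θ.1 θ.2 hθ hbar hi) ?_
    have hA : A.W (m - 1) = ⊤ := eq_top_iff.2 (h.weights ▸ A.W_mono (by omega))
    rw [em, WC, hA, cx_top]
    trivial

/-- The morphism to the middle term of `H_θ` with given components. -/
noncomputable def Hom.toTwist {X : MHS.{u}} (θ : W0Hom B A) (f : X.L →ₗ[ℤ] A.L) (g : Hom X B)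
    (hW : ∀ k, ∀ x ∈ X.W k, f.baseChange ℚ x ∈ A.W k)
    (hF : ∀ k, ∀ x ∈ X.F k, f.baseChange ℂ x - θ.1 (g.toLin.baseChange ℂ x) ∈ A.F k) :
    Hom X (twist A B θ) where
  toLin := LinearMap.prod f g.toLin
  map_W k x hx := by
    have h1 := baseChange_fst_prod ℚ f g.toLin x
    have h2 := baseChange_snd_prod ℚ f g.toLin x
    exact ⟨(congrArg (· ∈ A.W k) h1).mpr (hW k x hx),
      (congrArg (· ∈ B.W k) h2).mpr (g.map_W k hx)⟩
  map_F k x hx := by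
    have h1 := baseChange_fst_prod ℂ f g.toLin x
    have h2 := baseChange_snd_prod ℂ f g.toLin x
    have h3 : (fstC A B - θ.1 ∘ₗ sndC A B) ((f.prod g.toLin).baseChange ℂ x) =
      f.baseChange ℂ x - θ.1 (g.toLin.baseChange ℂ x) := by
      rw [LinearMap.sub_apply, LinearMap.comp_apply, h1, h2]
    exact ⟨(congrArg (· ∈ A.F k) h3).mpr (hF k x hx),
      (congrArg (· ∈ B.F k) h2).mpr (g.map_F k hx)⟩

end MHS

/-! ### The extensions `H_θ`: Baer sum, pullback, splitting and exhaustion. -/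

namespace Extension

open MHS

variable {A B C : MHS.{u}} {p : ℤ}

theorem ofTwist_W {θ : W0Hom B A} {k : ℤ} {x : ℚ ⊗[ℤ] (A.L × B.L)}
    (hx : x ∈ (ofTwist θ).H.W k) :
    (LinearMap.fst ℤ A.L B.L).baseChange ℚ x ∈ A.W k ∧
      (LinearMap.snd ℤ A.L B.L).baseChange ℚ x ∈ B.W k := hx

theorem ofTwist_F {θ : W0Hom B A} {k : ℤ} {x : ℂ ⊗[ℤ] (A.L × B.L)} :
    x ∈ (ofTwist θ).H.F k ↔ fstC A B x - θ.1 (sndC A B x) ∈ A.F k ∧ sndC A B x ∈ B.F k := Iff.rfl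

/-- The first projection `H_θ → A` on lattices. -/
noncomputable def twistFst (θ : W0Hom B A) : (ofTwist θ).H.L →ₗ[ℤ] A.L := LinearMap.fst ℤ A.L B.L

/-- On the fibre product the second coordinates agree, and `((a₁, b), (a₂, b)) ↦ (a₁ + a₂, b)`
induces the equivalence. Adding `a₁ - θ b ∈ F^k` and `a₂ - η b ∈ F^k` shows compatibility with the
Hodge filtrations. -/
theorem baer_ofTwist (θ η : W0Hom B A) :
    (baer (ofTwist θ) (ofTwist η)).Equiv (ofTwist (θ + η)) := by
  let a := fibFst (ofTwist θ).π (ofTwist η).π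
  let b := fibSnd (ofTwist θ).π (ofTwist η).π
  let f : (fib (ofTwist θ).π (ofTwist η).π).L →ₗ[ℤ] A.L :=
    twistFst θ ∘ₗ a.toLin + twistFst η ∘ₗ b.toLin
  have hab : (ofTwist θ).π.toLin ∘ₗ a.toLin = (ofTwist η).π.toLin ∘ₗ b.toLin :=
    LinearMap.ext fun e => fib_comm _ _ e
  refine baer_equiv (Hom.toTwist (θ + η) f ((ofTwist θ).π.comp a) (fun k x hx => ?_)
    (fun k x hx => ?_)) (fun e a₁ a₂ e1 e2 => ?_) (fun e => rfl)
  · rw [LinearMap.baseChange_add, LinearMap.baseChange_comp, LinearMap.baseChange_comp]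
    exact add_mem (ofTwist_W (θ := θ) (a.map_W k hx)).1 (ofTwist_W (θ := η) (b.map_W k hx)).1
  · have h1 := (ofTwist_F.1 (a.map_F k hx)).1
    have h2 := (ofTwist_F.1 (b.map_F k hx)).1
    have h3 : ((ofTwist θ).π.comp a).toLin.baseChange ℂ x =
        sndC A B (a.toLin.baseChange ℂ x) := by
      change ((ofTwist θ).π.toLin ∘ₗ a.toLin).baseChange ℂ x = _
      rw [LinearMap.baseChange_comp]; rfl
    have h4 : ((ofTwist θ).π.comp a).toLin.baseChange ℂ x =
        sndC A B (b.toLin.baseChange ℂ x) := by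
      change ((ofTwist θ).π.toLin ∘ₗ a.toLin).baseChange ℂ x = _
      rw [hab, LinearMap.baseChange_comp]; rfl
    rw [← h3] at h1
    rw [← h4] at h2
    rw [LinearMap.baseChange_add, LinearMap.baseChange_comp, LinearMap.baseChange_comp]
    have h5 := add_mem h1 h2
    rw [sub_add_sub_comm] at h5
    exact h5
  · refine Prod.ext ?_ ?_
    · change twistFst θ (a.toLin e) + twistFst η (b.toLin e) = a₁ + a₂
      rw [e1, e2]; rfl
    · change (ofTwist θ).π.toLin (a.toLin e) = 0
      rw [e1]; rfl

/-- The equivalence is `((a, f c), c) ↦ (a, c)`; the Hodge conditions match because `θ' c = θ (f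
c)`. -/
theorem pullback_ofTwist (f : Hom C B) (θ : W0Hom B A) (θ' : W0Hom C A)
    (hθ : θ'.1 = θ.1 ∘ₗ f.toLin.baseChange ℂ) :
    ((ofTwist θ).pullback f).Equiv (ofTwist θ') := by
  let a := fibFst (ofTwist θ).π f
  let b := fibSnd (ofTwist θ).π f
  have hab : (ofTwist θ).π.toLin ∘ₗ a.toLin = f.toLin ∘ₗ b.toLin :=
    LinearMap.ext fun e => fib_comm _ _ e
  let t : Hom (fib (ofTwist θ).π f) (twist A C θ') :=
    Hom.toTwist θ' (twistFst θ ∘ₗ a.toLin) b (fun k x hx => by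
      rw [LinearMap.baseChange_comp]
      exact (ofTwist_W (θ := θ) (a.map_W k hx)).1) (fun k x hx => by
      have h1 := (ofTwist_F.1 (a.map_F k hx)).1
      have h4 : f.toLin.baseChange ℂ (b.toLin.baseChange ℂ x) =
          sndC A B (a.toLin.baseChange ℂ x) := by
        rw [← LinearMap.comp_apply, ← LinearMap.baseChange_comp, ← hab,
          LinearMap.baseChange_comp]
        rfl
      rw [hθ, LinearMap.comp_apply, h4, LinearMap.baseChange_comp]
      exact h1)
  refine ⟨t, fun x => Prod.ext ?_ ?_, fun e => rfl⟩
  · change twistFst θ (a.toLin _) = x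
    have : a.toLin (((ofTwist θ).pullback f).ι.toLin x) = (ofTwist θ).ι.toLin x :=
      fibFst_lift _ _ (ofTwist θ).ι (Hom.zero A C)
        (fun a => by rw [π_ι, Hom.zero_apply, map_zero]) _
    exact congrArg (twistFst θ) this
  · exact π_ι ((ofTwist θ).pullback f) x

/-- A map `H_θ → A ⊕ C` inducing the identity on `A` and on `C` has the form `(a, c) ↦ (a + ψ c,
c)`. It sends `(a + θ c, c) ∈ F_θ^k` to `(a + (θ + ψ) c, c)`, so it respects `F` exactly when `θ +
ψ` does; the weights are automatic. -/
theorem equiv_split_iff (h : Separated p C A) (θ : W0Hom C A) :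
    (ofTwist θ).Equiv (split C A) ↔ ∃ ψ : C.L →ₗ[ℤ] A.L,
      ∀ k, ∀ x ∈ C.F k, θ.1 x + ψ.baseChange ℂ x ∈ A.F k := by
  constructor
  · rintro ⟨φ, h1, h2⟩
    -- `ρ` is the first coordinate of `φ`; its restriction to the summand `C` will be `ψ`.
    obtain ⟨ρ, hρ, hρF⟩ : ∃ ρ : (A.L × C.L) →ₗ[ℤ] A.L, (∀ a, ρ (LinearMap.inl ℤ A.L C.L a) = a) ∧
        ∀ k, ∀ u ∈ (ofTwist θ).H.F k, ρ.baseChange ℂ u ∈ A.F k := by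
      let φ' : Hom (ofTwist θ).H (ofTwist (0 : W0Hom C A)).H := φ
      refine ⟨(twistFst 0 ∘ₗ φ'.toLin : (ofTwist θ).H.L →ₗ[ℤ] A.L),
        fun a => congrArg (twistFst 0) (h1 a), fun k u hu => ?_⟩
      have h3 := (mem_prod_F.1 (φ.map_F k hu)).1
      exact (congrArg (· ∈ A.F k) (LinearMap.congr_fun
        (LinearMap.baseChange_comp (A := ℂ) φ'.toLin (twistFst 0)) u)).mpr h3
    refine ⟨ρ ∘ₗ LinearMap.inr ℤ A.L C.L, fun k x hx => ?_⟩
    -- The test vector `(θ x, x)` lies in `F_θ^k`, and `ρ` maps it to `θ x + ψ x`.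
    obtain ⟨u, hu1, hu2⟩ := baseChange_prod_mk ℂ (θ.1 x) x
    have hu : u ∈ (ofTwist θ).H.F k := ofTwist_F.2 (by
      rw [hu1, hu2, sub_self]
      exact ⟨zero_mem _, hx⟩)
    have h4 : ρ = LinearMap.fst ℤ A.L C.L +
        (ρ ∘ₗ LinearMap.inr ℤ A.L C.L) ∘ₗ LinearMap.snd ℤ A.L C.L := by
      refine LinearMap.prod_ext (LinearMap.ext fun a => ?_) (LinearMap.ext fun c => ?_)
      · have h0 : ρ (0, 0) = 0 := map_zero ρ
        simpa [h0] using hρ a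
      · simp
    have h6 := hρF k u hu
    rw [h4, LinearMap.baseChange_add, LinearMap.add_apply, LinearMap.baseChange_comp,
      LinearMap.comp_apply, hu1, hu2] at h6
    exact h6
  · rintro ⟨ψ, hψ⟩
    refine ⟨Hom.toTwist 0 (twistFst θ + ψ ∘ₗ (ofTwist θ).π.toLin) (ofTwist θ).π
      (fun k x hx => ?_) (fun k x hx => ?_), fun a => ?_, fun _ => rfl⟩
    · rw [LinearMap.baseChange_add, LinearMap.baseChange_comp]
      exact add_mem (ofTwist_W hx).1 (h.map_W ψ (ofTwist_W hx).2)
    · obtain ⟨h1, h2⟩ := ofTwist_F.1 hx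
      have h3 := add_mem h1 (hψ k _ h2)
      rw [LinearMap.baseChange_add, LinearMap.baseChange_comp]
      change fstC A C x + ψ.baseChange ℂ (sndC A C x) - 0 ∈ A.F k
      convert h3 using 1
      abel
    · refine Prod.ext ?_ rfl
      change a + ψ 0 = a
      rw [map_zero, add_zero]

/-- An integral section `s` exists because the lattice of `C` is free, and a section `σ` respecting
`F` exists by strictness of `π`. Their difference takes values in `A_ℂ` and is the required `θ`; the
equivalence is `(a, c) ↦ ι a + s c`. -/
theorem exists_ofTwist (h : Separated p C A) [Module.Free ℤ C.L] (E : Extension C A) :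
    ∃ θ : W0Hom C A, (ofTwist θ).Equiv E := by
  obtain ⟨s, hs⟩ := LinearMap.exists_rightInverse_of_surjective E.π.toLin
    (LinearMap.range_eq_top.2 E.surj)
  obtain ⟨σ, hσ, hσF⟩ := exists_filtered_section (F := E.H.F) (F' := C.F) E.H.F_anti C.F_anti
    C.F_bot E.H.F_top C.F_top (E.π.toLin.baseChange ℂ) (fun k y hy => by
      obtain ⟨x, rfl⟩ := baseChange_surjective ℂ _ E.surj y
      exact E.π.strict_F x hy)
  have hsC : ∀ y, E.π.toLin.baseChange ℂ (s.baseChange ℂ y) = y := fun y => by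
    rw [← LinearMap.comp_apply, ← LinearMap.baseChange_comp, hs, LinearMap.baseChange_id,
      LinearMap.id_apply]
  have hι := baseChange_injective ℂ _ E.inj
  have hr : ∀ y, (σ - s.baseChange ℂ) y ∈ LinearMap.range (E.ι.toLin.baseChange ℂ) := fun y =>
    (baseChange_exact ℂ _ _ E.exact _).1 (by
      rw [LinearMap.sub_apply, map_sub, hσ, hsC, sub_self])
  let θ₀ : (ℂ ⊗[ℤ] C.L) →ₗ[ℂ] (ℂ ⊗[ℤ] A.L) :=
    (LinearEquiv.ofInjective _ hι).symm.toLinearMap ∘ₗ (σ - s.baseChange ℂ).codRestrict _ hr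
  have hθ : ∀ y, E.ι.toLin.baseChange ℂ (θ₀ y) = σ y - s.baseChange ℂ y := fun y =>
    congrArg Subtype.val ((LinearEquiv.ofInjective _ hι).apply_symm_apply
      ((σ - s.baseChange ℂ).codRestrict _ hr y))
  have hW : ∀ k (x : ℚ ⊗[ℤ] (A.L × C.L)), (LinearMap.fst ℤ A.L C.L).baseChange ℚ x ∈ A.W k →
      (LinearMap.snd ℤ A.L C.L).baseChange ℚ x ∈ C.W k → (E.ι.toLin ∘ₗ LinearMap.fst ℤ A.L C.L +
        s ∘ₗ LinearMap.snd ℤ A.L C.L).baseChange ℚ x ∈ E.H.W k := by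
    intro k x h1 h2
    rw [LinearMap.baseChange_add, LinearMap.add_apply,
      LinearMap.baseChange_comp, LinearMap.baseChange_comp, LinearMap.comp_apply,
      LinearMap.comp_apply]
    refine add_mem (E.ι.map_W k h1) ?_
    by_cases hk : k < 2 * p
    · rw [h.W_eq_bot hk, Submodule.mem_bot] at h2
      rw [h2, map_zero]
      exact zero_mem _
    · obtain ⟨y, hy, e⟩ := E.π.strict_W (k := 2 * p)
        (s.baseChange ℚ ((LinearMap.snd ℤ A.L C.L).baseChange ℚ x)) (by rw [h.top]; trivial)
      obtain ⟨z, hz⟩ := (baseChange_exact ℚ _ _ E.exact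
        (s.baseChange ℚ ((LinearMap.snd ℤ A.L C.L).baseChange ℚ x) - y)).1 (by
          rw [map_sub, e, sub_self])
      rw [eq_sub_iff_add_eq] at hz
      rw [← hz]
      refine add_mem (E.ι.map_W k ?_) (E.H.W_mono (not_lt.1 hk) hy)
      rw [h.W_eq_top (not_lt.1 hk)]
      trivial
  have hF : ∀ k (x : ℂ ⊗[ℤ] (A.L × C.L)), fstC A C x - θ₀ (sndC A C x) ∈ A.F k →
      sndC A C x ∈ C.F k → (E.ι.toLin ∘ₗ LinearMap.fst ℤ A.L C.L +
        s ∘ₗ LinearMap.snd ℤ A.L C.L).baseChange ℂ x ∈ E.H.F k := by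
    intro k x h1 h2
    rw [LinearMap.baseChange_add, LinearMap.add_apply,
      LinearMap.baseChange_comp, LinearMap.baseChange_comp, LinearMap.comp_apply,
      LinearMap.comp_apply]
    -- Since `ι θ₀ = σ - s`, the vector `ι a + s c` equals `ι (a - θ₀ c) + σ c`, and both terms lie
    -- in `F^k`.
    have h3 : E.ι.toLin.baseChange ℂ (fstC A C x - θ₀ (sndC A C x)) + σ (sndC A C x) ∈ E.H.F k :=
      add_mem (E.ι.map_F k h1) (hσF k _ h2)
    rw [map_sub, hθ] at h3
    convert h3 using 1
    abel
  refine ⟨⟨θ₀, h.mem_W0Hom θ₀⟩, ⟨{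
    toLin := E.ι.toLin ∘ₗ LinearMap.fst ℤ A.L C.L + s ∘ₗ LinearMap.snd ℤ A.L C.L
    map_W := fun k x hx => hW k x hx.1 hx.2
    map_F := fun k x hx => hF k x hx.1 hx.2 }, fun a => ?_, fun x => ?_⟩⟩
  · change E.ι.toLin a + s 0 = E.ι.toLin a
    rw [map_zero, add_zero]
  · change E.π.toLin (E.ι.toLin x.1 + s x.2) = x.2
    rw [map_add, π_ι, zero_add]
    exact LinearMap.congr_fun hs x.2

theorem baseChange_inl_eq {u : ℂ ⊗[ℤ] (A.L × B.L)} {a : ℂ ⊗[ℤ] A.L} {b : B.L}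
    (h1 : fstC A B u = a) (h2 : sndC A B u = (1 : ℂ) ⊗ₜ[ℤ] b) :
    (LinearMap.inl ℤ A.L B.L).baseChange ℂ a = u - (1 : ℂ) ⊗ₜ[ℤ] ((0 : A.L), b) := by
  rw [← sub_eq_zero]
  refine baseChange_prod_ext ℂ _ ?_ ?_
  · rw [map_sub, map_sub, baseChange_fst_inl, h1, LinearMap.baseChange_tmul]
    simp
  · rw [map_sub, map_sub, baseChange_snd_inl, h2, LinearMap.baseChange_tmul]
    simp

/-- The lifts are `h = (0, b)` and `f = (θ (1 ⊗ b), 1 ⊗ b)`. Their difference shows that the Carlson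
class of `H_θ` is the value of `θ` at the generator. -/
theorem exists_diff_ofTwist (θ : W0Hom B A) {b : B.L} (hb : (1 : ℂ) ⊗ₜ[ℤ] b ∈ B.F p) :
    ∃ (h : (ofTwist θ).H.L) (f : ℂ ⊗[ℤ] (ofTwist θ).H.L), (ofTwist θ).π.toLin h = b ∧
      f ∈ (ofTwist θ).H.F p ∧ (ofTwist θ).π.toLin.baseChange ℂ f = (1 : ℂ) ⊗ₜ[ℤ] b ∧
      (ofTwist θ).ι.toLin.baseChange ℂ (θ.1 ((1 : ℂ) ⊗ₜ[ℤ] b)) = f - (1 : ℂ) ⊗ₜ[ℤ] h := by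
  obtain ⟨u, hu1, hu2⟩ := baseChange_prod_mk ℂ (θ.1 ((1 : ℂ) ⊗ₜ[ℤ] b)) ((1 : ℂ) ⊗ₜ[ℤ] b)
  refine ⟨((0 : A.L), b), u, rfl, ofTwist_F.2 ⟨?_, ?_⟩, hu2, baseChange_inl_eq hu1 hu2⟩
  · rw [hu1, hu2, sub_self]; exact zero_mem _
  · rw [hu2]; exact hb

theorem isDiff_ofTwist (θ : W0Hom (tateZ p) A) :
    (ofTwist θ).IsDiff (θ.1 ((1 : ℂ) ⊗ₜ[ℤ] tateGen p)) :=
  exists_diff_ofTwist θ (mem_hodge.1 (mem_hodge_tate p _ (tateGen p))).1.1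

end Extension

/-! ### Uniformizations from surjections of vector spaces, and discreteness criteria. -/

/-- A surjective homomorphism onto `G` that becomes, modulo a complex subspace of its kernel, a
quotient by a discrete subgroup, yields a uniformization of `G`. -/
theorem exists_uniformization {V G : Type*} [AddCommGroup V] [Module ℂ V] [AddCommGroup G]
    (u : V →+ G) (hu : Function.Surjective u) {d : ℕ} (q : V →ₗ[ℂ] (Fin d → ℂ))
    (hq : Function.Surjective q) (hk : ∀ v, q v = 0 → u v = 0) {ε : ℝ} (hε : 0 < ε)
    (hd : ∀ v, u v = 0 → ‖q v‖ < 2 * ε → q v = 0) :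
    ∃ (_ : TopologicalSpace G) (U : Uniformization d G), ∀ v, U.π (q v) = u v := by
  obtain ⟨s, hs⟩ := q.exists_rightInverse_of_surjective (LinearMap.range_eq_top.2 hq)
  have hs' : ∀ x, q (s x) = x := fun x => LinearMap.congr_fun hs x
  -- `π` is `u` read through a linear section of `q`; by `hk` it satisfies `π ∘ q = u`.
  let π : (Fin d → ℂ) →+ G := u.comp s.toAddMonoidHom
  have hπ : ∀ v, π (q v) = u v := fun v => by
    rw [← sub_eq_zero]
    change u (s (q v)) - u v = 0
    rw [← map_sub]
    exact hk _ (by rw [map_sub, hs', sub_self])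
  let _ : TopologicalSpace G := TopologicalSpace.coinduced π inferInstance
  have hsurj : Function.Surjective π := fun g => by
    obtain ⟨v, rfl⟩ := hu g
    exact ⟨q v, hπ v⟩
  have hquot : Topology.IsQuotientMap π := ⟨⟨rfl⟩, hsurj⟩
  have hopen : IsOpenMap π := by
    intro O hO
    rw [← hquot.isOpen_preimage]
    -- The saturation of an open set is a union of its translates by the kernel, hence open.
    have : π ⁻¹' (π '' O) = ⋃ k : π.ker, (fun x : Fin d → ℂ => x + k) ⁻¹' O := by
      ext x
      simp only [Set.mem_preimage, Set.mem_image, Set.mem_iUnion]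
      constructor
      · rintro ⟨y, hy, e⟩
        refine ⟨⟨y - x, ?_⟩, ?_⟩
        · rw [AddMonoidHom.mem_ker, map_sub, e, sub_self]
        · rwa [add_sub_cancel]
      · rintro ⟨k, hk⟩
        refine ⟨_, hk, ?_⟩
        rw [map_add, k.2, add_zero]
    rw [this]
    exact isOpen_iUnion fun k => hO.preimage (by fun_prop)
  exact ⟨_, {
    π := π
    quot := ⟨hsurj, hquot.continuous, hopen⟩
    ε := ε
    pos := hε
    disc := fun x hx hx' => by
      have h := hd (s x) hx
      rw [hs'] at h
      exact h hx' }, hπ⟩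

/-- Homomorphisms covered by linear maps are holomorphic. -/
theorem Uniformization.holomorphic_of_lift {V V' G G' : Type*} [AddCommGroup V] [Module ℂ V]
    [AddCommGroup V'] [Module ℂ V'] [AddCommGroup G] [AddCommGroup G'] [TopologicalSpace G]
    [TopologicalSpace G'] {d d' : ℕ} (U : Uniformization d G) (U' : Uniformization d' G')
    {u : V → G} {u' : V' → G'} {q : V →ₗ[ℂ] (Fin d → ℂ)} (hq : Function.Surjective q)
    {q' : V' →ₗ[ℂ] (Fin d' → ℂ)} (hU : ∀ v, U.π (q v) = u v) (hU' : ∀ v, U'.π (q' v) = u' v)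
    {f : G → G'} (l : V →ₗ[ℂ] V') (h : ∀ v, f (u v) = u' (l v)) :
    U.complexLie.Holomorphic U'.complexLie f := by
  obtain ⟨s, hs⟩ := q.exists_rightInverse_of_surjective (LinearMap.range_eq_top.2 hq)
  -- Inserting a section of `q` avoids having to show that `l` maps the kernel of `q` into that of
  -- `q'`.
  refine U.holomorphic U' (q' ∘ₗ l ∘ₗ s) fun x => ?_
  have hx : q (s x) = x := LinearMap.congr_fun hs x
  conv_lhs => rw [← hx, hU, h, ← hU']
  rfl

/-- A linearly independent finite family in a real vector space spans a discrete subgroup. -/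
theorem exists_pos_forall_mem_span_int {ι E : Type*} [Finite ι] [NormedAddCommGroup E]
    [NormedSpace ℝ E] [FiniteDimensional ℝ E] {w : ι → E} (hw : LinearIndependent ℝ w) :
    ∃ ε : ℝ, 0 < ε ∧ ∀ x ∈ Submodule.span ℤ (Set.range w), ‖x‖ < ε → x = 0 := by
  -- Completed to a real basis, the family lies in a full lattice, and full lattices are discrete.
  let b := Module.Basis.sumExtend hw
  have : Finite (ι ⊕ Module.Basis.sumExtendIndex hw) := Module.Finite.finite_basis b
  have hb : ∀ i, b (Sum.inl i) = w i := fun i => by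
    simp only [b, Module.Basis.sumExtend, Module.Basis.reindex_apply, Module.Basis.extend_apply_self]
    rfl
  have hd : DiscreteTopology (Submodule.span ℤ (Set.range b)) := inferInstance
  have h0 := discreteTopology_iff_isOpen_singleton.1 hd 0
  rw [Metric.isOpen_singleton_iff] at h0
  obtain ⟨ε, hε, h⟩ := h0
  refine ⟨ε, hε, fun x hx hx' => ?_⟩
  have hle : Submodule.span ℤ (Set.range w) ≤ Submodule.span ℤ (Set.range b) := by
    refine Submodule.span_mono ?_
    rintro _ ⟨i, rfl⟩
    exact ⟨_, hb i⟩
  exact congrArg Subtype.val (h ⟨x, hle hx⟩ (by rwa [dist_zero_right]))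

/-- Linear coordinates on the quotient by a subspace. -/
theorem exists_surjective_ker {V : Type*} [AddCommGroup V] [Module ℂ V] [Module.Finite ℂ V]
    (F : Submodule ℂ V) : ∃ (d : ℕ) (q : V →ₗ[ℂ] (Fin d → ℂ)), Function.Surjective q ∧
      ∀ v, q v = 0 ↔ v ∈ F := by
  let e := (Module.finBasis ℂ (V ⧸ F)).equivFun
  refine ⟨_, e.toLinearMap ∘ₗ F.mkQ, e.surjective.comp F.mkQ_surjective, fun v => ?_⟩
  rw [LinearMap.comp_apply, LinearEquiv.coe_coe, LinearEquiv.map_eq_zero_iff,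
    Submodule.mkQ_apply, Submodule.Quotient.mk_eq_zero]

/-! ### Discreteness of the lattice `Hom(C_ℤ, A_ℤ)` modulo `F^0`. -/

namespace MHS

variable {A C : MHS.{u}} {p : ℤ}

/-- The integral structure `Hom(C_ℤ, A_ℤ) → W_0 Hom(C, A)_ℂ`. -/
noncomputable def Separated.intHom (h : Separated p C A) : (C.L →ₗ[ℤ] A.L) →+ W0Hom C A where
  toFun ψ := ⟨ψ.baseChange ℂ, h.mem_W0Hom _⟩
  map_zero' := Subtype.ext (LinearMap.baseChange_zero)
  map_add' ψ χ := Subtype.ext (LinearMap.baseChange_add ψ χ)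

/-- The image of the lattice `Hom(C_ℤ, A_ℤ)` in `W_0 Hom(C, A)_ℂ / F^0` is discrete. -/
theorem Separated.exists_pos_forall_intHom (h : Separated p C A) [Module.Free ℤ C.L]
    [Module.Free ℤ A.L] {d : ℕ} (q : W0Hom C A →ₗ[ℂ] (Fin d → ℂ))
    (hq : ∀ θ, q θ = 0 → θ ∈ F0Hom C A) :
    ∃ ε : ℝ, 0 < ε ∧ ∀ ψ, ‖q (h.intHom ψ)‖ < ε → q (h.intHom ψ) = 0 := by
  classical
  let bC := Module.Free.chooseBasis ℤ C.L
  let bA := Module.Free.chooseBasis ℤ A.L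
  let e := bC.linearMap bA
  -- A real relation modulo `F^0` is a real combination of integral homomorphisms lying in `F^0`. It
  -- equals its own conjugate, so it vanishes.
  have hw : LinearIndependent ℝ fun ij => q (h.intHom (e ij)) := by
    rw [Fintype.linearIndependent_iff]
    intro g hg
    have happ : ∀ x, (∑ ij, (g ij : ℂ) • h.intHom (e ij) : W0Hom C A).1 x =
        ∑ ij, (g ij : ℂ) • (e ij).baseChange ℂ x := fun x => by
      rw [AddSubmonoidClass.coe_finsetSum, LinearMap.sum_apply]
      rfl
    have h0 : (∑ ij, (g ij : ℂ) • h.intHom (e ij) : W0Hom C A) = 0 := by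
      refine h.eq_zero_of_conjMap_eq (hq _ ?_) (LinearMap.ext fun x => ?_)
      · rw [map_sum, ← hg]
        refine Finset.sum_congr rfl fun ij _ => ?_
        rw [map_smul, Complex.coe_smul]
      · change conjC _ ((∑ ij, (g ij : ℂ) • h.intHom (e ij) : W0Hom C A).1 (conjC _ x)) = _
        rw [happ, happ, map_sum]
        refine Finset.sum_congr rfl fun ij _ => ?_
        rw [map_smulₛₗ, Complex.conj_ofReal, conjC_baseChange, conjC_conjC]
    rintro ⟨i, j⟩
    have h1 := happ ((1 : ℂ) ⊗ₜ[ℤ] bC j)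
    rw [h0] at h1
    -- Evaluating the vanishing combination at the basis vector `bC j` leaves only the coefficients
    -- `g (i, j)`, against a complex basis of `A_ℂ`.
    have h2 : ∑ i, (g (i, j) : ℂ) • (bA.baseChange ℂ) i = 0 := by
      rw [Fintype.sum_prod_type] at h1
      refine Eq.trans ?_ h1.symm
      refine Finset.sum_congr rfl fun i _ => ?_
      rw [Finset.sum_eq_single j]
      · rw [LinearMap.baseChange_tmul, Module.Basis.linearMap_apply_apply, if_pos rfl,
          Module.Basis.baseChange_apply]
      · intro j' _ hj
        rw [LinearMap.baseChange_tmul, Module.Basis.linearMap_apply_apply, if_neg hj,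
          TensorProduct.tmul_zero, smul_zero]
      · simp
    exact Complex.ofReal_eq_zero.1
      (Fintype.linearIndependent_iff.1 (bA.baseChange ℂ).linearIndependent _ h2 i)
  obtain ⟨ε, hε, H⟩ := exists_pos_forall_mem_span_int hw
  refine ⟨ε, hε, fun ψ => H _ ?_⟩
  rw [← e.sum_repr ψ, map_sum, map_sum]
  refine sum_mem fun ij _ => ?_
  rw [map_zsmul, map_zsmul]
  exact Submodule.smul_mem _ _ (Submodule.subset_span ⟨ij, rfl⟩)

/-- Linear coordinates on `W_0 Hom(C, A)_ℂ / F^0` in which the lattice `Hom(C_ℤ, A_ℤ)` is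
discrete. -/
theorem Separated.exists_coordinates (h : Separated p C A) [Module.Free ℤ C.L]
    [Module.Free ℤ A.L] :
    ∃ (d : ℕ) (q : W0Hom C A →ₗ[ℂ] (Fin d → ℂ)), Function.Surjective q ∧
      (∀ θ, q θ = 0 ↔ θ ∈ F0Hom C A) ∧ ∃ ε : ℝ, 0 < ε ∧
        ∀ θ, (∃ ψ, θ + h.intHom ψ ∈ F0Hom C A) → ‖q θ‖ < 2 * ε → q θ = 0 := by
  obtain ⟨d, q, hs, hq⟩ := exists_surjective_ker (V := W0Hom C A) (F0Hom C A)
  obtain ⟨ε, hε, H⟩ := h.exists_pos_forall_intHom q fun θ => (hq θ).1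
  -- Halving `ε` matches the bound `2 ε` used in a uniformization.
  refine ⟨d, q, hs, hq, ε / 2, half_pos hε, ?_⟩
  rintro θ ⟨ψ, hψ⟩ hθ
  -- Modulo `F^0` such a `θ` coincides with the integral homomorphism `-ψ`, to which discreteness
  -- applies.
  have h1 : q θ = q (h.intHom (-ψ)) := by
    rw [← sub_eq_zero, ← map_sub, hq, map_neg, sub_neg_eq_add]
    exact hψ
  rw [h1] at hθ ⊢
  exact H _ (by linarith)

end MHS

/-! ### The homomorphism `θ ↦ [H_θ]`, its kernel, and its pullbacks and Carlson classes. -/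

namespace Ext

open MHS

variable {A B C : MHS.{u}} {p : ℤ}

/-- The homomorphism `θ ↦ [H_θ]`. -/
noncomputable def twistHom (C A : MHS.{u}) : W0Hom C A →+ Ext C A :=
  AddMonoidHom.mk' (fun θ => Ext.mk (Extension.ofTwist θ)) fun θ η =>
    (Ext.sound (Extension.baer_ofTwist θ η)).symm

/-- The zero class is that of the split extension, so the splitting criterion identifies the kernel
as `F^0 + Hom(C_ℤ, A_ℤ)`. -/
theorem twistHom_eq_zero_iff (h : Separated p C A) (θ : W0Hom C A) :
    twistHom C A θ = 0 ↔ ∃ ψ, θ + h.intHom ψ ∈ F0Hom C A :=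
  Quotient.eq.trans (Extension.equiv_split_iff h θ)

theorem twistHom_surjective (h : Separated p C A) [Module.Free ℤ C.L] :
    Function.Surjective (twistHom C A) := by
  rintro ⟨E⟩
  obtain ⟨θ, hθ⟩ := Extension.exists_ofTwist h E
  exact ⟨θ, Ext.sound hθ⟩

/-- Restriction along a morphism `C → B`. -/
noncomputable def restrictW0 (A : MHS.{u}) (f : Hom C B) : W0Hom B A →ₗ[ℂ] W0Hom C A where
  toFun θ := ⟨θ.1 ∘ₗ f.toLin.baseChange ℂ, fun k x hx => θ.2 k _ (f.map_WC k x hx)⟩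
  map_add' _ _ := rfl
  map_smul' _ _ := rfl

theorem pullback_twistHom (f : Hom C B) (θ : W0Hom B A) :
    pullback f (twistHom B A θ) = twistHom C A (restrictW0 A f θ) :=
  Ext.sound (Extension.pullback_ofTwist f θ _ rfl)

theorem carlson_twistHom (θ : W0Hom (tateZ p) A) :
    carlson (twistHom (tateZ p) A θ) = toJ p A (θ.1 ((1 : ℂ) ⊗ₜ[ℤ] tateGen p)) :=
  carlson_mk (Extension.isDiff_ofTwist θ)

theorem classHom_tateGen (b : hodge p B) : (classHom b).toLin (tateGen p) = b :=
  one_smul ℤ (b : B.L)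

/-- Pullback along `1 ↦ b` precomposes `θ` with that morphism, and the Carlson class evaluates the
result at the generator. The formulas for `γ` and `γ̄` rest on this. -/
theorem carlson_pullback_twistHom (b : hodge p B) (θ : W0Hom B A) :
    carlson (pullback (classHom b) (twistHom B A θ)) =
      toJ p A (θ.1 ((1 : ℂ) ⊗ₜ[ℤ] (b : B.L))) := by
  rw [pullback_twistHom, carlson_twistHom]
  congr 1
  change θ.1 ((classHom b).toLin.baseChange ℂ _) = _
  rw [LinearMap.baseChange_tmul, classHom_tateGen]

end Ext

/-! ### Extensions of a structure of type `(p, p)`: comparison of kernels. -/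

namespace MHS

open Ext

variable {A B : MHS.{u}} {p : ℤ} {M : Type u} [AddCommGroup M] [Module.Finite ℤ M]

theorem separated_tate (hA : A.W (2 * p - 1) = ⊤) (M : Type u) [AddCommGroup M]
    [Module.Finite ℤ M] : Separated p (tate p M) A where
  top := if_pos le_rfl
  bot := if_neg (by omega)
  weights := hA

/-- On a structure of type `(p, p)` the filtration jumps only at `p`, so the condition at index `p`
implies all others; by linearity it can be tested on the lattice. -/
theorem mem_F0Hom_tate {θ : W0Hom (tate p M) A} :
    θ ∈ F0Hom (tate p M) A ↔ ∀ m : M, θ.1 ((1 : ℂ) ⊗ₜ[ℤ] m) ∈ A.F p := by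
  constructor
  · intro h m
    exact h p _ (mem_hodge.1 (mem_hodge_tate p M m)).1.1
  · intro h k x hx
    by_cases hk : k ≤ p
    · refine A.F_anti hk ?_
      have key : ∀ x : ℂ ⊗[ℤ] M, θ.1 x ∈ A.F p := fun x => by
        induction x with
        | zero => exact (congrArg (· ∈ A.F p) (map_zero θ.1)).mpr (zero_mem _)
        | tmul z m =>
          have e : z ⊗ₜ[ℤ] m = z • ((1 : ℂ) ⊗ₜ[ℤ] m) := by
            rw [TensorProduct.smul_tmul', smul_eq_mul, mul_one]
          exact (congrArg (· ∈ A.F p) ((congrArg θ.1 e).trans (map_smul θ.1 z _))).mpr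
            ((A.F p).smul_mem z (h m))
        | add x y hx hy => exact (congrArg (· ∈ A.F p) (map_add θ.1 x y)).mpr (add_mem hx hy)
      exact key x
    · have h0 : (tate p M).F k = ⊥ := if_neg hk
      rw [h0, Submodule.mem_bot] at hx
      rw [hx, map_zero]
      exact zero_mem _

/-- The sign is chosen so that the condition has the same shape as `θ + ψ ∈ F^0` in the kernel of `θ
↦ [H_θ]`. -/
theorem toJ_eq_zero_iff {a : ℂ ⊗[ℤ] A.L} :
    toJ p A a = 0 ↔ ∃ n : A.L, a + (1 : ℂ) ⊗ₜ[ℤ] n ∈ A.F p := by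
  rw [toJ, Submodule.mkQ_apply, Submodule.Quotient.mk_eq_zero, Submodule.mem_sup]
  have e : ∀ (y : ℂ ⊗[ℤ] A.L) (n : A.L), y + (1 : ℂ) ⊗ₜ[ℤ] n + (1 : ℂ) ⊗ₜ[ℤ] (-n) = y :=
    fun y n => by rw [TensorProduct.tmul_neg, add_neg_cancel_right]
  constructor
  · rintro ⟨y, hy, _, ⟨n, rfl⟩, rfl⟩
    exact ⟨-n, (congrArg (· ∈ A.F p) (e y n)).mpr hy⟩
  · rintro ⟨n, hn⟩
    exact ⟨_, hn, _, ⟨-n, rfl⟩, e a n⟩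

/-- Splitting asks for one linear integral correction `ψ`, vanishing in `J^p(A)` for a correction at
each `m` separately. Freeness of `M` allows the separate corrections to be replaced by a linear one.
-/
theorem twistHom_tate_eq_zero_iff (hA : A.W (2 * p - 1) = ⊤) [Module.Free ℤ M]
    (θ : W0Hom (tate p M) A) :
    twistHom (tate p M) A θ = 0 ↔ ∀ m : M, toJ p A (θ.1 ((1 : ℂ) ⊗ₜ[ℤ] m)) = 0 := by
  rw [twistHom_eq_zero_iff (separated_tate hA M)]
  simp only [mem_F0Hom_tate, toJ_eq_zero_iff]
  constructor
  · rintro ⟨ψ, hψ⟩ m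
    exact ⟨ψ m, hψ m⟩
  · intro h
    choose n hn using h
    let b := Module.Free.chooseBasis ℤ M
    -- The chosen `n` need not be additive; only its values on a basis are retained.
    let ψ : M →ₗ[ℤ] A.L := b.constr ℤ fun i => n (b i)
    refine ⟨ψ, fun m => ?_⟩
    let τ : M →+ ℂ ⊗[ℤ] A.L := (θ + (separated_tate hA M).intHom ψ).1.toAddMonoidHom.comp
      (TensorProduct.mk ℤ ℂ M 1).toAddMonoidHom
    -- The elements at which the corrected map takes values in `F^p` form a subgroup, which contains
    -- the basis.
    have hb : Submodule.span ℤ (Set.range b) ≤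
        AddSubgroup.toIntSubmodule ((A.F p).toAddSubgroup.comap τ) := by
      rw [Submodule.span_le]
      rintro _ ⟨i, rfl⟩
      have h1 := hn (b i)
      have h2 : ψ (b i) = n (b i) := b.constr_basis ℤ _ i
      rw [← h2] at h1
      exact h1
    rw [b.span_eq] at hb
    exact hb (x := m) trivial

end MHS

/-! ### Homomorphisms between quotients of a common group. -/

/-- A map which becomes additive after composition with a surjective homomorphism is additive. -/
theorem map_add_of_comp {V G H : Type*} [AddCommGroup V] [AddCommGroup G] [AddCommGroup H]
    {u : V →+ G} (hu : Function.Surjective u) {f : G → H} (v : V →+ H) (h : ∀ x, f (u x) = v x)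
    (x y : G) : f (x + y) = f x + f y := by
  obtain ⟨x, rfl⟩ := hu x
  obtain ⟨y, rfl⟩ := hu y
  rw [← map_add, h, h, h, map_add]

/-- Two quotients of a group by the same subgroup are isomorphic. -/
theorem exists_addEquiv_of_ker {V G H : Type*} [AddCommGroup V] [AddCommGroup G] [AddCommGroup H]
    {u : V →+ G} (hu : Function.Surjective u) {v : V →+ H} (hv : Function.Surjective v)
    (h : ∀ x, u x = 0 ↔ v x = 0) : ∃ e : G ≃+ H, ∀ x, e (u x) = v x := by
  have hk : u.ker = v.ker := AddSubgroup.ext h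
  refine ⟨(QuotientAddGroup.quotientKerEquivOfSurjective u hu).symm.trans
    ((QuotientAddGroup.quotientAddEquivOfEq hk).trans
      (QuotientAddGroup.quotientKerEquivOfSurjective v hv)), fun x => ?_⟩
  have : (QuotientAddGroup.quotientKerEquivOfSurjective u hu).symm (u x) = (x : V ⧸ u.ker) := by
    rw [AddEquiv.symm_apply_eq]; rfl
  rw [AddEquiv.trans_apply, this]
  rfl

/-! ### Extensions of type `(p, p)` as homomorphisms to the Jacobian, and restriction to
`B_ℤ^{p,p}`. -/

namespace MHS

open Ext

variable {A B : MHS.{u}} {p : ℤ} {M : Type u} [AddCommGroup M] [Module.Finite ℤ M]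

/-- Linear maps out of `(ℤ(-p) ⊗ M)_ℂ` are homomorphisms out of `M`. -/
noncomputable def liftW0 (hA : A.W (2 * p - 1) = ⊤) (M : Type u) [AddCommGroup M]
    [Module.Finite ℤ M] : (M →ₗ[ℤ] ℂ ⊗[ℤ] A.L) ≃ₗ[ℂ] W0Hom (tate p M) A :=
  LinearEquiv.ofBijective
    (LinearMap.codRestrict (W0Hom (tate p M) A) (LinearMap.liftBaseChangeEquiv ℂ).toLinearMap
      fun φ => (separated_tate hA M).mem_W0Hom _)
    ⟨fun φ χ h => (LinearMap.liftBaseChangeEquiv ℂ).injective (congrArg Subtype.val h),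
      fun θ => by
        obtain ⟨φ, hφ⟩ := (LinearMap.liftBaseChangeEquiv (R := ℤ) (M := M) ℂ).surjective θ.1
        exact ⟨φ, Subtype.ext hφ⟩⟩

theorem liftW0_apply (hA : A.W (2 * p - 1) = ⊤) (φ : M →ₗ[ℤ] ℂ ⊗[ℤ] A.L) (m : M) :
    (liftW0 hA M φ).1 ((1 : ℂ) ⊗ₜ[ℤ] m) = φ m :=
  (LinearMap.liftBaseChange_tmul ..).trans (one_smul ℂ _)

/-- The homomorphism `θ ↦ (m ↦ [θ (m ⊗ 1)])` from `W_0 Hom(M ⊗ ℤ(-p), A)_ℂ` to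
`Hom(M, J^p(A))`. -/
noncomputable def evalTate (p : ℤ) (M : Type u) [AddCommGroup M] [Module.Finite ℤ M]
    (A : MHS.{u}) : W0Hom (tate p M) A →+ (M →ₗ[ℤ] J p A) where
  toFun θ := toJ p A ∘ₗ (θ.1.toAddMonoidHom.comp
    (TensorProduct.mk ℤ ℂ M 1).toAddMonoidHom).toIntLinearMap
  map_zero' := LinearMap.ext fun _ => map_zero (toJ p A)
  map_add' _ _ := LinearMap.ext fun _ => map_add (toJ p A) _ _

theorem evalTate_liftW0 (hA : A.W (2 * p - 1) = ⊤) (φ : M →ₗ[ℤ] ℂ ⊗[ℤ] A.L) :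
    evalTate p M A (liftW0 hA M φ) = toJ p A ∘ₗ φ :=
  LinearMap.ext fun m => congrArg (toJ p A) (liftW0_apply hA φ m)

/-- Equality of the two kernels yields the isomorphism of `Ext¹` with `Hom(M, J^p(A))`, and it lets
both groups use the same linear coordinates. -/
theorem twistHom_eq_zero_iff_evalTate (hA : A.W (2 * p - 1) = ⊤) [Module.Free ℤ M]
    (θ : W0Hom (tate p M) A) : twistHom (tate p M) A θ = 0 ↔ evalTate p M A θ = 0 := by
  rw [twistHom_tate_eq_zero_iff hA, LinearMap.ext_iff]
  rfl

/-- As `M` is free, homomorphisms `M → J^p(A)` lift to `A_ℂ`. -/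
theorem evalTate_surjective (hA : A.W (2 * p - 1) = ⊤) [Module.Free ℤ M] :
    Function.Surjective (evalTate p M A) := fun g => by
  obtain ⟨φ, hφ⟩ := Module.projective_lifting_property (toJ p A) g (Submodule.mkQ_surjective _)
  exact ⟨liftW0 hA M φ, (evalTate_liftW0 hA φ).trans hφ⟩

/-- The generator of `ℤ(-p)` identifies `Hom(ℤ, J^p(A))` with `J^p(A)`. -/
theorem exists_evalEquiv (p : ℤ) (A : MHS.{u}) :
    ∃ e : (ULift.{u} ℤ →ₗ[ℤ] J p A) ≃+ J p A, ∀ f, e f = f (ULift.up 1) := by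
  let ev : (ULift.{u} ℤ →ₗ[ℤ] J p A) →+ J p A :=
    { toFun := fun f => f (ULift.up 1)
      map_zero' := rfl
      map_add' := fun _ _ => rfl }
  refine ⟨AddEquiv.ofBijective ev ⟨fun f g h => LinearMap.ext fun m => ?_, fun a => ?_⟩,
    fun _ => rfl⟩
  · have hm : m = m.down • (ULift.up 1 : ULift.{u} ℤ) := ULift.ext _ _ (by simp)
    rw [hm, map_zsmul, map_zsmul]
    exact congrArg (m.down • ·) h
  · refine ⟨((zmultiplesHom (J p A) a).comp
      AddEquiv.ulift.toAddMonoidHom).toIntLinearMap, ?_⟩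
    change (1 : ℤ) • a = a
    exact one_zsmul a

instance free_ulift : Module.Free ℤ (ULift.{u} ℤ) :=
  Module.Free.of_equiv ULift.moduleEquiv.symm

/-- Carlson's map is an isomorphism. -/
theorem exists_carlsonEquiv (hA : A.W (2 * p - 1) = ⊤) :
    ∃ c : Ext (tateZ p) A ≃+ J p A, ∀ x, c x = carlson x := by
  have : Module.Free ℤ (tateZ.{u} p).L := free_ulift
  have hu := twistHom_surjective (C := tateZ p) (separated_tate hA (ULift ℤ))
  -- For `M = ℤ` the two quotients of `W_0 Hom` coincide; evaluation at the generator then turns the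
  -- isomorphism into Carlson's map.
  obtain ⟨e, he⟩ := exists_addEquiv_of_ker hu (evalTate_surjective (M := ULift.{u} ℤ) hA)
    (twistHom_eq_zero_iff_evalTate hA)
  obtain ⟨e', he'⟩ := exists_evalEquiv p A
  refine ⟨e.trans e', fun x => ?_⟩
  obtain ⟨θ, rfl⟩ := hu x
  exact ((congrArg e' (he θ)).trans (he' _)).trans (carlson_twistHom θ).symm

theorem restrictW0_hodgeIncl_apply (θ : W0Hom B A) (b : hodge p B) :
    (restrictW0 A (hodgeIncl p B) θ).1 ((1 : ℂ) ⊗ₜ[ℤ] b) = θ.1 ((1 : ℂ) ⊗ₜ[ℤ] (b : B.L)) :=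
  congrArg θ.1 (LinearMap.baseChange_tmul (A := ℂ) (hodgeIncl p B).toLin 1 b)

/-- The inclusion stays injective over `ℂ` and has a linear retraction `r`, which need not respect
`F`. The extension `η ∘ r` respects `W` automatically because `B` is pure and `A` has smaller
weights. -/
theorem restrictW0_surjective (h : Separated p B A) :
    Function.Surjective (restrictW0 A (hodgeIncl p B)) := fun η => by
  have hi : Function.Injective ((hodgeIncl p B).toLin.baseChange ℂ) :=
    baseChange_injective ℂ _ (Submodule.injective_subtype (hodge p B))
  obtain ⟨r, hr⟩ := LinearMap.exists_leftInverse_of_injective _ (LinearMap.ker_eq_bot.2 hi)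
  refine ⟨⟨η.1 ∘ₗ r, h.mem_W0Hom _⟩, Subtype.ext ?_⟩
  change (η.1 ∘ₗ r) ∘ₗ (hodgeIncl p B).toLin.baseChange ℂ = η.1
  rw [LinearMap.comp_assoc, hr, LinearMap.comp_id]

theorem carlson_pullback_classHomPart (b : hodge p B) (θ : W0Hom (hodgePart p B) A) :
    carlson (pullback (classHomPart b) (twistHom (hodgePart p B) A θ)) =
      evalTate p (hodge p B) A θ b :=
  carlson_pullback_twistHom (B := hodgePart p B) _ θ

theorem carlson_pullback_classHom (b : hodge p B) (θ : W0Hom B A) :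
    carlson (pullback (classHom b) (twistHom B A θ)) =
      evalTate p (hodge p B) A (restrictW0 A (hodgeIncl p B) θ) b :=
  (carlson_pullback_twistHom b θ).trans
    (congrArg (toJ p A) (restrictW0_hodgeIncl_apply θ b).symm)

end MHS

end HodgeExt

/-! ### Assembly of the proposition. -/

theorem mainTheorem12 (p : ℤ) (A B : MHS.{u})
    (hA : IsAddTorsionFree A.L) (hB : IsAddTorsionFree B.L)
    (hBpure : B.W (2 * p) = ⊤ ∧ B.W (2 * p - 1) = ⊥) (hAweights : A.W (2 * p - 1) = ⊤) :
    ∃ (S₁ : ComplexLie (Ext B A)) (S₂ : ComplexLie (hodge p B →ₗ[ℤ] J p A))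
      (S₃ : ComplexLie (Ext (hodgePart p B) A))
      (c : Ext (tateZ p) A ≃+ J p A)
      (γ : Ext B A →+ (hodge p B →ₗ[ℤ] J p A))
      (γbar : Ext (hodgePart p B) A ≃+ (hodge p B →ₗ[ℤ] J p A))
      (istar : Ext B A →+ Ext (hodgePart p B) A),
      S₁.IsQuotient (fun θ : W0Hom B A => Ext.mk (Extension.ofTwist θ)) ∧
      S₂.IsQuotient (fun φ : hodge p B →ₗ[ℤ] ℂ ⊗[ℤ] A.L => toJ p A ∘ₗ φ) ∧
      S₃.IsQuotient (fun θ : W0Hom (hodgePart p B) A => Ext.mk (Extension.ofTwist θ)) ∧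
      (∀ x, c x = Ext.carlson x) ∧
      (∀ x b, γ x b = Ext.carlson (Ext.pullback (classHom b) x)) ∧
      (∀ x b, γbar x b = Ext.carlson (Ext.pullback (classHomPart b) x)) ∧
      (∀ x, istar x = Ext.pullback (hodgeIncl p B) x) ∧
      S₁.Holomorphic S₂ γ ∧
      S₃.Holomorphic S₂ γbar ∧ S₂.Holomorphic S₃ γbar.symm ∧
      S₁.Holomorphic S₃ istar ∧
      Function.Surjective istar ∧
      ∀ x, γbar (istar x) = γ x := by
  have hsB : Separated p B A := ⟨hBpure.1, hBpure.2, hAweights⟩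
  have hsM : Separated p (hodgePart p B) A := separated_tate hAweights _
  -- A subgroup of a finitely generated torsion-free group is again finitely generated and
  -- torsion-free, hence free.
  have hM : Module.Free ℤ (hodge p B) := inferInstance
  have hM' : Module.Free ℤ (hodgePart p B).L := hM
  have hu₁ := Ext.twistHom_surjective hsB
  have hu₃ := Ext.twistHom_surjective hsM
  have hu₂ := evalTate_surjective (M := hodge p B) hAweights
  have hk := twistHom_eq_zero_iff_evalTate (M := hodge p B) hAweights
  obtain ⟨c, hc⟩ := exists_carlsonEquiv hAweights
  obtain ⟨γbar, hγbar⟩ := exists_addEquiv_of_ker hu₃ hu₂ hk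
  let r := Ext.restrictW0 A (hodgeIncl p B)
  have hi : ∀ θ, Ext.pullback (hodgeIncl p B) (Ext.twistHom B A θ) = Ext.twistHom (hodgePart p B) A (r θ) :=
    Ext.pullback_twistHom _
  -- Pullback is additive because restriction of `θ` is additive and every class has the form
  -- `[H_θ]`.
  let istar : Ext B A →+ Ext (hodgePart p B) A := AddMonoidHom.mk' (Ext.pullback (hodgeIncl p B))
    (map_add_of_comp hu₁ ((Ext.twistHom (hodgePart p B) A).comp r.toAddMonoidHom) hi)
  -- With `γ` defined as the composition, the factorization holds by construction; what remains to
  -- be verified is the formula for `γ` in terms of pullbacks.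
  let γ : Ext B A →+ (hodge p B →ₗ[ℤ] J p A) := γbar.toAddMonoidHom.comp istar
  have hγ : ∀ θ, γ (Ext.twistHom B A θ) = evalTate p (hodge p B) A (r θ) := fun θ =>
    (congrArg γbar (hi θ)).trans (hγbar _)
  obtain ⟨d₁, q₁, hq₁, hF₁, ε₁, hε₁, hd₁⟩ := hsB.exists_coordinates
  obtain ⟨d₃, q₃, hq₃, hF₃, ε₃, hε₃, hd₃⟩ := hsM.exists_coordinates
  have hz₁ : ∀ θ, q₁ θ = 0 → Ext.twistHom B A θ = 0 := fun θ h =>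
    (Ext.twistHom_eq_zero_iff hsB θ).2 ⟨0, by rw [map_zero, add_zero]; exact (hF₁ θ).1 h⟩
  have hz₃ : ∀ θ, q₃ θ = 0 → Ext.twistHom (hodgePart p B) A θ = 0 := fun θ h =>
    (Ext.twistHom_eq_zero_iff hsM θ).2 ⟨0, by rw [map_zero, add_zero]; exact (hF₃ θ).1 h⟩
  obtain ⟨t₁, U₁, hU₁⟩ := exists_uniformization _ hu₁ q₁ hq₁ hz₁ hε₁ fun θ h =>
    hd₁ θ ((Ext.twistHom_eq_zero_iff hsB θ).1 h)
  -- The coordinates `q₃` serve `Hom(B_ℤ^{p,p}, J^p(A))` too, since by `hk` it is a quotient of `W_0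
  -- Hom(B_ℤ^{p,p}, A)_ℂ` by the same subgroup.
  obtain ⟨t₂, U₂, hU₂⟩ := exists_uniformization _ hu₂ q₃ hq₃ (fun θ h => (hk θ).1 (hz₃ θ h)) hε₃
    fun θ h => hd₃ θ ((Ext.twistHom_eq_zero_iff hsM θ).1 ((hk θ).2 h))
  obtain ⟨t₃, U₃, hU₃⟩ := exists_uniformization _ hu₃ q₃ hq₃ hz₃ hε₃ fun θ h =>
    hd₃ θ ((Ext.twistHom_eq_zero_iff hsM θ).1 h)
  have hfin₁ : Module.Finite ℂ (W0Hom B A) := inferInstance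
  have hfin₃ : Module.Finite ℂ (W0Hom (hodgePart p B) A) := inferInstance
  let e : (hodge p B →ₗ[ℤ] ℂ ⊗[ℤ] A.L) ≃ₗ[ℂ] W0Hom (hodgePart p B) A :=
    liftW0 hAweights (hodge p B)
  have hfin₂ : Module.Finite ℂ (hodge p B →ₗ[ℤ] ℂ ⊗[ℤ] A.L) := Module.Finite.equiv e.symm
  refine ⟨U₁.complexLie, U₂.complexLie, U₃.complexLie, c, γ, γbar, istar, ?_, ?_, ?_, hc,
    fun x b => ?_, fun x b => ?_, fun x => rfl, ?_, ?_, ?_, ?_, ?_, fun x => rfl⟩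
  · have h := U₁.isQuotient (V := W0Hom B A) q₁ hq₁
    have h' : (fun θ => U₁.π (q₁ θ)) = Ext.twistHom B A := funext hU₁
    rwa [h'] at h
  -- The source asked for is `Hom(B_ℤ^{p,p}, A_ℂ)`, so `q₃` is transported along the linear
  -- isomorphism `e`.
  · have h := U₂.isQuotient (q₃ ∘ₗ e.toLinearMap) (hq₃.comp e.surjective)
    have h' : (fun φ => U₂.π ((q₃ ∘ₗ e.toLinearMap) φ)) = fun φ => toJ p A ∘ₗ φ :=
      funext fun φ => (hU₂ (e φ)).trans (evalTate_liftW0 hAweights φ)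
    rwa [h'] at h
  · have h := U₃.isQuotient (V := W0Hom (hodgePart p B) A) q₃ hq₃
    have h' : (fun θ => U₃.π (q₃ θ)) = Ext.twistHom (hodgePart p B) A := funext hU₃
    rwa [h'] at h
  · obtain ⟨θ, rfl⟩ := hu₁ x
    exact (LinearMap.congr_fun (hγ θ) b).trans (carlson_pullback_classHom b θ).symm
  · obtain ⟨θ, rfl⟩ := hu₃ x
    exact (LinearMap.congr_fun (hγbar θ) b).trans (carlson_pullback_classHomPart b θ).symm
  · exact U₁.holomorphic_of_lift U₂ (u := Ext.twistHom B A) (u' := evalTate p (hodge p B) A)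
      (q' := q₃) (f := γ) hq₁ hU₁ hU₂ r hγ
  -- Both `γ̄` and its inverse are covered by the identity of `W_0 Hom(B_ℤ^{p,p}, A)_ℂ`.
  · exact U₃.holomorphic_of_lift U₂ (u := Ext.twistHom (hodgePart p B) A)
      (u' := evalTate p (hodge p B) A) (q' := q₃) (f := γbar) hq₃ hU₃ hU₂ LinearMap.id hγbar
  · exact U₂.holomorphic_of_lift U₃ (u := evalTate p (hodge p B) A)
      (u' := Ext.twistHom (hodgePart p B) A) (q' := q₃) (f := γbar.symm) hq₃ hU₂ hU₃ LinearMap.id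
      fun θ => γbar.symm_apply_eq.2 (hγbar θ).symm
  · exact U₁.holomorphic_of_lift U₃ (u := Ext.twistHom B A) (u' := Ext.twistHom (hodgePart p B) A)
      (q' := q₃) (f := istar) hq₁ hU₁ hU₃ r hi
  · intro y
    obtain ⟨η, rfl⟩ := hu₃ y
    obtain ⟨θ, rfl⟩ := restrictW0_surjective hsB η
    exact ⟨Ext.twistHom B A θ, hi θ⟩
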